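/- Let $m>0$ and consider the Schwarzschild spacetime $r>2m$ with metric $$g=-\Big(1-\frac{2m}{r}\Big)dt^2+\Big(1-\frac{2m}{r}\Big)^{-1}dr^2+r^2\sigma ,$$ where $\sigma$ is the standard metric of $\mathbb S^2$ and $\partial_t$ is future pointing. Put $s=1/r$, $v=t-r_*$ with $r_*=r+2m\log(\frac r{2m}-1)$, and use $(\mathbf y,s,v)$, $\mathbf y\in\mathbb S^2$, as coordinates. Let $f$ be a smooth function on $\mathbb S^2$, let $0<\tau_1<\tau_2<\infty$, and for $\tau>0$ set $$P(\mathbf y,s,\tau)=f+s\,\phi+\tfrac12 s^2\psi,\qquad \phi=-\tfrac12\big(\tau^2+|\widetilde\nabla f|^2\big),\qquad \psi=\tfrac12\big(\tau^2\widetilde\Delta f+\langle\widetilde\nabla|\widetilde\nabla f|^2,\widetilde\nabla f\rangle\big),$$ where $\widetilde\nabla,\widetilde\Delta$, the norm and the inner product are those of $(\mathbb S^2,\sigma)$. Let $\Sigma_\tau=\{v=-P(\mathbf y,s,\tau)\}$. Then there is $s_0\in(0,\frac1{2m})$, depending only on $m$, $\tau_1$, $\tau_2$ and $f$, such that the following hold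 in $0<s<s_0$. The surfaces $\Sigma_\tau$, $\tau\in(\tau_1,\tau_2)$, foliate an open region $\Omega$, which is parametrized by $(\mathbf y,s,\tau)\in\mathbb S^2\times(0,s_0)\times(\tau_1,\tau_2)$ and on which $\tau$ is a smooth function with timelike gradient. Each $\Sigma_\tau$ is spacelike. Let $\nabla$ be the Levi-Civita connection of $g$, let $\alpha=(-g(\nabla\tau,\nabla\tau))^{-1/2}$ be the lapse of $\tau$, let $T=-\alpha\nabla\tau$, which is the future pointing unit normal of the surfaces $\Sigma_\tau$, let $\Theta=g+2\,\omega\otimes\omega$ with $\omega=g(T,\cdot)$, and let $\vec H_{\tau,s}$ be the mean curvature vector of the surface $\{\tau=\mathrm{const},\ s=\mathrm{const}\}$. Then $$\alpha,\quad \alpha^{-1},\quad \|\nabla\alpha\|_\Theta,\quad \|\nabla T\|_\Theta,\quad \|\nabla\nabla T\|_\Theta,\quad \|\vec H_{\tau,s}\|_\Theta$$ are uniformly bounded on $\mathbb S^2\times(0,s_0)\times(\tau_1,\tau_2)$. Moreover the mean curvature $H$ of $\Sigma_\tau$, which is one third of the trace of the second fundamental form $\mathcal K(X,Y)=g(\nabla_XT,Y)$,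 satisfies $$H=\tau^{-1}+s\,\Lambda(\mathbf y,s,\tau)$$ for a function $\Lambda$ that is smooth on $\mathbb S^2\times[0,s_0]\times[\tau_1,\tau_2]$; in particular $H=\tau^{-1}+O(s)$ uniformly. -/

import Mathlib

open scoped Manifold ContDiff

noncomputable section

/-- Euclidean three-space. -/
abbrev E3 : Type := EuclideanSpace ℝ (Fin 3)

/-- The unit sphere of Euclidean three-space, with Mathlib's smooth structure. -/
abbrev S2 : Type := Metric.sphere (0 : E3) 1

/-- Spacetime coordinates `(t, x¹, x², x³)`; index `0` is the time `t`. -/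
abbrev R4 : Type := Fin 4 → ℝ

/-! ### Calculus on the round sphere -/

/-- The radial projection `x ↦ x / |x|` onto the unit sphere. (At the origin it has an irrelevant
value.) -/
def dir (x : E3) : S2 :=
  if h : x = 0 then ⟨EuclideanSpace.single 0 1, by simp⟩
  else ⟨‖x‖⁻¹ • x, by simp [norm_smul, h]⟩

/-- The extension of a function on the sphere that is constant along rays from the origin. -/
def homExt (f : S2 → ℝ) : E3 → ℝ := fun x => f (dir x)

/-- The gradient of `f` for the round metric, as a vector of `ℝ³` tangent to the sphere at `y`:
the extension of `f` is constant along rays, so its Euclidean gradient at `y` is tangent to the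
sphere and restricts there to the differential of `f`. -/
def sphereGrad (f : S2 → ℝ) (y : S2) : E3 := gradient (homExt f) (y : E3)

/-- The Laplace-Beltrami operator of the round metric (trace of the Hessian): in polar coordinates
the Euclidean Laplacian is `∂_r² + 2 r⁻¹ ∂_r + r⁻²` times the spherical one, and the extension of
`f` does not depend on `r`. -/
def sphereLaplacian (f : S2 → ℝ) (y : S2) : ℝ := Laplacian.laplacian (homExt f) (y : E3)

/-- `|∇f|²` on the round sphere. -/
def sphereGradSq (f : S2 → ℝ) (y : S2) : ℝ := ‖sphereGrad f y‖ ^ 2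

/-! ### The functions `φ`, `ψ`, `P` -/

def phiFun (f : S2 → ℝ) (τ : ℝ) (y : S2) : ℝ :=
  -(1 / 2) * (τ ^ 2 + sphereGradSq f y)

def psiFun (f : S2 → ℝ) (τ : ℝ) (y : S2) : ℝ :=
  (1 / 2) * (τ ^ 2 * sphereLaplacian f y
    + inner ℝ (sphereGrad (sphereGradSq f) y) (sphereGrad f y))

/-- `P(y, s, τ) = f(y) + s φ(τ, y) + (1/2) s² ψ(τ, y)`. -/
def heightP (f : S2 → ℝ) (y : S2) (s τ : ℝ) : ℝ :=
  f y + s * phiFun f τ y + (1 / 2) * s ^ 2 * psiFun f τ y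

/-! ### Semi-Riemannian geometry of a metric on (an open part of) `ℝ⁴`

A metric is given by its values `g p u w` on tangent vectors `u, w` at `p`. -/

/-- The coordinate vector `∂_a`. -/
def coordVec (a : Fin 4) : R4 := Pi.single a 1

/-- The partial derivative `∂_a h`. -/
def pd (a : Fin 4) (h : R4 → ℝ) (p : R4) : ℝ := fderiv ℝ h p (coordVec a)

/-- The matrix `(g_{ab})` of a metric. -/
def gram (g : R4 → R4 → R4 → ℝ) (p : R4) : Matrix (Fin 4) (Fin 4) ℝ :=
  Matrix.of fun a b => g p (coordVec a) (coordVec b)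

/-- The inverse matrix `(g^{ab})`. -/
def gramInv (g : R4 → R4 → R4 → ℝ) (p : R4) : Matrix (Fin 4) (Fin 4) ℝ := (gram g p)⁻¹

/-- The Christoffel symbol `Γ^c_{ab}` of the Levi-Civita connection. -/
def christoffel (g : R4 → R4 → R4 → ℝ) (p : R4) (c a b : Fin 4) : ℝ :=
  (1 / 2) * ∑ d, gramInv g p c d *
    (pd a (fun q => gram g q b d) p + pd b (fun q => gram g q a d) p
      - pd d (fun q => gram g q a b) p)

/-- The gradient of a function, `g^{cd} ∂_d h`. -/
def metricGrad (g : R4 → R4 → R4 → ℝ) (h : R4 → ℝ) (p : R4) : R4 :=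
  fun c => ∑ d, gramInv g p c d * pd d h p

/-- The covariant derivative `∇X` of a vector field: entry `b c` is the `c`-component of
`∇_{∂_b} X`. -/
def covDeriv (g : R4 → R4 → R4 → ℝ) (X : R4 → R4) (p : R4) (b c : Fin 4) : ℝ :=
  pd b (fun q => X q c) p + ∑ d, christoffel g p c b d * X p d

/-- The vector `∇_u X` at `p`. -/
def covAlong (g : R4 → R4 → R4 → ℝ) (X : R4 → R4) (p u : R4) : R4 :=
  fun c => ∑ b, u b * covDeriv g X p b c

/-- The second covariant derivative `∇∇X` of a vector field, that is, the covariant derivative of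
the tensor `∇X`: entry `a b c` is the `c`-component of `(∇_{∂_a} (∇X))(∂_b)`. -/
def covDeriv2 (g : R4 → R4 → R4 → ℝ) (X : R4 → R4) (p : R4) (a b c : Fin 4) : ℝ :=
  pd a (fun q => covDeriv g X q b c) p
    + ∑ d, christoffel g p c a d * covDeriv g X p b d
    - ∑ d, christoffel g p d a b * covDeriv g X p d c

/-! ### Level sets of a time function -/

/-- The lapse `α = (-g(∇τ, ∇τ))^{-1/2}` of a time function. -/
def lapse (g : R4 → R4 → R4 → ℝ) (tau : R4 → ℝ) (p : R4) : ℝ :=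
  (Real.sqrt (-(g p (metricGrad g tau p) (metricGrad g tau p))))⁻¹

/-- The unit normal `T = -α ∇τ` of the level sets of a time function. -/
def unitNormal (g : R4 → R4 → R4 → ℝ) (tau : R4 → ℝ) (p : R4) : R4 :=
  (-(lapse g tau p)) • metricGrad g tau p

/-- The bilinear form `Θ = g + 2 ω ⊗ ω`, where `ω = g(T, ·)`. -/
def thetaMetric (g : R4 → R4 → R4 → ℝ) (T : R4 → R4) (p u w : R4) : ℝ :=
  g p u w + 2 * g p (T p) u * g p (T p) w

/-- The norm of a vector for a Riemannian metric `θ`. -/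
def vecNorm (θ : R4 → R4 → R4 → ℝ) (p V : R4) : ℝ := Real.sqrt (θ p V V)

/-- The norm of a tensor `A_a{}^c` for a Riemannian metric `θ`. -/
def tensorNorm1 (θ : R4 → R4 → R4 → ℝ) (p : R4) (A : Fin 4 → Fin 4 → ℝ) : ℝ :=
  Real.sqrt (∑ a, ∑ a', ∑ c, ∑ c',
    gramInv θ p a a' * gram θ p c c' * A a c * A a' c')

/-- The norm of a tensor `A_{ab}{}^c` for a Riemannian metric `θ`. -/
def tensorNorm2 (θ : R4 → R4 → R4 → ℝ) (p : R4) (A : Fin 4 → Fin 4 → Fin 4 → ℝ) : ℝ :=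
  Real.sqrt (∑ a, ∑ a', ∑ b, ∑ b', ∑ c, ∑ c',
    gramInv θ p a a' * gramInv θ p b b' * gram θ p c c' * A a b c * A a' b' c')

/-- The mean curvature of the spacelike hypersurface with timelike unit normal field `T`: one third
of the trace, for the induced metric, of the second fundamental form `K(X, Y) = g(∇_X T, Y)`. The
inverse of the induced metric is `g^{ab} + T^a T^b`. -/
def meanCurvature (g : R4 → R4 → R4 → ℝ) (T : R4 → R4) (p : R4) : ℝ :=
  (1 / 3) * ∑ a, ∑ b, (gramInv g p a b + T p a * T p b) *
    g p (covAlong g T p (coordVec a)) (coordVec b)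

/-- `N` is the mean curvature vector at `p` of the spacelike surface `h₁ = const, h₂ = const`
through `p`: for a smooth local frame `W₁, W₂` of orthonormal vector fields tangent to the
surfaces `h₁ = const, h₂ = const`, it is the part of `∇_{W₁} W₁ + ∇_{W₂} W₂` normal to the
surface. -/
def IsMeanCurvatureVector (g : R4 → R4 → R4 → ℝ) (h₁ h₂ : R4 → ℝ) (p N : R4) : Prop :=
  ∃ W : Fin 2 → R4 → R4,
    (∀ A, ContDiffAt ℝ ∞ (W A) p) ∧
    (∀ᶠ q in nhds p,
      (∀ A, fderiv ℝ h₁ q (W A q) = 0 ∧ fderiv ℝ h₂ q (W A q) = 0) ∧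
      (∀ A B, g q (W A q) (W B q) = if A = B then 1 else 0)) ∧
    N = (∑ A, covAlong g (W A) p (W A p))
      - ∑ B, g p (∑ A, covAlong g (W A) p (W A p)) (W B p) • W B p

/-! ### The Schwarzschild spacetime -/

/-- The spatial part `x` of `(t, x)`. -/
def spatial (p : R4) : E3 := WithLp.toLp 2 fun i => p i.succ

/-- The differential of `r = |x|` at `p`, evaluated on `u`. -/
def drForm (p u : R4) : ℝ := inner ℝ (spatial p) (spatial u) / ‖spatial p‖

/-- The Schwarzschild metric `-(1 - 2m/r) dt² + (1 - 2m/r)⁻¹ dr² + r² σ` of mass `m` on `r > 2m`,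
in the coordinates `(t, x)` with `r = |x|`. Here `r² σ` is the Euclidean metric minus `dr²`. -/
def gSch (m : ℝ) (p u w : R4) : ℝ :=
  -(1 - 2 * m / ‖spatial p‖) * (u 0 * w 0)
    + (1 - 2 * m / ‖spatial p‖)⁻¹ * (drForm p u * drForm p w)
    + (inner ℝ (spatial u) (spatial w) - drForm p u * drForm p w)

/-- `r_* = r + 2m log (r/(2m) - 1)`. -/
def rStar (m r : ℝ) : ℝ := r + 2 * m * Real.log (r / (2 * m) - 1)

/-- The spherical coordinate `y = x/|x|`. -/
def yCoord (p : R4) : S2 := dir (spatial p)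

/-- The coordinate `s = 1/r`. -/
def sCoord (p : R4) : ℝ := ‖spatial p‖⁻¹

/-- The retarded null coordinate `v = t - r_*`. -/
def vCoord (m : ℝ) (p : R4) : ℝ := p 0 - rStar m ‖spatial p‖

/-- The part of `Σ_τ = {v = -P(y, s, τ)}` in `0 < s < s₀`. -/
def leaf (m : ℝ) (f : S2 → ℝ) (s₀ τ : ℝ) : Set R4 :=
  {p | 0 < sCoord p ∧ sCoord p < s₀ ∧ vCoord m p = -(heightP f (yCoord p) (sCoord p) τ)}

/-- The region swept out by the leaves `Σ_τ`, `τ₁ < τ < τ₂`, in `0 < s < s₀`. -/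
def foliatedRegion (m : ℝ) (f : S2 → ℝ) (τ₁ τ₂ s₀ : ℝ) : Set R4 :=
  ⋃ τ ∈ Set.Ioo τ₁ τ₂, leaf m f s₀ τ

end

/-! The idea is to find a frame in which nothing is singular as `s → 0`. Such a frame is
`nullFrame`: the fields `s ∂_v` and `s ∂_s` of the coordinates `(y, s, v)`, and the projections of
the three Cartesian coordinate vectors to the spheres `r = const`. These five fields are linearly
dependent but globally defined, so no charts of the sphere are needed. Their products, the
coefficients of the inverse metric and the products of their brackets with the frame are polynomials
in `y`, `s` and `m`.

The equation `v = -P` is affine in `τ²`, so it can be solved for `τ` (`timeFun`). Differentiating it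
along the frame produces a factor `s` on both sides; after cancelling it, the derivatives of `τ` are
smooth functions of `(y, s, τ)` up to `s = 0` (`fderiv_timeFun_nullFrame`). Hence the functions that
extend smoothly in `(y, s, τ)` to the compact set `𝕊² × [0, s₀] × [τ₁, τ₂]` form an algebra of
bounded functions that is stable under the frame (`IsLeafCoord.admissibleFrame`). By the Koszul
formula the Levi-Civita connection preserves the vector fields with coefficients in this algebra
(`AdmissibleFrame.covAlong_field`). Once `α` is known to lie in the algebra, so do the squares of
all the `Θ`-norms to be estimated.

The function `φ` is chosen so that `-g(∇τ, ∇τ)` equals `τ⁻² (|∇f|² + τ²) - τ⁻² |∇f|² = 1` at `s = 0`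
(`lapseInvSq_zero`). By compactness it stays positive for small `s₀`, which makes `α` and `α⁻¹`
members of the algebra and, by the reversed Cauchy-Schwarz inequality, the leaves spacelike. The
mean curvature vector is computed from the normal bundle alone, spanned by `T` and the dual of
`ds/s`, whose Gram determinant does not vanish up to `s = 0`.

In Cartesian coordinates the Schwarzschild volume density is constant, so `3H` is the Euclidean
divergence `∑ ∂_a T^a`. It is evaluated modulo `s` times the algebra, an ideal stable under the
frame because the frame maps `s` to `0` or to `s`. The result is `3 τ⁻¹` (`eqModS_divergence`), and
the smooth quotient by `s` yields `Λ`. The function `ψ` enters only this remainder. -/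

open Filter Topology

/-! ### Levi-Civita calculus in coordinates. -/

/-- A field of symmetric bilinear forms on `ℝ⁴` that is smooth and nondegenerate on `Ω`. -/
structure IsMetricOn (g : R4 → R4 → R4 → ℝ) (Ω : Set R4) : Prop where
  apply_eq : ∀ p u w, g p u w = ∑ a, ∑ b, gram g p a b * u a * w b
  symm : ∀ p u w, g p u w = g p w u
  smooth : ∀ p ∈ Ω, ∀ a b, ContDiffAt ℝ ∞ (fun q => gram g q a b) p
  isUnit_det : ∀ p ∈ Ω, IsUnit (gram g p).det

/-- The derivative of the components of a metric in the direction `u`, as a bilinear form. -/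
noncomputable def metricDeriv (g : R4 → R4 → R4 → ℝ) (p u w z : R4) : ℝ :=
  ∑ a, ∑ b, fderiv ℝ (fun q => gram g q a b) p u * w a * z b

/-- The bilinear map `Γ^c_{ab} u^a w^b`. -/
noncomputable def christoffelVec (g : R4 → R4 → R4 → ℝ) (p u w : R4) : R4 :=
  fun c => ∑ a, ∑ b, christoffel g p c a b * u a * w b

/-- The Lie bracket `[X, Y]` of vector fields. -/
noncomputable def bracket (X Y : R4 → R4) (p : R4) : R4 :=
  fderiv ℝ Y p (X p) - fderiv ℝ X p (Y p)

theorem sum_smul_coordVec (u : R4) : ∑ a, u a • coordVec a = u := by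
  ext c
  simp [coordVec, Finset.sum_apply, Pi.single_apply]

theorem sum_mul_clm_coordVec (L : R4 →L[ℝ] ℝ) (u : R4) : ∑ a, u a * L (coordVec a) = L u := by
  conv_rhs => rw [← sum_smul_coordVec u, map_sum]
  simp

theorem pd_component {X : R4 → R4} {p : R4} (hX : DifferentiableAt ℝ X p) (b c : Fin 4) :
    pd b (fun q => X q c) p = fderiv ℝ X p (coordVec b) c := by
  unfold pd
  rw [fderiv_apply hX]; rfl

theorem fderiv_component {X : R4 → R4} {p : R4} (hX : DifferentiableAt ℝ X p) (u : R4)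
    (c : Fin 4) : fderiv ℝ (fun q => X q c) p u = fderiv ℝ X p u c := by
  rw [fderiv_apply hX]; rfl

/-- Separating the flat derivative from the Christoffel term allows identities for the connection to
be checked without coordinate indices. -/
theorem covAlong_eq (g : R4 → R4 → R4 → ℝ) {X : R4 → R4} {p : R4}
    (hX : DifferentiableAt ℝ X p) (u : R4) :
    covAlong g X p u = fderiv ℝ X p u + christoffelVec g p u (X p) := by
  ext c
  simp only [covAlong, covDeriv, christoffelVec, Pi.add_apply, mul_add, Finset.sum_add_distrib,
    Finset.mul_sum]
  congr 1
  · rw [← fderiv_component hX, ← sum_mul_clm_coordVec]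
    rfl
  · refine Finset.sum_congr rfl fun a _ => Finset.sum_congr rfl fun b _ => by ring

namespace IsMetricOn

variable {g : R4 → R4 → R4 → ℝ} {Ω : Set R4} (hg : IsMetricOn g Ω)
include hg

theorem gram_symm (p : R4) (a b : Fin 4) : gram g p a b = gram g p b a := hg.symm _ _ _

theorem add_left (p u v w : R4) : g p (u + v) w = g p u w + g p v w := by
  simp only [hg.apply_eq, Pi.add_apply, ← Finset.sum_add_distrib]
  refine Finset.sum_congr rfl fun a _ => Finset.sum_congr rfl fun b _ => by ring

theorem smul_left (p : R4) (c : ℝ) (u w : R4) : g p (c • u) w = c * g p u w := by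
  simp only [hg.apply_eq, Pi.smul_apply, smul_eq_mul, Finset.mul_sum]
  refine Finset.sum_congr rfl fun a _ => Finset.sum_congr rfl fun b _ => by ring

theorem add_right (p u v w : R4) : g p u (v + w) = g p u v + g p u w := by
  rw [hg.symm, hg.add_left, hg.symm _ v, hg.symm _ w]

theorem smul_right (p : R4) (c : ℝ) (u w : R4) : g p u (c • w) = c * g p u w := by
  rw [hg.symm, hg.smul_left, hg.symm]

theorem sub_left (p u v w : R4) : g p (u - v) w = g p u w - g p v w := by
  rw [sub_eq_add_neg, ← neg_one_smul ℝ v, hg.add_left, hg.smul_left]; ring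

theorem sub_right (p u v w : R4) : g p u (v - w) = g p u v - g p u w := by
  rw [hg.symm, hg.sub_left, hg.symm _ v, hg.symm _ w]

theorem sum_left {ι : Type*} (s : Finset ι) (p : R4) (u : ι → R4) (w : R4) :
    g p (∑ i ∈ s, u i) w = ∑ i ∈ s, g p (u i) w := by
  classical
  induction s using Finset.induction_on with
  | empty => simp [hg.apply_eq]
  | insert i s hi ih => rw [Finset.sum_insert hi, Finset.sum_insert hi, hg.add_left, ih]

theorem sum_right {ι : Type*} (s : Finset ι) (p : R4) (w : R4) (u : ι → R4) :
    g p w (∑ i ∈ s, u i) = ∑ i ∈ s, g p w (u i) := by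
  rw [hg.symm, hg.sum_left]
  exact Finset.sum_congr rfl fun i _ => hg.symm _ _ _

theorem apply_coordVec_right (p u : R4) (b : Fin 4) :
    g p u (coordVec b) = ∑ a, gram g p a b * u a := by
  rw [hg.apply_eq]
  refine Finset.sum_congr rfl fun a _ => ?_
  simp [coordVec, Pi.single_apply]

theorem gram_mul_gramInv {p : R4} (hp : p ∈ Ω) : gram g p * gramInv g p = 1 :=
  Matrix.mul_nonsing_inv _ (hg.isUnit_det p hp)

theorem gramInv_mul_gram {p : R4} (hp : p ∈ Ω) : gramInv g p * gram g p = 1 :=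
  Matrix.nonsing_inv_mul _ (hg.isUnit_det p hp)

theorem gramInv_symm (p : R4) (a b : Fin 4) : gramInv g p a b = gramInv g p b a := by
  have : (gram g p).transpose = gram g p := by ext a b; exact hg.gram_symm p b a
  have h2 : (gramInv g p).transpose = gramInv g p := by
    rw [gramInv, Matrix.transpose_nonsing_inv, this]
  exact congrFun (congrFun h2 b) a

/-- Raising the index of `ξ` and pairing with `z` gives `ξ(z)`. -/
theorem apply_raise {p : R4} (hp : p ∈ Ω) (ξ : Fin 4 → ℝ) (z : R4) :
    g p (fun c => ∑ d, gramInv g p c d * ξ d) z = ∑ a, ξ a * z a := by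
  have key : ∀ b d, ∑ a, gram g p b a * gramInv g p a d = if b = d then 1 else 0 := by
    intro b d
    have := congrFun (congrFun (hg.gram_mul_gramInv hp) b) d
    rwa [Matrix.mul_apply, Matrix.one_apply] at this
  rw [hg.symm, hg.apply_eq]
  refine Finset.sum_congr rfl fun b _ => ?_
  calc ∑ a, gram g p b a * z b * ∑ d, gramInv g p a d * ξ d
      = ∑ a, ∑ d, z b * ξ d * (gram g p b a * gramInv g p a d) := by
        refine Finset.sum_congr rfl fun a _ => ?_
        rw [Finset.mul_sum]
        exact Finset.sum_congr rfl fun d _ => by ring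
    _ = ∑ d, z b * ξ d * ∑ a, gram g p b a * gramInv g p a d := by
        rw [Finset.sum_comm]
        exact Finset.sum_congr rfl fun d _ => by rw [Finset.mul_sum]
    _ = ξ b * z b := by
        simp only [key]
        simp [mul_comm]

theorem eq_of_apply_eq {p : R4} (hp : p ∈ Ω) {u v : R4} (h : ∀ z, g p u z = g p v z) :
    u = v := by
  have hmul : ∀ w : R4, (gram g p).mulVec w = fun b => g p w (coordVec b) := by
    intro w
    ext b
    rw [hg.apply_coordVec_right]
    change ∑ a, gram g p b a * w a = _
    refine Finset.sum_congr rfl fun a _ => ?_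
    rw [hg.gram_symm p b a]
  have : (gram g p).mulVec u = (gram g p).mulVec v := by
    rw [hmul, hmul]
    ext b
    exact h _
  calc u = (gramInv g p * gram g p).mulVec u := by rw [hg.gramInv_mul_gram hp, Matrix.one_mulVec]
    _ = (gramInv g p * gram g p).mulVec v := by
      rw [← Matrix.mulVec_mulVec, this, Matrix.mulVec_mulVec]
    _ = v := by rw [hg.gramInv_mul_gram hp, Matrix.one_mulVec]

theorem apply_metricGrad {p : R4} (hp : p ∈ Ω) (h : R4 → ℝ) (u : R4) :
    g p (metricGrad g h p) u = fderiv ℝ h p u := by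
  rw [← sum_mul_clm_coordVec]
  unfold metricGrad
  rw [hg.apply_raise hp]
  exact Finset.sum_congr rfl fun a _ => mul_comm _ _

theorem metricDeriv_symm (p u w z : R4) : metricDeriv g p u w z = metricDeriv g p u z w := by
  unfold metricDeriv
  rw [Finset.sum_comm]
  refine Finset.sum_congr rfl fun a _ => Finset.sum_congr rfl fun b _ => ?_
  have : (fun q => gram g q b a) = fun q => gram g q a b := by ext q; exact hg.gram_symm q b a
  rw [this]; ring

theorem fderiv_apply_apply {p : R4} (hp : p ∈ Ω) {X Y : R4 → R4}
    (hX : DifferentiableAt ℝ X p) (hY : DifferentiableAt ℝ Y p) (u : R4) :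
    fderiv ℝ (fun q => g q (X q) (Y q)) p u =
      metricDeriv g p u (X p) (Y p) + g p (fderiv ℝ X p u) (Y p) + g p (X p) (fderiv ℝ Y p u) := by
  have hd : ∀ a b, HasFDerivAt (fun q => gram g q a b * X q a * Y q b) _ p := fun a b =>
    ((((hg.smooth p hp a b).differentiableAt (by simp)).hasFDerivAt.mul
      (hasFDerivAt_pi'.1 hX.hasFDerivAt a)).mul (hasFDerivAt_pi'.1 hY.hasFDerivAt b))
  have h2 := HasFDerivAt.fun_sum (u := Finset.univ) fun a _ =>
    HasFDerivAt.fun_sum (u := Finset.univ) fun b _ => hd a b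
  have h3 : (fun q => g q (X q) (Y q)) = fun q => ∑ a, ∑ b, gram g q a b * X q a * Y q b := by
    ext q
    rw [hg.apply_eq]
  rw [h3, h2.fderiv]
  simp only [metricDeriv, hg.apply_eq, ← Finset.sum_add_distrib, _root_.sum_apply]
  refine Finset.sum_congr rfl fun a _ => Finset.sum_congr rfl fun b _ => ?_
  simp
  ring

/-- Lowering the upper index cancels the inverse metric, so only first derivatives of the metric
remain. Both metric compatibility and the Koszul formula become linear algebra from here. -/
theorem apply_christoffelVec {p : R4} (hp : p ∈ Ω) (u w z : R4) :
    g p (christoffelVec g p u w) z = (1 / 2) *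
      (metricDeriv g p u w z + metricDeriv g p w u z - metricDeriv g p z u w) := by
  have h1 : christoffelVec g p u w = fun c => ∑ d, gramInv g p c d *
      ∑ a, ∑ b, (1 / 2) * (pd a (fun q => gram g q b d) p + pd b (fun q => gram g q a d) p
        - pd d (fun q => gram g q a b) p) * u a * w b := by
    ext c
    simp only [christoffelVec, christoffel, Finset.mul_sum, Finset.sum_mul]
    rw [Finset.sum_comm' (t' := Finset.univ) (s' := fun _ => Finset.univ) (by simp)]
    rw [Finset.sum_comm]
    conv_rhs => rw [Finset.sum_comm]
    refine Finset.sum_congr rfl fun a _ => ?_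
    conv_rhs => rw [Finset.sum_comm]
    refine Finset.sum_congr rfl fun b _ => Finset.sum_congr rfl fun d _ => by ring
  rw [h1, hg.apply_raise hp]
  have h2 : ∀ (F : R4 → ℝ) (v : R4), fderiv ℝ F p v = ∑ d, v d * pd d F p := fun F v =>
    (sum_mul_clm_coordVec (fderiv ℝ F p) v).symm
  simp only [metricDeriv, h2, Fin.sum_univ_four]
  ring

/-- Metric compatibility of the Levi-Civita connection. -/
theorem fderiv_apply_covAlong {p : R4} (hp : p ∈ Ω) {X Y : R4 → R4}
    (hX : DifferentiableAt ℝ X p) (hY : DifferentiableAt ℝ Y p) (u : R4) :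
    fderiv ℝ (fun q => g q (X q) (Y q)) p u =
      g p (covAlong g X p u) (Y p) + g p (X p) (covAlong g Y p u) := by
  rw [hg.fderiv_apply_apply hp hX hY, covAlong_eq g hX, covAlong_eq g hY, hg.add_left,
    hg.add_right, hg.apply_christoffelVec hp, hg.symm p (X p) (christoffelVec g p u (Y p)),
    hg.apply_christoffelVec hp, hg.metricDeriv_symm p u (Y p) (X p),
    hg.metricDeriv_symm p (X p) u (Y p), hg.metricDeriv_symm p (Y p) u (X p)]
  ring

/-- The Koszul formula. -/
theorem koszul {p : R4} (hp : p ∈ Ω) {X Y Z : R4 → R4} (hX : DifferentiableAt ℝ X p)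
    (hY : DifferentiableAt ℝ Y p) (hZ : DifferentiableAt ℝ Z p) :
    g p (covAlong g Y p (X p)) (Z p) = (1 / 2) *
      (fderiv ℝ (fun q => g q (Y q) (Z q)) p (X p) + fderiv ℝ (fun q => g q (X q) (Z q)) p (Y p)
        - fderiv ℝ (fun q => g q (X q) (Y q)) p (Z p) + g p (bracket X Y p) (Z p)
        - g p (bracket X Z p) (Y p) - g p (bracket Y Z p) (X p)) := by
  simp only [bracket, hg.fderiv_apply_apply hp hX hY, hg.fderiv_apply_apply hp hX hZ,
    hg.fderiv_apply_apply hp hY hZ, covAlong_eq g hY, hg.add_left, hg.sub_left,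
    hg.apply_christoffelVec hp]
  rw [hg.symm p (Y p) (fderiv ℝ Z p (X p)), hg.symm p (X p) (fderiv ℝ Z p (Y p)),
    hg.symm p (X p) (fderiv ℝ Y p (Z p))]
  ring

end IsMetricOn

/-- This is the identity `∇_X (∇_Y T) - ∇_{∇_X Y} T = (∇∇T)(X, Y)`, with `X` needed only as a vector
at `p`. It reduces bounds for `∇∇T` to iterated first derivatives, so no estimate of Christoffel
symbols is needed. -/
theorem covAlong_covAlong_sub (g : R4 → R4 → R4 → ℝ) {T Y : R4 → R4} {p : R4}
    (hT : ∀ b c, DifferentiableAt ℝ (fun q => covDeriv g T q b c) p)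
    (hY : DifferentiableAt ℝ Y p) (X : R4) (c : Fin 4) :
    (covAlong g (fun q => covAlong g T q (Y q)) p X - covAlong g T p (covAlong g Y p X)) c =
      ∑ a, ∑ b, X a * Y p b * covDeriv2 g T p a b c := by
  have h1 : ∀ a, pd a (fun q => ∑ b, Y q b * covDeriv g T q b c) p =
      ∑ b, (Y p b * pd a (fun q => covDeriv g T q b c) p
        + covDeriv g T p b c * pd a (fun q => Y q b) p) := by
    intro a
    have := HasFDerivAt.fun_sum (u := Finset.univ) fun b _ =>
      (hasFDerivAt_pi'.1 hY.hasFDerivAt b).fun_mul (hT b c).hasFDerivAt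
    rw [pd, this.fderiv]
    simp only [_root_.sum_apply]
    refine Finset.sum_congr rfl fun b _ => ?_
    rw [pd_component hY]
    simp [pd]
  have h2 : ∀ a, covDeriv g (fun q => covAlong g T q (Y q)) p a c =
      ∑ b, (Y p b * pd a (fun q => covDeriv g T q b c) p
        + covDeriv g T p b c * pd a (fun q => Y q b) p)
      + ∑ d, christoffel g p c a d * ∑ b, Y p b * covDeriv g T p b d := by
    intro a
    rw [← h1]
    rfl
  simp only [Pi.sub_apply, covDeriv2, covAlong.eq_1 g (fun q => covAlong g T q (Y q)), h2,
    covAlong.eq_1 g T p, covAlong.eq_1 g Y, covDeriv.eq_1 g Y]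
  simp only [Fin.sum_univ_four]
  ring

/-! ### Calculus of fields with coefficients in a stable algebra of bounded functions. -/

/-- An algebra `A` of functions that are smooth and bounded on an open set `Ω`, and a (possibly
redundant) frame `E` of vector fields along which `A` is stable and in which the metric `g`, its
inverse `∑ G k l • E k ⊗ E l` and the brackets have components in `A`. -/
structure AdmissibleFrame {ι : Type} [Fintype ι] (g : R4 → R4 → R4 → ℝ) (Ω : Set R4)
    (A : (R4 → ℝ) → Prop) (E : ι → R4 → R4) (G : ι → ι → R4 → ℝ) : Prop where
  isOpen : IsOpen Ω
  metric : IsMetricOn g Ω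
  congr : ∀ {h h' : R4 → ℝ}, A h → (∀ p ∈ Ω, h' p = h p) → A h'
  const : ∀ c : ℝ, A fun _ => c
  add : ∀ {h h' : R4 → ℝ}, A h → A h' → A fun p => h p + h' p
  mul : ∀ {h h' : R4 → ℝ}, A h → A h' → A fun p => h p * h' p
  smooth : ∀ {h : R4 → ℝ}, A h → ∀ p ∈ Ω, ContDiffAt ℝ ∞ h p
  deriv_frame : ∀ {h : R4 → ℝ}, A h → ∀ k, A fun p => fderiv ℝ h p (E k p)
  -- An upper bound is enough: `A` is closed under negation, and norms are square roots, which are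
  -- monotone.
  bounded : ∀ {h : R4 → ℝ}, A h → ∃ C, ∀ p ∈ Ω, h p ≤ C
  smooth_frame : ∀ k, ∀ p ∈ Ω, ContDiffAt ℝ ∞ (E k) p
  apply_frame : ∀ k l, A fun p => g p (E k p) (E l p)
  bracket_frame : ∀ k l j, A fun p => g p (bracket (E k) (E l) p) (E j p)
  coeff : ∀ k l, A (G k l)
  gramInv_eq : ∀ p ∈ Ω, ∀ a b, gramInv g p a b = ∑ k, ∑ l, G k l p * E k p a * E l p b

/-- A vector field whose components in the frame `E` can be chosen in `A`. -/
def IsAdmissibleField {ι : Type} [Fintype ι] (Ω : Set R4) (A : (R4 → ℝ) → Prop)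
    (E : ι → R4 → R4) (X : R4 → R4) : Prop :=
  ∃ c : ι → R4 → ℝ, (∀ k, A (c k)) ∧ ∀ p ∈ Ω, X p = ∑ k, c k p • E k p

namespace AdmissibleFrame

variable {ι : Type} [Fintype ι] {g : R4 → R4 → R4 → ℝ} {Ω : Set R4}
  {A : (R4 → ℝ) → Prop} {E : ι → R4 → R4} {G : ι → ι → R4 → ℝ}
  (F : AdmissibleFrame g Ω A E G)
include F

theorem sum {κ : Type} (s : Finset κ) {h : κ → R4 → ℝ} (hh : ∀ k, A (h k)) :
    A fun p => ∑ k ∈ s, h k p := by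
  classical
  induction s using Finset.induction_on with
  | empty => simpa using F.const 0
  | insert i s hi ih => simpa only [Finset.sum_insert hi] using F.add (hh i) ih

theorem neg {h : R4 → ℝ} (hh : A h) : A fun p => -h p :=
  F.congr (F.mul (F.const (-1)) hh) fun p _ => by ring

theorem sub {h h' : R4 → ℝ} (hh : A h) (hh' : A h') : A fun p => h p - h' p :=
  F.congr (F.add hh (F.neg hh')) fun p _ => by ring

theorem mem_nhds {p : R4} (hp : p ∈ Ω) : Ω ∈ 𝓝 p := F.isOpen.mem_nhds hp

theorem frame_field [DecidableEq ι] (k : ι) : IsAdmissibleField Ω A E (E k) :=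
  ⟨fun l _ => if l = k then 1 else 0, fun l => F.const _, fun p _ => by simp⟩

theorem smul_field {h : R4 → ℝ} {X : R4 → R4} (hh : A h) (hX : IsAdmissibleField Ω A E X) :
    IsAdmissibleField Ω A E fun p => h p • X p := by
  obtain ⟨c, hc, hX⟩ := hX
  exact ⟨fun k p => h p * c k p, fun k => F.mul hh (hc k), fun p hp => by
    simp only [hX p hp, Finset.smul_sum, smul_smul]⟩

theorem add_field {X Y : R4 → R4} (hX : IsAdmissibleField Ω A E X)
    (hY : IsAdmissibleField Ω A E Y) : IsAdmissibleField Ω A E fun p => X p + Y p := by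
  obtain ⟨c, hc, hX⟩ := hX
  obtain ⟨d, hd, hY⟩ := hY
  exact ⟨fun k p => c k p + d k p, fun k => F.add (hc k) (hd k), fun p hp => by
    simp only [hX p hp, hY p hp, add_smul, Finset.sum_add_distrib]⟩

theorem sum_field {κ : Type} (s : Finset κ) {X : κ → R4 → R4}
    (hX : ∀ k, IsAdmissibleField Ω A E (X k)) :
    IsAdmissibleField Ω A E fun p => ∑ k ∈ s, X k p := by
  classical
  induction s using Finset.induction_on with
  | empty => exact ⟨fun _ _ => 0, fun _ => F.const 0, fun p _ => by simp⟩
  | insert i s hi ih => simpa only [Finset.sum_insert hi] using F.add_field (hX i) ih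

theorem sub_field {X Y : R4 → R4} (hX : IsAdmissibleField Ω A E X)
    (hY : IsAdmissibleField Ω A E Y) : IsAdmissibleField Ω A E fun p => X p - Y p := by
  have := F.add_field hX (F.smul_field (F.const (-1)) hY)
  simpa only [neg_one_smul, ← sub_eq_add_neg] using this

theorem field_eventuallyEq {X Y : R4 → R4} (h : ∀ p ∈ Ω, X p = Y p) {p : R4} (hp : p ∈ Ω) :
    X =ᶠ[𝓝 p] Y := by
  filter_upwards [F.mem_nhds hp] with q hq using h q hq

theorem smooth_field {X : R4 → R4} (hX : IsAdmissibleField Ω A E X) {p : R4} (hp : p ∈ Ω) :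
    ContDiffAt ℝ ∞ X p := by
  obtain ⟨c, hc, hX⟩ := hX
  refine ContDiffAt.congr_of_eventuallyEq ?_ (F.field_eventuallyEq hX hp)
  exact ContDiffAt.sum fun k _ => (F.smooth (hc k) p hp).smul (F.smooth_frame k p hp)

theorem differentiableAt {h : R4 → ℝ} (hh : A h) {p : R4} (hp : p ∈ Ω) :
    DifferentiableAt ℝ h p := (F.smooth hh p hp).differentiableAt (by simp)

theorem differentiableAt_frame (k : ι) {p : R4} (hp : p ∈ Ω) : DifferentiableAt ℝ (E k) p :=
  (F.smooth_frame k p hp).differentiableAt (by simp)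

theorem differentiableAt_field {X : R4 → R4} (hX : IsAdmissibleField Ω A E X) {p : R4}
    (hp : p ∈ Ω) : DifferentiableAt ℝ X p := (F.smooth_field hX hp).differentiableAt (by simp)

theorem apply_field {X Y : R4 → R4} (hX : IsAdmissibleField Ω A E X)
    (hY : IsAdmissibleField Ω A E Y) : A fun p => g p (X p) (Y p) := by
  obtain ⟨c, hc, hX⟩ := hX
  obtain ⟨d, hd, hY⟩ := hY
  refine F.congr (F.sum Finset.univ fun k => F.sum Finset.univ fun l =>
    F.mul (F.mul (hc k) (hd l)) (F.apply_frame k l)) fun p hp => ?_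
  rw [hX p hp, hY p hp]
  simp only [F.metric.sum_left, F.metric.sum_right, F.metric.smul_left, F.metric.smul_right,
    mul_assoc]

/-- The formula for the inverse metric resolves the identity, so expansion in the frame works
although the frame is redundant and the coefficients are not unique. -/
theorem eq_sum_frame {p : R4} (hp : p ∈ Ω) (u : R4) :
    u = ∑ k, (∑ l, G k l p * g p u (E l p)) • E k p := by
  have h1 : u = fun c => ∑ d, gramInv g p c d * ∑ a, gram g p d a * u a := by
    refine F.metric.eq_of_apply_eq hp fun z => ?_
    rw [F.metric.apply_raise hp, F.metric.symm, F.metric.apply_eq]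
    refine Finset.sum_congr rfl fun a _ => ?_
    rw [Finset.sum_mul]
    exact Finset.sum_congr rfl fun b _ => by ring
  ext c
  conv_lhs => rw [h1]
  simp only [F.gramInv_eq p hp, Finset.sum_apply, Pi.smul_apply, smul_eq_mul,
    F.metric.symm p u (E _ p), F.metric.apply_eq p (E _ p) u, Finset.sum_mul, Finset.mul_sum]
  rw [Finset.sum_comm' (t' := Finset.univ) (s' := fun _ => Finset.univ) (by simp)]
  simp only [Finset.sum_comm (s := (Finset.univ : Finset (Fin 4))) (t := (Finset.univ : Finset ι))]
  refine Finset.sum_congr rfl fun k _ => Finset.sum_congr rfl fun l _ => ?_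
  rw [Finset.sum_comm]
  refine Finset.sum_congr rfl fun a _ => Finset.sum_congr rfl fun b _ => by ring

/-- The criterion by which fields are recognized as admissible: only their products with the frame
have to be examined. -/
theorem field_of_apply_frame {X : R4 → R4} (h : ∀ k, A fun p => g p (X p) (E k p)) :
    IsAdmissibleField Ω A E X :=
  ⟨fun k p => ∑ l, G k l p * g p (X p) (E l p),
    fun k => F.sum _ fun l => F.mul (F.coeff k l) (h l), fun _ hp => F.eq_sum_frame hp _⟩

theorem metricGrad_field {h : R4 → ℝ} (hh : ∀ k, A fun p => fderiv ℝ h p (E k p)) :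
    IsAdmissibleField Ω A E (metricGrad g h) :=
  F.field_of_apply_frame fun k => F.congr (hh k) fun _ hp => F.metric.apply_metricGrad hp h _

/-- All six terms of the Koszul formula lie in `A`: three are frame derivatives of products of frame
fields, three are products of brackets with the frame. -/
theorem covAlong_frame (k l : ι) : IsAdmissibleField Ω A E fun p => covAlong g (E l) p (E k p) := by
  refine F.field_of_apply_frame fun j => ?_
  refine F.congr (F.mul (F.const (1 / 2)) (F.sub (F.sub (F.add (F.sub (F.add
    (F.deriv_frame (F.apply_frame l j) k) (F.deriv_frame (F.apply_frame k j) l))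
    (F.deriv_frame (F.apply_frame k l) j)) (F.bracket_frame k l j)) (F.bracket_frame k j l))
    (F.bracket_frame l j k))) fun p hp => ?_
  exact F.metric.koszul hp (F.differentiableAt_frame k hp) (F.differentiableAt_frame l hp)
    (F.differentiableAt_frame j hp)

theorem covAlong_sum_smul {c : ι → R4 → ℝ} {X : R4 → R4} (hc : ∀ k, A (c k))
    (hX : ∀ p ∈ Ω, X p = ∑ k, c k p • E k p) {p : R4} (hp : p ∈ Ω) (u : R4) :
    covAlong g X p u =
      ∑ k, (fderiv ℝ (c k) p u • E k p + c k p • covAlong g (E k) p u) := by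
  have hd : DifferentiableAt ℝ X p := F.differentiableAt_field ⟨c, hc, hX⟩ hp
  have h1 := HasFDerivAt.fun_sum (u := Finset.univ) fun k _ =>
    (F.differentiableAt (hc k) hp).hasFDerivAt.fun_smul (F.differentiableAt_frame k hp).hasFDerivAt
  have h2 : christoffelVec g p u (X p) = ∑ k, c k p • christoffelVec g p u (E k p) := by
    rw [hX p hp]
    ext d
    simp only [christoffelVec, Finset.sum_apply, Pi.smul_apply, smul_eq_mul, Finset.mul_sum]
    simp only [Finset.sum_comm (s := (Finset.univ : Finset ι)) (t := (Finset.univ : Finset (Fin 4)))]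
    refine Finset.sum_congr rfl fun a _ => Finset.sum_congr rfl fun b _ =>
      Finset.sum_congr rfl fun k _ => by ring
  rw [covAlong_eq g hd, (F.field_eventuallyEq hX hp).fderiv_eq, h1.fderiv, h2]
  simp only [_root_.sum_apply, ← Finset.sum_add_distrib]
  refine Finset.sum_congr rfl fun k _ => ?_
  rw [covAlong_eq g (F.differentiableAt_frame k hp)]
  ext d
  simp
  ring

omit F in
theorem covAlong_sum_right (X : R4 → R4) (p : R4) (c : ι → ℝ) (u : ι → R4) :
    covAlong g X p (∑ k, c k • u k) = ∑ k, c k • covAlong g X p (u k) := by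
  ext d
  simp only [covAlong, Finset.sum_apply, Pi.smul_apply, smul_eq_mul, Finset.sum_mul,
    Finset.mul_sum, mul_assoc]
  rw [Finset.sum_comm]

/-- The Leibniz rule reduces the differentiated field to the frame, and tensoriality reduces the
direction to the frame; `covAlong_frame` does the rest. -/
theorem covAlong_field {X Y : R4 → R4} (hX : IsAdmissibleField Ω A E X)
    (hY : IsAdmissibleField Ω A E Y) : IsAdmissibleField Ω A E fun p => covAlong g Y p (X p) := by
  classical
  have h1 : ∀ k, IsAdmissibleField Ω A E fun p => covAlong g Y p (E k p) := by
    intro k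
    obtain ⟨d, hd, hY⟩ := hY
    obtain ⟨e, he, h⟩ := F.sum_field Finset.univ fun l => F.add_field
      (F.smul_field (F.deriv_frame (hd l) k) (F.frame_field l))
      (F.smul_field (hd l) (F.covAlong_frame k l))
    exact ⟨e, he, fun p hp => (F.covAlong_sum_smul hd hY hp _).trans (h p hp)⟩
  obtain ⟨c, hc, hX⟩ := hX
  obtain ⟨e, he, h⟩ := F.sum_field Finset.univ fun k => F.smul_field (hc k) (h1 k)
  refine ⟨e, he, fun p hp => Eq.trans ?_ (h p hp)⟩
  change covAlong g Y p (X p) = _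
  rw [hX p hp, covAlong_sum_right]

theorem smooth_gramInv {p : R4} (hp : p ∈ Ω) (a b : Fin 4) :
    ContDiffAt ℝ ∞ (fun q => gramInv g q a b) p := by
  have : (fun q => gramInv g q a b) =ᶠ[𝓝 p] fun q => ∑ k, ∑ l, G k l q * E k q a * E l q b := by
    filter_upwards [F.mem_nhds hp] with q hq using F.gramInv_eq q hq a b
  refine ContDiffAt.congr_of_eventuallyEq ?_ this
  exact ContDiffAt.sum fun k _ => ContDiffAt.sum fun l _ =>
    ((F.smooth (F.coeff k l) p hp).mul (contDiffAt_pi.1 (F.smooth_frame k p hp) a)).mul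
      (contDiffAt_pi.1 (F.smooth_frame l p hp) b)

omit F in
theorem contDiffAt_pd {h : R4 → ℝ} {p : R4} (hh : ContDiffAt ℝ ∞ h p) (a : Fin 4) :
    ContDiffAt ℝ ∞ (pd a h) p :=
  (hh.fderiv_right (m := ∞) (by simp)).clm_apply contDiffAt_const

theorem smooth_christoffel {p : R4} (hp : p ∈ Ω) (c a b : Fin 4) :
    ContDiffAt ℝ ∞ (fun q => christoffel g q c a b) p :=
  contDiffAt_const.mul (ContDiffAt.sum fun d _ => (F.smooth_gramInv hp c d).mul
    (((contDiffAt_pd (F.metric.smooth p hp b d) a).add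
      (contDiffAt_pd (F.metric.smooth p hp a d) b)).sub
        (contDiffAt_pd (F.metric.smooth p hp a b) d)))

/-- Cartesian components need not be bounded. Their smoothness serves only to justify
differentiating `∇X` once more in `covAlong_covAlong_sub`. -/
theorem smooth_covDeriv {X : R4 → R4} (hX : IsAdmissibleField Ω A E X) {p : R4} (hp : p ∈ Ω)
    (b c : Fin 4) : ContDiffAt ℝ ∞ (fun q => covDeriv g X q b c) p :=
  (contDiffAt_pd (contDiffAt_pi.1 (F.smooth_field hX hp) c) b).add
    (ContDiffAt.sum fun d _ => (F.smooth_christoffel hp c b d).mul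
      (contDiffAt_pi.1 (F.smooth_field hX hp) d))

theorem covDeriv2_field {X Y T : R4 → R4} (hX : IsAdmissibleField Ω A E X)
    (hY : IsAdmissibleField Ω A E Y) (hT : IsAdmissibleField Ω A E T) :
    IsAdmissibleField Ω A E fun p c => ∑ a, ∑ b, X p a * Y p b * covDeriv2 g T p a b c := by
  obtain ⟨e, he, h⟩ := F.sub_field (F.covAlong_field hX (F.covAlong_field hY hT))
    (F.covAlong_field (F.covAlong_field hX hY) hT)
  refine ⟨e, he, fun p hp => ?_⟩
  rw [← h p hp]
  ext c
  exact (covAlong_covAlong_sub g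
    (fun b c => (F.smooth_covDeriv hT hp b c).differentiableAt (by simp))
    (F.differentiableAt_field hY hp) (X p) c).symm

end AdmissibleFrame

/-! ### Contractions, the metric `Θ`, and the mean curvature as a divergence. -/

/-- Tensor norms and traces are defined with the inverse matrix of a metric. Writing that matrix in
a frame turns them into sums of values on frame fields. -/
theorem sum_sum_mul_contract {κ μ : Type} [Fintype κ] [Fintype μ] {M : Fin 4 → Fin 4 → ℝ}
    {c : κ → μ → ℝ} {x : κ → R4} {z : μ → R4}
    (hM : ∀ a b, M a b = ∑ k, ∑ l, c k l * x k a * z l b) (β : Fin 4 → Fin 4 → ℝ) :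
    ∑ a, ∑ b, M a b * β a b = ∑ k, ∑ l, c k l * ∑ a, ∑ b, x k a * z l b * β a b := by
  simp only [hM, Finset.sum_mul, Finset.mul_sum]
  rw [Finset.sum_congr rfl fun a _ => Finset.sum_comm, Finset.sum_comm]
  refine Finset.sum_congr rfl fun k _ => ?_
  rw [Finset.sum_congr rfl fun a _ => Finset.sum_comm, Finset.sum_comm]
  refine Finset.sum_congr rfl fun l _ => Finset.sum_congr rfl fun a _ =>
    Finset.sum_congr rfl fun b _ => by ring

theorem covAlong_coordVec_contract (g : R4 → R4 → R4 → ℝ) (X : R4 → R4) (p u : R4) :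
    covAlong g X p u = ∑ a, u a • covAlong g X p (coordVec a) := by
  rw [← AdmissibleFrame.covAlong_sum_right, sum_smul_coordVec]

namespace IsMetricOn

variable {g : R4 → R4 → R4 → ℝ} {Ω : Set R4} (hg : IsMetricOn g Ω)
include hg

theorem sum_sum_mul_apply {κ μ : Type} [Fintype κ] [Fintype μ] (p : R4) (x : κ → ℝ) (y : κ → R4)
    (z : μ → ℝ) (w : μ → R4) :
    ∑ a, ∑ b, x a * z b * g p (y a) (w b) = g p (∑ a, x a • y a) (∑ b, z b • w b) := by
  simp only [hg.sum_left, hg.sum_right, hg.smul_left, hg.smul_right, mul_assoc]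

theorem sum_gramInv_mul {p : R4} (hp : p ∈ Ω) (u : R4) (a : Fin 4) :
    ∑ b, gramInv g p a b * g p u (coordVec b) = u a := by
  have : (fun c => ∑ d, gramInv g p c d * g p u (coordVec d)) = u := by
    refine hg.eq_of_apply_eq hp fun z => ?_
    rw [hg.apply_raise hp]
    conv_rhs => rw [← sum_smul_coordVec z, hg.sum_right]
    refine Finset.sum_congr rfl fun b _ => ?_
    rw [hg.smul_right, mul_comm]
  exact congrFun this a

/-- The bilinear form `Θ = g + 2 ω ⊗ ω` is nondegenerate, with inverse `g⁻¹ + 2 T ⊗ T`. -/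
theorem gram_theta_mul {p : R4} (hp : p ∈ Ω) {T : R4 → R4} (hT : g p (T p) (T p) = -1) :
    gram (thetaMetric g T) p * Matrix.of (fun a b => gramInv g p a b + 2 * (T p a * T p b)) = 1 := by
  ext a c
  have h1 : ∑ b, gram g p a b * gramInv g p b c = if a = c then 1 else 0 := by
    have := congrFun (congrFun (hg.gram_mul_gramInv hp) a) c
    rwa [Matrix.mul_apply, Matrix.one_apply] at this
  have h2 : ∑ b, g p (T p) (coordVec b) * gramInv g p b c = T p c := by
    rw [← hg.sum_gramInv_mul hp (T p) c]
    exact Finset.sum_congr rfl fun b _ => by rw [hg.gramInv_symm, mul_comm]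
  have h3 : ∑ b, gram g p a b * T p b = g p (T p) (coordVec a) := by
    rw [hg.apply_coordVec_right]
    exact Finset.sum_congr rfl fun b _ => by rw [hg.gram_symm]
  have h4 : ∑ b, g p (T p) (coordVec b) * T p b = -1 := by
    rw [← hT]
    conv_rhs => rw [← sum_smul_coordVec (T p), hg.sum_right, sum_smul_coordVec]
    exact Finset.sum_congr rfl fun b _ => by rw [hg.smul_right, mul_comm]
  rw [Matrix.mul_apply, Matrix.one_apply, ← h1]
  have : ∀ b, gram (thetaMetric g T) p a b *
      Matrix.of (fun a b => gramInv g p a b + 2 * (T p a * T p b)) b c =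
      gram g p a b * gramInv g p b c + 2 * T p c * (gram g p a b * T p b)
      + 2 * g p (T p) (coordVec a) * (g p (T p) (coordVec b) * gramInv g p b c)
      + 4 * g p (T p) (coordVec a) * T p c * (g p (T p) (coordVec b) * T p b) := by
    intro b
    simp only [gram, thetaMetric, Matrix.of_apply]
    ring
  simp only [this, Finset.sum_add_distrib, ← Finset.mul_sum, h2, h3, h4]
  ring

theorem gramInv_theta {p : R4} (hp : p ∈ Ω) {T : R4 → R4} (hT : g p (T p) (T p) = -1)
    (a b : Fin 4) : gramInv (thetaMetric g T) p a b = gramInv g p a b + 2 * (T p a * T p b) := by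
  rw [gramInv, Matrix.inv_eq_right_inv (hg.gram_theta_mul hp hT)]
  rfl

theorem theta {T : R4 → R4} (hT : ∀ p ∈ Ω, g p (T p) (T p) = -1)
    (hTs : ∀ p ∈ Ω, ContDiffAt ℝ ∞ T p) : IsMetricOn (thetaMetric g T) Ω where
  apply_eq p u w := by
    have h : ∀ v, g p (T p) v = ∑ a, v a * g p (T p) (coordVec a) := by
      intro v
      conv_lhs => rw [← sum_smul_coordVec v, hg.sum_right]
      exact Finset.sum_congr rfl fun a _ => by rw [hg.smul_right]
    simp only [thetaMetric, gram, Matrix.of_apply, add_mul, Finset.sum_add_distrib]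
    congr 1
    · exact hg.apply_eq p u w
    · rw [mul_assoc, h u, h w, Finset.sum_mul_sum, Finset.mul_sum]
      refine Finset.sum_congr rfl fun a _ => ?_
      rw [Finset.mul_sum]
      refine Finset.sum_congr rfl fun b _ => by ring
  symm p u w := by
    simp only [thetaMetric, hg.symm p u w]
    ring
  smooth p hp a b := by
    have h : ∀ b, ContDiffAt ℝ ∞ (fun q => g q (T q) (coordVec b)) p := by
      intro b
      simp only [hg.apply_coordVec_right]
      exact ContDiffAt.sum fun a _ => (hg.smooth p hp a b).mul (contDiffAt_pi.1 (hTs p hp) a)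
    exact (hg.smooth p hp a b).add ((contDiffAt_const.mul (h a)).mul (h b))
  isUnit_det p hp :=
    Matrix.isUnit_det_of_right_inverse (hg.gram_theta_mul hp (hT p hp))

/-- The mean curvature is a third of the divergence of the unit normal. -/
theorem meanCurvature_eq {p : R4} (hp : p ∈ Ω) {T : R4 → R4}
    (hT : ∀ᶠ q in 𝓝 p, g q (T q) (T q) = -1) (hTd : DifferentiableAt ℝ T p) :
    meanCurvature g T p = (1 / 3) * (∑ a, fderiv ℝ T p (coordVec a) a +
      ∑ d, T p d * ((1 / 2) * ∑ a, ∑ b, gramInv g p a b * pd d (fun q => gram g q a b) p)) := by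
  have h1 : ∀ v, ∑ b, (T p b) * g p v (coordVec b) = g p v (T p) := by
    intro v
    conv_rhs => rw [← sum_smul_coordVec (T p), hg.sum_right]
    exact Finset.sum_congr rfl fun b _ => by rw [hg.smul_right]
  -- Differentiating `g(T, T) = -1` along `T`; hence the term `T^a T^b` of the induced inverse
  -- metric does not contribute to the trace.
  have h2 : g p (covAlong g T p (T p)) (T p) = 0 := by
    have h3 := hg.fderiv_apply_covAlong hp hTd hTd (T p)
    have h4 : (fun q => g q (T q) (T q)) =ᶠ[𝓝 p] fun _ => -1 := hT
    rw [h4.fderiv_eq, hg.symm p (T p)] at h3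
    simp at h3
    linarith
  have h5 : ∑ a, ∑ b, (T p a * T p b) * g p (covAlong g T p (coordVec a)) (coordVec b) = 0 := by
    rw [← h2, covAlong_coordVec_contract, hg.sum_left]
    refine Finset.sum_congr rfl fun a _ => ?_
    rw [hg.smul_left, ← h1, Finset.mul_sum]
    exact Finset.sum_congr rfl fun b _ => by ring
  have h6 : ∀ a, covAlong g T p (coordVec a) a = covDeriv g T p a a := by
    intro a
    simp [covAlong, coordVec, Pi.single_apply]
  have h7 : ∀ d, ∑ a, christoffel g p a a d =
      (1 / 2) * ∑ a, ∑ b, gramInv g p a b * pd d (fun q => gram g q a b) p := by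
    intro d
    -- In the trace `Γ^a_{ad}` two of the three derivatives of the metric cancel by symmetry of the
    -- inverse matrix, leaving the logarithmic derivative of the volume density.
    have h8 : ∑ a, ∑ b, gramInv g p a b * pd a (fun q => gram g q d b) p =
        ∑ a, ∑ b, gramInv g p a b * pd b (fun q => gram g q a d) p := by
      rw [Finset.sum_comm]
      refine Finset.sum_congr rfl fun a _ => Finset.sum_congr rfl fun b _ => ?_
      have : (fun q => gram g q d a) = fun q => gram g q a d := by ext q; exact hg.gram_symm _ _ _
      rw [hg.gramInv_symm, this]
    simp only [christoffel, ← Finset.mul_sum]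
    congr 1
    simp only [mul_sub, mul_add, Finset.sum_sub_distrib, Finset.sum_add_distrib, h8]
    ring
  unfold meanCurvature
  congr 1
  simp only [add_mul, Finset.sum_add_distrib, h5, hg.sum_gramInv_mul hp, h6, covDeriv, add_zero]
  congr 1
  · exact Finset.sum_congr rfl fun a _ => pd_component hTd a a
  · rw [Finset.sum_comm]
    refine Finset.sum_congr rfl fun d _ => ?_
    rw [← h7, Finset.mul_sum]
    exact Finset.sum_congr rfl fun a _ => mul_comm _ _

/-- An orthonormal pair `w` and a pair `n` spanning its orthogonal complement resolve the inverse
metric. -/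
theorem gramInv_eq_of_orthonormal {p : R4} {w n : Fin 2 → R4}
    (hw : ∀ i j, g p (w i) (w j) = if i = j then 1 else 0) (hwn : ∀ i j, g p (w i) (n j) = 0)
    (hD : g p (n 0) (n 0) * g p (n 1) (n 1) - g p (n 0) (n 1) ^ 2 ≠ 0)
    {Q : Fin 2 → Fin 2 → ℝ}
    (hQ : ∀ i j, ∑ k, g p (n i) (n k) * Q k j = if i = j then 1 else 0) (a b : Fin 4) :
    gramInv g p a b = (∑ i, w i a * w i b) + ∑ i, ∑ j, Q i j * n i a * n j b := by
  set v : Fin 4 → R4 := ![w 0, w 1, n 0, n 1] with hv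
  set M : Matrix (Fin 4) (Fin 4) ℝ := Matrix.of v with hM
  set X : Matrix (Fin 4) (Fin 4) ℝ :=
    Matrix.of (fun a b => (∑ i, w i a * w i b) + ∑ i, ∑ j, Q i j * n i a * n j b) with hX
  have hMg : ∀ i b, (M * gram g p) i b = g p (v i) (coordVec b) := by
    intro i b
    rw [Matrix.mul_apply, hg.apply_coordVec_right]
    exact Finset.sum_congr rfl fun a _ => mul_comm _ _
  have happ : ∀ u z : R4, ∑ b, g p u (coordVec b) * z b = g p u z := by
    intro u z
    conv_rhs => rw [← sum_smul_coordVec z, hg.sum_right]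
    exact Finset.sum_congr rfl fun b _ => by rw [hg.smul_right, mul_comm]
  -- The Gram matrix of the four vectors is block diagonal with nonzero determinant, so they form a
  -- basis and `M` can be cancelled from `M * (gram g p * X) = M`.
  have hB : M * gram g p * M.transpose =
      !![1, 0, 0, 0; 0, 1, 0, 0; 0, 0, g p (n 0) (n 0), g p (n 0) (n 1);
        0, 0, g p (n 0) (n 1), g p (n 1) (n 1)] := by
    have : ∀ i j, (M * gram g p * M.transpose) i j = g p (v i) (v j) := by
      intro i j
      rw [Matrix.mul_apply, ← happ (v i) (v j)]
      exact Finset.sum_congr rfl fun b _ => by rw [hMg]; rfl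
    have hnw : ∀ i j, g p (n j) (w i) = 0 := fun i j => by rw [hg.symm, hwn]
    ext i j
    rw [this]
    fin_cases i <;> fin_cases j <;> simp [hv, hw, hwn, hnw, hg.symm p (n 1) (n 0)]
  have hdet : IsUnit M.det := by
    have h1 : (M * gram g p * M.transpose).det =
        g p (n 0) (n 0) * g p (n 1) (n 1) - g p (n 0) (n 1) ^ 2 := by
      rw [hB]
      simp [Matrix.det_succ_row_zero, Fin.sum_univ_succ, Fin.succAbove]
      ring
    rw [Matrix.det_mul, Matrix.det_mul] at h1
    rw [isUnit_iff_ne_zero]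
    intro h0
    rw [h0] at h1
    exact hD (by rw [← h1]; ring)
  have hMX : M * (gram g p * X) = M := by
    rw [← Matrix.mul_assoc]
    have hrow : ∀ i b, (M * gram g p * X) i b = (∑ j, g p (v i) (w j) * w j b) +
        ∑ j, ∑ k, g p (v i) (n j) * Q j k * n k b := by
      intro i b
      simp only [Matrix.mul_apply (M := M * gram g p), hMg, hX, Matrix.of_apply, mul_add,
        Finset.sum_add_distrib]
      congr 1
      · simp only [Finset.mul_sum, ← happ (v i) (w _), Finset.sum_mul]
        rw [Finset.sum_comm]
        exact Finset.sum_congr rfl fun _ _ => Finset.sum_congr rfl fun _ _ => by ring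
      · simp only [Finset.mul_sum, ← happ (v i) (n _), Finset.sum_mul]
        rw [Finset.sum_comm]
        refine Finset.sum_congr rfl fun _ _ => ?_
        rw [Finset.sum_comm]
        exact Finset.sum_congr rfl fun _ _ => Finset.sum_congr rfl fun _ _ => by ring
    have hnw : ∀ i j, g p (n j) (w i) = 0 := fun i j => by rw [hg.symm, hwn]
    have hn : ∀ i b, ∑ j, ∑ k, g p (n i) (n j) * Q j k * n k b = n i b := by
      intro i b
      rw [Finset.sum_comm]
      simp only [← Finset.sum_mul, hQ]
      simp
    ext i b
    rw [hrow]
    fin_cases i <;> simp [hv, hM, hw, hwn, hnw]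
    all_goals simpa using hn _ b
  have hgX : gram g p * X = 1 := by
    calc gram g p * X = M⁻¹ * (M * (gram g p * X)) := by
          rw [← Matrix.mul_assoc M⁻¹, Matrix.nonsing_inv_mul _ hdet, Matrix.one_mul]
      _ = 1 := by rw [hMX, Matrix.nonsing_inv_mul _ hdet]
  rw [gramInv, Matrix.inv_eq_right_inv hgX]
  rfl

end IsMetricOn

/-! ### Uniform bounds for `Θ`-norms, and the mean curvature vector. -/

namespace AdmissibleFrame

variable {ι : Type} [Fintype ι] {g : R4 → R4 → R4 → ℝ} {Ω : Set R4}
  {A : (R4 → ℝ) → Prop} {E : ι → R4 → R4} {G : ι → ι → R4 → ℝ}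
  (F : AdmissibleFrame g Ω A E G)
include F

theorem sqrt_bounded {h : R4 → ℝ} (hh : A h) : ∃ C, ∀ p ∈ Ω, Real.sqrt (h p) ≤ C := by
  obtain ⟨C, hC⟩ := F.bounded hh
  exact ⟨Real.sqrt C, fun p hp => Real.sqrt_le_sqrt (hC p hp)⟩

variable {T : R4 → R4} (hT : IsAdmissibleField Ω A E T) (hTT : ∀ p ∈ Ω, g p (T p) (T p) = -1)
include hT

theorem theta_field {X Y : R4 → R4} (hX : IsAdmissibleField Ω A E X)
    (hY : IsAdmissibleField Ω A E Y) : A fun p => thetaMetric g T p (X p) (Y p) :=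
  F.add (F.apply_field hX hY)
    (F.mul (F.mul (F.const 2) (F.apply_field hT hX)) (F.apply_field hT hY))

theorem vecNorm_bounded {X : R4 → R4} (hX : IsAdmissibleField Ω A E X) :
    ∃ C, ∀ p ∈ Ω, vecNorm (thetaMetric g T) p (X p) ≤ C :=
  F.sqrt_bounded (F.theta_field hT hX hX)

include hTT

theorem isMetricOn_theta : IsMetricOn (thetaMetric g T) Ω :=
  F.metric.theta hTT fun _ hp => F.smooth_field hT hp

/-- The inverse of `Θ` is `g⁻¹ + 2 T ⊗ T`, and both summands have coefficients in `A` with respect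
to the frame. -/
theorem exists_gramInv_theta : ∃ M : ι → ι → R4 → ℝ, (∀ k l, A (M k l)) ∧ ∀ p ∈ Ω, ∀ a b,
    gramInv (thetaMetric g T) p a b = ∑ k, ∑ l, M k l p * E k p a * E l p b := by
  obtain ⟨c, hc, h⟩ := hT
  refine ⟨fun k l p => G k l p + 2 * (c k p * c l p),
    fun k l => F.add (F.coeff k l) (F.mul (F.const 2) (F.mul (hc k) (hc l))), fun p hp a b => ?_⟩
  rw [F.metric.gramInv_theta hp (hTT p hp), F.gramInv_eq p hp, h p hp]
  simp only [Finset.sum_apply, Pi.smul_apply, smul_eq_mul, add_mul, Finset.sum_add_distrib]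
  congr 1
  rw [Finset.sum_mul_sum, Finset.mul_sum]
  refine Finset.sum_congr rfl fun k _ => ?_
  rw [Finset.mul_sum]
  refine Finset.sum_congr rfl fun l _ => by ring

/-- Contracting with the inverse of `Θ` in the frame expresses the squared norm through the values
of the tensor on frame fields, which are admissible by hypothesis. -/
theorem tensorNorm1_bounded {B : R4 → Fin 4 → Fin 4 → ℝ}
    (hB : ∀ k, IsAdmissibleField Ω A E fun p => ∑ a, E k p a • B p a) :
    ∃ C, ∀ p ∈ Ω, tensorNorm1 (thetaMetric g T) p (B p) ≤ C := by
  obtain ⟨M, hM, hMeq⟩ := F.exists_gramInv_theta hT hTT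
  have hθ := F.isMetricOn_theta hT hTT
  refine F.sqrt_bounded (F.congr (F.sum Finset.univ fun k => F.sum Finset.univ fun l =>
    F.mul (hM k l) (F.theta_field hT (hB k) (hB l))) fun p hp => ?_)
  calc _ = ∑ a, ∑ a', gramInv (thetaMetric g T) p a a' * thetaMetric g T p (B p a) (B p a') := by
        simp only [hθ.apply_eq, Finset.mul_sum]
        refine Finset.sum_congr rfl fun _ _ => Finset.sum_congr rfl fun _ _ =>
          Finset.sum_congr rfl fun _ _ => Finset.sum_congr rfl fun _ _ => by ring
    _ = _ := by
        rw [sum_sum_mul_contract (hMeq p hp)]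
        simp only [hθ.sum_sum_mul_apply]

theorem tensorNorm2_bounded {B : R4 → Fin 4 → Fin 4 → Fin 4 → ℝ}
    (hB : ∀ k l, IsAdmissibleField Ω A E fun p => ∑ a, E k p a • ∑ b, E l p b • B p a b) :
    ∃ C, ∀ p ∈ Ω, tensorNorm2 (thetaMetric g T) p (B p) ≤ C := by
  obtain ⟨M, hM, hMeq⟩ := F.exists_gramInv_theta hT hTT
  have hθ := F.isMetricOn_theta hT hTT
  refine F.sqrt_bounded (F.congr (F.sum Finset.univ fun k => F.sum Finset.univ fun l =>
    F.mul (hM k l) (F.sum Finset.univ fun k' => F.sum Finset.univ fun l' =>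
      F.mul (hM k' l') (F.theta_field hT (hB k k') (hB l l')))) fun p hp => ?_)
  calc _ = ∑ a, ∑ a', gramInv (thetaMetric g T) p a a' *
          ∑ b, ∑ b', gramInv (thetaMetric g T) p b b' *
            thetaMetric g T p (B p a b) (B p a' b') := by
        simp only [hθ.apply_eq, Finset.mul_sum]
        refine Finset.sum_congr rfl fun _ _ => Finset.sum_congr rfl fun _ _ =>
          Finset.sum_congr rfl fun _ _ => Finset.sum_congr rfl fun _ _ =>
          Finset.sum_congr rfl fun _ _ => Finset.sum_congr rfl fun _ _ => by ring
    _ = _ := by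
        rw [sum_sum_mul_contract (hMeq p hp)]
        refine Finset.sum_congr rfl fun k _ => Finset.sum_congr rfl fun l _ => ?_
        congr 1
        simp only [sum_sum_mul_contract (hMeq p hp), hθ.sum_sum_mul_apply]
        simp only [Finset.mul_sum]
        rw [Finset.sum_congr rfl fun a _ => Finset.sum_comm, Finset.sum_comm]
        refine Finset.sum_congr rfl fun k' _ => ?_
        rw [Finset.sum_congr rfl fun a _ => Finset.sum_comm, Finset.sum_comm]
        refine Finset.sum_congr rfl fun l' _ => ?_
        rw [← hθ.sum_sum_mul_apply, Finset.mul_sum]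
        refine Finset.sum_congr rfl fun a _ => ?_
        rw [Finset.mul_sum]
        exact Finset.sum_congr rfl fun b _ => by ring

theorem covDeriv_bounded :
    ∃ C, ∀ p ∈ Ω, tensorNorm1 (thetaMetric g T) p (covDeriv g T p) ≤ C := by
  classical
  refine F.tensorNorm1_bounded hT hTT fun k => ?_
  obtain ⟨c, hc, h⟩ := F.covAlong_field (F.frame_field k) hT
  refine ⟨c, hc, fun p hp => Eq.trans ?_ (h p hp)⟩
  ext d
  simp [covAlong, Finset.sum_apply]

theorem covDeriv2_bounded :
    ∃ C, ∀ p ∈ Ω, tensorNorm2 (thetaMetric g T) p (covDeriv2 g T p) ≤ C := by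
  classical
  refine F.tensorNorm2_bounded hT hTT fun k l => ?_
  obtain ⟨c, hc, h⟩ := F.covDeriv2_field (F.frame_field k) (F.frame_field l) hT
  refine ⟨c, hc, fun p hp => Eq.trans ?_ (h p hp)⟩
  ext d
  simp only [Finset.sum_apply, Pi.smul_apply, smul_eq_mul, Finset.mul_sum, mul_assoc]

omit hT hTT

/-- The mean curvature vector of the surfaces with normal bundle spanned by `n 0`, `n 1`. -/
theorem exists_meanCurvatureVector_field [DecidableEq ι] {n : Fin 2 → R4 → R4}
    (hn : ∀ i, IsAdmissibleField Ω A E (n i))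
    (hD : ∀ p ∈ Ω, g p (n 0 p) (n 0 p) * g p (n 1 p) (n 1 p) - g p (n 0 p) (n 1 p) ^ 2 ≠ 0)
    (hDA : A fun p => (g p (n 0 p) (n 0 p) * g p (n 1 p) (n 1 p) - g p (n 0 p) (n 1 p) ^ 2)⁻¹) :
    ∃ N : R4 → R4, IsAdmissibleField Ω A E N ∧ ∀ p ∈ Ω, ∀ W : Fin 2 → R4 → R4,
      (∀ i, DifferentiableAt ℝ (W i) p) →
      (∀ᶠ q in 𝓝 p, (∀ i j, g q (W i q) (n j q) = 0) ∧
        ∀ i j, g q (W i q) (W j q) = if i = j then 1 else 0) →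
      (∑ i, covAlong g (W i) p (W i p))
        - ∑ j, g p (∑ i, covAlong g (W i) p (W i p)) (W j p) • W j p = N p := by
  set D : R4 → ℝ := fun p =>
    (g p (n 0 p) (n 0 p) * g p (n 1 p) (n 1 p) - g p (n 0 p) (n 1 p) ^ 2)⁻¹ with hDdef
  -- The inverse of the Gram matrix of `n 0`, `n 1`, by Cramer's rule.
  set Q : Fin 2 → Fin 2 → R4 → ℝ := fun i j p => D p *
    !![g p (n 1 p) (n 1 p), -g p (n 0 p) (n 1 p); -g p (n 0 p) (n 1 p), g p (n 0 p) (n 0 p)] i j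
    with hQdef
  have hQA : ∀ i j, A (Q i j) := by
    intro i j
    refine F.mul hDA ?_
    fin_cases i <;> fin_cases j <;> simp
    · exact F.apply_field (hn 1) (hn 1)
    · exact F.neg (F.apply_field (hn 0) (hn 1))
    · exact F.neg (F.apply_field (hn 0) (hn 1))
    · exact F.apply_field (hn 0) (hn 0)
  have hQ : ∀ p ∈ Ω, ∀ i j, ∑ k, g p (n i p) (n k p) * Q k j p = if i = j then 1 else 0 := by
    intro p hp i j
    have h := hD p hp
    have hs := F.metric.symm p (n 1 p) (n 0 p)
    have hD' : D p * (g p (n 0 p) (n 0 p) * g p (n 1 p) (n 1 p) - g p (n 0 p) (n 1 p) ^ 2) = 1 :=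
      inv_mul_cancel₀ h
    fin_cases i <;> fin_cases j <;> simp [hQdef, Fin.sum_univ_two, hs] <;>
      first | linear_combination hD' | ring1
  -- The trace of `g(∇ n_i, ·)` over the tangent planes, written as the full trace minus the trace
  -- over the normal planes. No tangent frame occurs, so this is visibly in `A`.
  set S : Fin 2 → R4 → ℝ := fun i p =>
    (∑ k, ∑ l, G k l p * g p (covAlong g (n i) p (E k p)) (E l p))
      - ∑ j, ∑ k, Q j k p * g p (covAlong g (n i) p (n j p)) (n k p) with hSdef
  have hS : ∀ i, A (S i) := fun i => F.sub
    (F.sum _ fun k => F.sum _ fun l => F.mul (F.coeff k l)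
      (F.apply_field (F.covAlong_field (F.frame_field k) (hn i)) (F.frame_field l)))
    (F.sum _ fun j => F.sum _ fun k => F.mul (hQA j k)
      (F.apply_field (F.covAlong_field (hn j) (hn i)) (hn k)))
  refine ⟨fun p => ∑ i, ∑ j, (Q i j p * -S i p) • n j p,
    F.sum_field _ fun i => F.sum_field _ fun j =>
      F.smul_field (F.mul (hQA i j) (F.neg (hS i))) (hn j), fun p hp W hW hWp => ?_⟩
  obtain ⟨hWn, hWW⟩ := hWp.self_of_nhds
  have hres := F.metric.gramInv_eq_of_orthonormal (w := fun i => W i p) (n := fun i => n i p)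
    hWW hWn (hD p hp) (hQ p hp)
  have hβ : ∀ (i : Fin 2) (x z : R4), ∑ a, ∑ b, x a * z b *
      g p (covAlong g (n i) p (coordVec a)) (coordVec b) = g p (covAlong g (n i) p x) z := by
    intro i x z
    rw [F.metric.sum_sum_mul_apply, sum_smul_coordVec, ← covAlong_coordVec_contract]
  have htr : ∀ i, ∑ j, g p (covAlong g (n i) p (W j p)) (W j p) = S i p := by
    intro i
    have h1 := sum_sum_mul_contract (F.gramInv_eq p hp)
      (fun a b => g p (covAlong g (n i) p (coordVec a)) (coordVec b))
    simp only [hres, add_mul, Finset.sum_add_distrib, hβ] at h1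
    rw [sum_sum_mul_contract (κ := Fin 2) (μ := Fin 2) (c := fun i j => Q i j p)
      (x := fun i => n i p) (z := fun i => n i p) (fun a b => rfl)] at h1
    simp only [hβ] at h1
    rw [hSdef]
    simp only [← h1, Finset.sum_mul]
    simp only [← hβ i (W _ p) (W _ p), add_sub_cancel_right]
    rw [Finset.sum_comm]
    refine Finset.sum_congr rfl fun a _ => ?_
    rw [Finset.sum_comm]
  set V := ∑ i, covAlong g (W i) p (W i p) with hV
  -- Differentiating `g(W_j, n_i) = 0` along `W_j` moves the derivative from `W_j` to `n_i`, which
  -- removes the dependence on the choice of `W`.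
  have hVn : ∀ i, g p V (n i p) = -S i p := by
    intro i
    rw [hV, F.metric.sum_left, ← htr, ← Finset.sum_neg_distrib]
    refine Finset.sum_congr rfl fun j _ => ?_
    have h1 := F.metric.fderiv_apply_covAlong hp (hW j) (F.differentiableAt_field (hn i) hp) (W j p)
    have h2 : (fun q => g q (W j q) (n i q)) =ᶠ[𝓝 p] fun _ => 0 := by
      filter_upwards [hWp] with q hq using hq.1 j i
    rw [h2.fderiv_eq, F.metric.symm p (W j p)] at h1
    simp at h1
    linarith
  have hdec : V = (∑ i, g p V (W i p) • W i p) + ∑ i, ∑ j, (Q i j p * g p V (n i p)) • n j p := by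
    ext a
    rw [← F.metric.sum_gramInv_mul hp V a]
    have happ : ∀ z : R4, ∑ b, z b * g p V (coordVec b) = g p V z := by
      intro z
      conv_rhs => rw [← sum_smul_coordVec z, F.metric.sum_right]
      exact Finset.sum_congr rfl fun b _ => by rw [F.metric.smul_right]
    simp only [F.metric.gramInv_symm p a, hres, add_mul, Finset.sum_add_distrib, Finset.sum_mul,
      Pi.add_apply, Finset.sum_apply, Pi.smul_apply, smul_eq_mul]
    congr 1
    · rw [Finset.sum_comm]
      refine Finset.sum_congr rfl fun i _ => ?_
      rw [← happ, Finset.sum_mul]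
      refine Finset.sum_congr rfl fun b _ => by ring
    · rw [Finset.sum_comm]
      refine Finset.sum_congr rfl fun i _ => ?_
      rw [Finset.sum_comm]
      refine Finset.sum_congr rfl fun j _ => ?_
      rw [← happ, Finset.mul_sum, Finset.sum_mul]
      refine Finset.sum_congr rfl fun b _ => by ring
  rw [sub_eq_iff_eq_add]
  conv_lhs => rw [hdec]
  simp only [hVn]
  rw [add_comm]

end AdmissibleFrame

/-! ### Existence of smooth orthonormal tangent frames. -/

namespace IsMetricOn

variable {g : R4 → R4 → R4 → ℝ} {Ω : Set R4} (hg : IsMetricOn g Ω)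
include hg

theorem contDiffAt_apply {p : R4} (hp : p ∈ Ω) {X Y : R4 → R4} (hX : ContDiffAt ℝ ∞ X p)
    (hY : ContDiffAt ℝ ∞ Y p) : ContDiffAt ℝ ∞ (fun q => g q (X q) (Y q)) p := by
  simp only [hg.apply_eq]
  exact ContDiffAt.sum fun a _ => ContDiffAt.sum fun b _ =>
    ((hg.smooth p hp a b).mul (contDiffAt_pi.1 hX a)).mul (contDiffAt_pi.1 hY b)

/-- The Gram-Schmidt process yields a smooth orthonormal frame, so that a surface with a positive
definite induced metric has a mean curvature vector. -/
theorem exists_isMeanCurvatureVector {p : R4} (hp : p ∈ Ω) {h₁ h₂ : R4 → ℝ} {X Y : R4 → R4}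
    (hX : ContDiffAt ℝ ∞ X p) (hY : ContDiffAt ℝ ∞ Y p)
    (htan : ∀ᶠ q in 𝓝 p, (fderiv ℝ h₁ q (X q) = 0 ∧ fderiv ℝ h₂ q (X q) = 0) ∧
      fderiv ℝ h₁ q (Y q) = 0 ∧ fderiv ℝ h₂ q (Y q) = 0)
    (hli : LinearIndependent ℝ ![X p, Y p])
    (hpos : ∀ u, u ≠ 0 → fderiv ℝ h₁ p u = 0 → 0 < g p u u) :
    ∃ N, IsMeanCurvatureVector g h₁ h₂ p N := by
  rw [LinearIndependent.pair_iff] at hli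
  obtain ⟨⟨hX1, -⟩, hY1, -⟩ := htan.self_of_nhds
  have hXp : 0 < g p (X p) (X p) := by
    refine hpos _ (fun h0 => ?_) hX1
    have := hli 1 0 (by simp [h0])
    simp at this
  set W₀ : R4 → R4 := fun q => (Real.sqrt (g q (X q) (X q)))⁻¹ • X q with hW₀
  have hW₀s : ContDiffAt ℝ ∞ W₀ p :=
    (((hg.contDiffAt_apply hp hX hX).sqrt hXp.ne').inv (Real.sqrt_pos.2 hXp).ne').smul hX
  set Y' : R4 → R4 := fun q => Y q - g q (Y q) (W₀ q) • W₀ q with hY'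
  have hY's : ContDiffAt ℝ ∞ Y' p := hY.sub ((hg.contDiffAt_apply hp hY hW₀s).smul hW₀s)
  have hYp : 0 < g p (Y' p) (Y' p) := by
    refine hpos _ (fun h0 => ?_) (by simp [hY', hW₀, hX1, hY1])
    have := hli (-(g p (Y p) (W₀ p) * (Real.sqrt (g p (X p) (X p)))⁻¹)) 1 (by
      rw [← h0, hY', hW₀]
      module)
    simp at this
  set W₁ : R4 → R4 := fun q => (Real.sqrt (g q (Y' q) (Y' q)))⁻¹ • Y' q with hW₁
  have hW₁s : ContDiffAt ℝ ∞ W₁ p :=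
    (((hg.contDiffAt_apply hp hY's hY's).sqrt hYp.ne').inv (Real.sqrt_pos.2 hYp).ne').smul hY's
  have hunit : ∀ (q v : R4), 0 < g q v v →
      g q ((Real.sqrt (g q v v))⁻¹ • v) ((Real.sqrt (g q v v))⁻¹ • v) = 1 := by
    intro q v hv
    rw [hg.smul_left, hg.smul_right, ← mul_assoc, ← mul_inv, Real.mul_self_sqrt hv.le,
      inv_mul_cancel₀ hv.ne']
  refine ⟨_, ![W₀, W₁], fun i => ?_, ?_, rfl⟩
  · fin_cases i
    · exact hW₀s
    · exact hW₁s
  filter_upwards [htan,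
    (hg.contDiffAt_apply hp hX hX).continuousAt.eventually (lt_mem_nhds hXp),
    (hg.contDiffAt_apply hp hY's hY's).continuousAt.eventually (lt_mem_nhds hYp)]
    with q ⟨⟨hX1, hX2⟩, hY1, hY2⟩ hXq hYq
  have h00 : g q (W₀ q) (W₀ q) = 1 := hunit q _ hXq
  have h11 : g q (W₁ q) (W₁ q) = 1 := hunit q _ hYq
  have h01 : g q (W₀ q) (W₁ q) = 0 := by
    simp only [hW₁, hY', hg.smul_right, hg.sub_right, h00]
    rw [hg.symm q (W₀ q) (Y q)]
    ring
  have h10 : g q (W₁ q) (W₀ q) = 0 := by rw [hg.symm, h01]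
  constructor
  · intro i
    fin_cases i
    · simp [hW₀, hX1, hX2]
    · simp [hW₁, hY', hW₀, hX1, hX2, hY1, hY2]
  · intro i j
    fin_cases i <;> fin_cases j <;> simp [h00, h01, h10, h11]

end IsMetricOn

/-! ### The Schwarzschild metric in Cartesian coordinates. -/

/-- The projection `(t, x) ↦ x` as a continuous linear map. -/
noncomputable def spatialL : R4 →L[ℝ] E3 :=
  LinearMap.toContinuousLinearMap
    { toFun := spatial
      map_add' := fun _ _ => rfl
      map_smul' := fun _ _ => rfl }

theorem spatialL_apply (p : R4) : spatialL p = spatial p := rfl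

theorem spatial_apply (p : R4) (i : Fin 3) : spatial p i = p i.succ := rfl

/-- The components of the unit vector `x / |x|`. -/
noncomputable def unitComp (i : Fin 3) (p : R4) : ℝ := p i.succ * sCoord p

/-- The factor `1 - 2m/r`. -/
noncomputable def lapseFactor (m : ℝ) (p : R4) : ℝ := 1 - 2 * m * sCoord p

/-- The differential of `r`. -/
noncomputable def radialForm (p u : R4) : ℝ := ∑ i : Fin 3, unitComp i p * u i.succ

theorem drForm_eq (p u : R4) : drForm p u = radialForm p u := by
  simp only [drForm, radialForm, unitComp, sCoord, PiLp.inner_apply, spatial_apply,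
    RCLike.inner_apply, conj_trivial, div_eq_mul_inv, Finset.sum_mul]
  refine Finset.sum_congr rfl fun i _ => by ring

theorem gSch_eq (m : ℝ) (p u w : R4) : gSch m p u w =
    -lapseFactor m p * (u 0 * w 0) + ((lapseFactor m p)⁻¹ - 1) * (radialForm p u * radialForm p w)
      + ∑ i : Fin 3, u i.succ * w i.succ := by
  have : inner ℝ (spatial u) (spatial w) = ∑ i : Fin 3, u i.succ * w i.succ := by
    simp only [PiLp.inner_apply, spatial_apply, RCLike.inner_apply, conj_trivial]
    refine Finset.sum_congr rfl fun i _ => by ring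
  simp only [gSch, drForm_eq, this, lapseFactor, sCoord, div_eq_mul_inv]
  ring

/-- The exterior region `r > 2m`. -/
def exterior (m : ℝ) : Set R4 := {p | 0 < sCoord p ∧ 0 < lapseFactor m p}

theorem spatial_ne_zero {p : R4} (hs : 0 < sCoord p) : spatial p ≠ 0 := by
  intro h
  simp [sCoord, h] at hs

theorem sum_unitComp_sq {p : R4} (hs : 0 < sCoord p) : ∑ i, unitComp i p ^ 2 = 1 := by
  have h0 := norm_ne_zero_iff.2 (spatial_ne_zero hs)
  have h1 : ∑ i : Fin 3, p i.succ ^ 2 = ‖spatial p‖ ^ 2 := by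
    rw [EuclideanSpace.norm_sq_eq]
    simp [spatial_apply]
  simp only [unitComp, mul_pow, ← Finset.sum_mul, h1, sCoord]
  field_simp

theorem succ_eq_unitComp {p : R4} (hs : 0 < sCoord p) (i : Fin 3) :
    p i.succ = unitComp i p * (sCoord p)⁻¹ := by
  rw [unitComp, mul_assoc, mul_inv_cancel₀ hs.ne', mul_one]

theorem hasFDerivAt_norm_spatial {p : R4} (hs : 0 < sCoord p) :
    HasFDerivAt (fun q => ‖spatial q‖)
      (∑ i : Fin 3, unitComp i p • ContinuousLinearMap.proj (R := ℝ) (φ := fun _ => ℝ) i.succ)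
      p := by
  have h0 := norm_pos_iff.2 (spatial_ne_zero hs)
  have h1 := (spatialL.hasFDerivAt (x := p)).norm_sq.sqrt (by
    rw [spatialL_apply]
    positivity)
  have h2 : (fun q => Real.sqrt (‖spatialL q‖ ^ 2)) = fun q => ‖spatial q‖ := by
    ext q
    rw [Real.sqrt_sq (norm_nonneg _)]
    rfl
  rw [h2] at h1
  have h4 : (∑ i : Fin 3, unitComp i p •
      ContinuousLinearMap.proj (R := ℝ) (φ := fun _ : Fin 4 => ℝ) i.succ) =
      (1 / (2 * Real.sqrt (‖spatialL p‖ ^ 2))) • 2 • (innerSL ℝ) (spatialL p) ∘SL spatialL := by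
    refine ContinuousLinearMap.ext fun u => ?_
    have h3 := drForm_eq p u
    simp only [drForm, radialForm] at h3
    simp [spatialL_apply, ← h3, Real.sqrt_sq]
    field_simp
  rw [h4]
  exact h1

theorem fderiv_norm_spatial {p : R4} (hs : 0 < sCoord p) (u : R4) :
    fderiv ℝ (fun q => ‖spatial q‖) p u = radialForm p u := by
  rw [(hasFDerivAt_norm_spatial hs).fderiv]
  simp [radialForm]

theorem contDiffAt_norm_spatial {p : R4} (hs : 0 < sCoord p) :
    ContDiffAt ℝ ∞ (fun q => ‖spatial q‖) p :=
  (spatialL.contDiff.contDiffAt (x := p)).norm ℝ (spatial_ne_zero hs)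

theorem contDiffAt_sCoord {p : R4} (hs : 0 < sCoord p) : ContDiffAt ℝ ∞ sCoord p :=
  (contDiffAt_norm_spatial hs).inv (norm_ne_zero_iff.2 (spatial_ne_zero hs))

theorem fderiv_sCoord {p : R4} (hs : 0 < sCoord p) (u : R4) :
    fderiv ℝ sCoord p u = -sCoord p ^ 2 * radialForm p u := by
  have h0 := norm_ne_zero_iff.2 (spatial_ne_zero hs)
  have h1 : HasFDerivAt sCoord _ p := (hasDerivAt_inv h0).comp_hasFDerivAt p
    (hasFDerivAt_norm_spatial hs)
  rw [h1.fderiv]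
  simp [radialForm, sCoord]

theorem hasFDerivAt_sCoord {p : R4} (hs : 0 < sCoord p) :
    HasFDerivAt sCoord (fderiv ℝ sCoord p) p :=
  ((contDiffAt_sCoord hs).differentiableAt (by simp)).hasFDerivAt

theorem contDiffAt_unitComp {p : R4} (hs : 0 < sCoord p) (i : Fin 3) :
    ContDiffAt ℝ ∞ (unitComp i) p :=
  (contDiff_apply ℝ ℝ i.succ).contDiffAt.mul (contDiffAt_sCoord hs)

theorem fderiv_unitComp {p : R4} (hs : 0 < sCoord p) (i : Fin 3) (u : R4) :
    fderiv ℝ (unitComp i) p u = sCoord p * (u i.succ - unitComp i p * radialForm p u) := by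
  have h1 : HasFDerivAt (unitComp i) _ p :=
    (hasFDerivAt_apply (𝕜 := ℝ) i.succ p).fun_mul (hasFDerivAt_sCoord hs)
  rw [h1.fderiv]
  simp [fderiv_sCoord hs]
  rw [unitComp]
  ring

theorem contDiffAt_lapseFactor (m : ℝ) {p : R4} (hs : 0 < sCoord p) :
    ContDiffAt ℝ ∞ (lapseFactor m) p :=
  contDiffAt_const.sub (contDiffAt_const.mul (contDiffAt_sCoord hs))

theorem fderiv_lapseFactor (m : ℝ) {p : R4} (hs : 0 < sCoord p) (u : R4) :
    fderiv ℝ (lapseFactor m) p u = 2 * m * sCoord p ^ 2 * radialForm p u := by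
  have h1 : HasFDerivAt (lapseFactor m) _ p := ((hasFDerivAt_sCoord hs).const_mul (2 * m)).const_sub 1
  rw [h1.fderiv]
  simp [fderiv_sCoord hs]
  ring

theorem gram_gSch_zero_zero (m : ℝ) (p : R4) : gram (gSch m) p 0 0 = -lapseFactor m p := by
  simp [gram, gSch_eq, coordVec, radialForm, Fin.succ_ne_zero]

theorem gram_gSch_zero_succ (m : ℝ) (p : R4) (i : Fin 3) : gram (gSch m) p 0 i.succ = 0 := by
  simp [gram, gSch_eq, coordVec, radialForm, Fin.succ_ne_zero, (Fin.succ_ne_zero i).symm]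

theorem gram_gSch_succ_zero (m : ℝ) (p : R4) (i : Fin 3) : gram (gSch m) p i.succ 0 = 0 := by
  simp [gram, gSch_eq, coordVec, radialForm, Fin.succ_ne_zero, (Fin.succ_ne_zero i).symm]

theorem gram_gSch_succ_succ (m : ℝ) (p : R4) (i j : Fin 3) : gram (gSch m) p i.succ j.succ =
    ((lapseFactor m p)⁻¹ - 1) * (unitComp i p * unitComp j p) + if i = j then 1 else 0 := by
  simp [gram, gSch_eq, coordVec, radialForm, Pi.single_apply, Fin.succ_ne_zero, eq_comm]

/-- The inverse of the Schwarzschild metric. -/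
noncomputable def schInv (m : ℝ) (p : R4) : Matrix (Fin 4) (Fin 4) ℝ :=
  Matrix.of (Fin.cons (Fin.cons (-(lapseFactor m p)⁻¹) fun _ => 0) fun i => Fin.cons 0 fun j =>
    (lapseFactor m p - 1) * (unitComp i p * unitComp j p) + if i = j then 1 else 0)

theorem gram_gSch_mul_schInv {m : ℝ} {p : R4} (hp : p ∈ exterior m) :
    gram (gSch m) p * schInv m p = 1 := by
  obtain ⟨hs, hh⟩ := hp
  have hu := sum_unitComp_sq hs
  have hi := inv_mul_cancel₀ hh.ne'
  ext a b
  rw [Matrix.mul_apply, Fin.sum_univ_succ]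
  refine Fin.cases ?_ (fun i => ?_) a <;> refine Fin.cases ?_ (fun j => ?_) b
  · simp [schInv, gram_gSch_zero_zero, gram_gSch_zero_succ, hh.ne']
  · simp [schInv, gram_gSch_zero_zero, gram_gSch_zero_succ, (Fin.succ_ne_zero j).symm]
  · simp [schInv, gram_gSch_succ_zero, Fin.succ_ne_zero]
  · simp only [schInv, gram_gSch_succ_zero, Matrix.of_apply, Fin.cons_succ, gram_gSch_succ_succ,
      zero_mul, zero_add, Matrix.one_apply, Fin.succ_inj]
    have : ∀ k, (((lapseFactor m p)⁻¹ - 1) * (unitComp i p * unitComp k p) +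
          (if i = k then 1 else 0)) *
        ((lapseFactor m p - 1) * (unitComp k p * unitComp j p) + if k = j then 1 else 0) =
        ((lapseFactor m p)⁻¹ - 1) * (lapseFactor m p - 1) * (unitComp i p * unitComp j p)
          * unitComp k p ^ 2
        + (if k = j then ((lapseFactor m p)⁻¹ - 1) * (unitComp i p * unitComp k p) else 0)
        + (if i = k then ((lapseFactor m p - 1) * (unitComp k p * unitComp j p) +
          if k = j then 1 else 0) else 0) := by
      intro k
      split_ifs <;> ring
    simp only [this, Finset.sum_add_distrib, ← Finset.mul_sum, hu]
    simp
    linear_combination (unitComp i p * unitComp j p) * hi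

theorem gramInv_gSch {m : ℝ} {p : R4} (hp : p ∈ exterior m) : gramInv (gSch m) p = schInv m p :=
  Matrix.inv_eq_right_inv (gram_gSch_mul_schInv hp)

theorem isMetricOn_gSch {m : ℝ} {Ω : Set R4} (hΩ : Ω ⊆ exterior m) : IsMetricOn (gSch m) Ω where
  apply_eq p u w := by
    simp only [Fin.sum_univ_succ (n := 3), gram_gSch_zero_zero, gram_gSch_zero_succ,
      gram_gSch_succ_zero, gram_gSch_succ_succ, gSch_eq, radialForm]
    simp only [Fin.sum_univ_three]
    simp
    ring
  symm p u w := by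
    simp only [gSch_eq]
    rw [mul_comm (u 0), mul_comm (radialForm p u)]
    congr 1
    exact Finset.sum_congr rfl fun i _ => mul_comm _ _
  smooth p hp a b := by
    obtain ⟨hs, hh⟩ := hΩ hp
    refine Fin.cases ?_ (fun i => ?_) a <;> refine Fin.cases ?_ (fun j => ?_) b
    · simp only [gram_gSch_zero_zero]
      exact (contDiffAt_lapseFactor m hs).neg
    · simp only [gram_gSch_zero_succ]
      exact contDiffAt_const
    · simp only [gram_gSch_succ_zero]
      exact contDiffAt_const
    · simp only [gram_gSch_succ_succ]
      exact ((((contDiffAt_lapseFactor m hs).inv hh.ne').sub contDiffAt_const).mul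
        ((contDiffAt_unitComp hs i).mul (contDiffAt_unitComp hs j))).add contDiffAt_const
  isUnit_det p hp := Matrix.isUnit_det_of_right_inverse (gram_gSch_mul_schInv (hΩ hp))

/-- The spatial part of the trace of `g⁻¹ ∂g`, with `k = h⁻¹` and `μ` the derivative of `h`. The
derivative of the unit vector `Y` is orthogonal to `Y` and drops out. Only the derivative of the
radial coefficient survives, and it cancels the `dt²` contribution. -/
theorem sum_rankOne_mul (h k s ρ μ : ℝ) (Y e : Fin 3 → ℝ) (hi : k * h = 1)
    (hu : ∑ i, Y i ^ 2 = 1) (hr : ∑ i, Y i * e i = ρ) :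
    ∑ i, ∑ j, ((h - 1) * (Y i * Y j) + if i = j then 1 else 0) *
      ((k - 1) * (Y i * (s * (e j - Y j * ρ)) + Y j * (s * (e i - Y i * ρ)))
        - k ^ 2 * μ * (Y i * Y j)) = -(k * μ) := by
  have key : (k - 1) * s * (((h - 1) * 2 * ∑ i, Y i ^ 2 + 2)
      * (∑ i, Y i * e i - (∑ i, Y i ^ 2) * ρ))
      - k ^ 2 * μ * ((h - 1) * (∑ i, Y i ^ 2) ^ 2 + ∑ i, Y i ^ 2) = -(k * μ) := by
    rw [hu, hr]
    linear_combination (-k * μ) * hi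
  rw [← key]
  simp only [add_mul, ite_mul, one_mul, zero_mul, Finset.sum_add_distrib, Finset.sum_ite_eq,
    Finset.mem_univ, if_true]
  simp only [Fin.sum_univ_three]
  ring

/-- In Cartesian coordinates the Schwarzschild metric has constant volume density. -/
theorem trace_schInv_mul_pd_gram {m : ℝ} {p : R4} (hp : p ∈ exterior m) (d : Fin 4) :
    ∑ a, ∑ b, gramInv (gSch m) p a b * pd d (fun q => gram (gSch m) q a b) p = 0 := by
  obtain ⟨hs, hh⟩ := hp
  have hu := sum_unitComp_sq hs
  set e := coordVec d
  have hr : ∑ i : Fin 3, unitComp i p * e i.succ = radialForm p e := rfl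
  have h0 : pd d (fun q => gram (gSch m) q 0 0) p = -(2 * m * sCoord p ^ 2 * radialForm p e) := by
    simp only [pd, gram_gSch_zero_zero, ← fderiv_lapseFactor m hs]
    rw [fderiv_fun_neg]
    rfl
  have hd := ((contDiffAt_lapseFactor m hs).differentiableAt (by simp)).hasFDerivAt
  have hc : ∀ i, HasFDerivAt (unitComp i) (fderiv ℝ (unitComp i) p) p := fun i =>
    ((contDiffAt_unitComp hs i).differentiableAt (by simp)).hasFDerivAt
  have h1 : ∀ i j : Fin 3, pd d (fun q => gram (gSch m) q i.succ j.succ) p =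
      ((lapseFactor m p)⁻¹ - 1) * (unitComp i p * (sCoord p * (e j.succ - unitComp j p * radialForm p e))
        + unitComp j p * (sCoord p * (e i.succ - unitComp i p * radialForm p e)))
      - (lapseFactor m p ^ 2)⁻¹ * (2 * m * sCoord p ^ 2 * radialForm p e)
        * (unitComp i p * unitComp j p) := by
    intro i j
    have h2 := ((((hasDerivAt_inv hh.ne').comp_hasFDerivAt p hd).sub_const 1).fun_mul
      ((hc i).fun_mul (hc j))).add_const (if i = j then (1 : ℝ) else 0)
    simp only [pd, gram_gSch_succ_succ]
    simp only [Function.comp_apply] at h2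
    rw [h2.fderiv]
    simp only [_root_.add_apply, _root_.smul_apply, smul_eq_mul, fderiv_unitComp hs,
      fderiv_lapseFactor m hs]
    ring
  have h2 : ∀ i : Fin 3, pd d (fun q => gram (gSch m) q 0 i.succ) p = 0 := by
    intro i
    simp [pd, gram_gSch_zero_succ]
  have h3 : ∀ i : Fin 3, pd d (fun q => gram (gSch m) q i.succ 0) p = 0 := by
    intro i
    simp [pd, gram_gSch_succ_zero]
  rw [gramInv_gSch ⟨hs, hh⟩]
  simp only [Fin.sum_univ_succ (n := 3), h0, h1, h2, h3]
  simp only [schInv, Matrix.of_apply, Fin.cons_zero, Fin.cons_succ]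
  have hi := inv_mul_cancel₀ hh.ne'
  have h4 := sum_rankOne_mul _ _ (sCoord p) _ (2 * m * sCoord p ^ 2 * radialForm p e)
    (fun i => unitComp i p) (fun i => e i.succ) hi hu hr
  simp only [zero_mul, zero_add, Finset.sum_const_zero, add_zero, ← inv_pow, h4]
  ring

/-! ### The null frame, its products and its brackets. -/

/-- A frame adapted to null infinity: `s ∂_v`, `s ∂_s` and the orthogonal projections of the
Cartesian coordinate vectors to the spheres `r = const`. -/
noncomputable def nullFrame (m : ℝ) : Fin 2 ⊕ Fin 3 → R4 → R4
  | .inl 0 => fun p => Fin.cons (sCoord p) fun _ => 0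
  -- The field `-r ∂_r` of the coordinates `(t, x)` changes `v`. The time component compensates for
  -- this, since `dr_*/dr = (1 - 2m/r)⁻¹`, so that the derivative is at fixed `v`.
  | .inl 1 => fun p => Fin.cons (-(sCoord p * lapseFactor m p)⁻¹) fun j => -p j.succ
  | .inr i => fun p => Fin.cons 0 fun j => (if i = j then 1 else 0) - unitComp i p * unitComp j p

/-- The coefficients of the inverse metric in `nullFrame`. -/
noncomputable def nullCoeff (m : ℝ) : Fin 2 ⊕ Fin 3 → Fin 2 ⊕ Fin 3 → R4 → ℝ
  -- With `h = 1 - 2ms`, the products of the first two fields form the matrix `!![-h s², 1; 1, 0]`,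
  -- with inverse `!![0, 1; 1, h s²]`. On the sphere part the projected coordinate vectors resolve
  -- the inverse metric with coefficients `δ_ij`.
  | .inl 0, .inl 1 => fun _ => 1
  | .inl 1, .inl 0 => fun _ => 1
  | .inl 1, .inl 1 => fun p => lapseFactor m p * sCoord p ^ 2
  | .inr i, .inr j => fun _ => if i = j then 1 else 0
  | _, _ => fun _ => 0

/-- The unit vector `x / |x|`. -/
noncomputable def sphereVec (p : R4) : E3 := sCoord p • spatial p

theorem sphereVec_apply (p : R4) (i : Fin 3) : sphereVec p i = unitComp i p := by
  simp [sphereVec, spatial_apply, unitComp, mul_comm]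

theorem sum_sphereVec {p : R4} (hs : 0 < sCoord p) : ‖sphereVec p‖ = 1 := by
  simp only [sphereVec, norm_smul, sCoord, norm_inv, norm_norm]
  exact inv_mul_cancel₀ (norm_ne_zero_iff.2 (spatial_ne_zero hs))

theorem contDiffAt_sphereVec {p : R4} (hs : 0 < sCoord p) : ContDiffAt ℝ ∞ sphereVec p :=
  (contDiffAt_sCoord hs).smul (spatialL.contDiff.contDiffAt)

theorem fderiv_sphereVec {p : R4} (hs : 0 < sCoord p) (u : R4) :
    fderiv ℝ sphereVec p u = sCoord p • (spatial u - radialForm p u • sphereVec p) := by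
  have h1 : HasFDerivAt sphereVec _ p := (hasFDerivAt_sCoord hs).fun_smul spatialL.hasFDerivAt
  rw [h1.fderiv]
  simp [fderiv_sCoord hs, spatialL_apply, sphereVec]
  module

section frame

variable {m : ℝ} {p : R4} (hp : p ∈ exterior m)
include hp

omit hp in
theorem radialForm_nullFrame_zero : radialForm p (nullFrame m (.inl 0) p) = 0 := by
  simp [radialForm, nullFrame]

theorem radialForm_nullFrame_one : radialForm p (nullFrame m (.inl 1) p) = -(sCoord p)⁻¹ := by
  have h := sum_unitComp_sq hp.1
  simp only [radialForm, nullFrame, Fin.cons_succ, succ_eq_unitComp hp.1]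
  calc _ = -((∑ i, unitComp i p ^ 2) * (sCoord p)⁻¹) := by
        rw [Finset.sum_mul, ← Finset.sum_neg_distrib]
        exact Finset.sum_congr rfl fun i _ => by ring
    _ = _ := by rw [h, one_mul]

theorem radialForm_nullFrame_inr (i : Fin 3) : radialForm p (nullFrame m (.inr i) p) = 0 := by
  have h := sum_unitComp_sq hp.1
  have h2 : ∀ j, unitComp j p * ((if i = j then 1 else 0) - unitComp i p * unitComp j p) =
      (if i = j then unitComp j p else 0) - unitComp i p * unitComp j p ^ 2 := by
    intro j
    split_ifs <;> ring
  simp [radialForm, nullFrame, h2, ← Finset.mul_sum, h]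

theorem fderiv_sphereVec_nullFrame_zero :
    fderiv ℝ sphereVec p (nullFrame m (.inl 0) p) = 0 := by
  rw [fderiv_sphereVec hp.1, radialForm_nullFrame_zero]
  ext i
  simp [spatial_apply, nullFrame]

theorem fderiv_sphereVec_nullFrame_one :
    fderiv ℝ sphereVec p (nullFrame m (.inl 1) p) = 0 := by
  rw [fderiv_sphereVec hp.1, radialForm_nullFrame_one hp]
  ext i
  simp [spatial_apply, nullFrame, sphereVec_apply, succ_eq_unitComp hp.1]
  ring

theorem fderiv_sphereVec_nullFrame_inr (i : Fin 3) :
    fderiv ℝ sphereVec p (nullFrame m (.inr i) p) =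
      sCoord p • (EuclideanSpace.single i 1 - unitComp i p • sphereVec p) := by
  rw [fderiv_sphereVec hp.1, radialForm_nullFrame_inr hp]
  ext j
  simp [spatial_apply, nullFrame, sphereVec_apply, eq_comm]

theorem contDiffAt_nullFrame (k : Fin 2 ⊕ Fin 3) : ContDiffAt ℝ ∞ (nullFrame m k) p := by
  obtain ⟨hs, hh⟩ := hp
  rw [contDiffAt_pi]
  rcases k with k | i
  · fin_cases k
    · refine Fin.cases ?_ fun j => ?_
      · exact contDiffAt_sCoord hs
      · exact contDiffAt_const
    · refine Fin.cases ?_ fun j => ?_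
      · exact (((contDiffAt_sCoord hs).mul (contDiffAt_lapseFactor m hs)).inv
          (mul_pos hs hh).ne').neg
      · exact (contDiff_apply ℝ ℝ j.succ).contDiffAt.neg
  · refine Fin.cases ?_ fun j => ?_
    · exact contDiffAt_const
    · exact contDiffAt_const.sub ((contDiffAt_unitComp hs i).mul (contDiffAt_unitComp hs j))

theorem fderiv_nullFrame_zero (u : R4) : fderiv ℝ (nullFrame m (.inl 0)) p u =
    Fin.cons (-sCoord p ^ 2 * radialForm p u) fun _ => 0 := by
  have hd := (contDiffAt_nullFrame hp (.inl 0)).differentiableAt (by simp)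
  ext c
  rw [← fderiv_component hd]
  refine Fin.cases ?_ (fun j => ?_) c
  · exact fderiv_sCoord hp.1 u
  · simp [nullFrame]

theorem fderiv_nullFrame_one (u : R4) : fderiv ℝ (nullFrame m (.inl 1)) p u =
    Fin.cons (-((lapseFactor m p)⁻¹ ^ 2 * radialForm p u *
      (lapseFactor m p - 2 * m * sCoord p))) fun j => -u j.succ := by
  have hd := (contDiffAt_nullFrame hp (.inl 1)).differentiableAt (by simp)
  obtain ⟨hs, hh⟩ := hp
  ext c
  rw [← fderiv_component hd]
  refine Fin.cases ?_ (fun j => ?_) c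
  · have h1 : HasFDerivAt (fun q => nullFrame m (.inl 1) q 0) _ p :=
      ((hasDerivAt_inv (mul_pos hs hh).ne').comp_hasFDerivAt p
        ((hasFDerivAt_sCoord hs).fun_mul ((contDiffAt_lapseFactor m hs).differentiableAt
          (by simp)).hasFDerivAt)).neg
    rw [h1.fderiv]
    simp [fderiv_sCoord hs, fderiv_lapseFactor m hs]
    field_simp
    ring
  · have h1 : HasFDerivAt (fun q => nullFrame m (.inl 1) q j.succ) _ p :=
      (hasFDerivAt_apply (𝕜 := ℝ) j.succ p).neg
    rw [h1.fderiv]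
    simp

theorem fderiv_nullFrame_inr (i : Fin 3) (u : R4) : fderiv ℝ (nullFrame m (.inr i)) p u =
    Fin.cons 0 fun j => -(sCoord p * (unitComp i p * (u j.succ - unitComp j p * radialForm p u)
      + unitComp j p * (u i.succ - unitComp i p * radialForm p u))) := by
  have hd := (contDiffAt_nullFrame hp (.inr i)).differentiableAt (by simp)
  ext c
  rw [← fderiv_component hd]
  have hc : ∀ i, HasFDerivAt (unitComp i) (fderiv ℝ (unitComp i) p) p := fun i =>
    ((contDiffAt_unitComp hp.1 i).differentiableAt (by simp)).hasFDerivAt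
  refine Fin.cases ?_ (fun j => ?_) c
  · simp [nullFrame]
  · have h1 : HasFDerivAt (fun q => nullFrame m (.inr i) q j.succ) _ p :=
      ((hc i).fun_mul (hc j)).const_sub _
    rw [h1.fderiv]
    simp [fderiv_unitComp hp.1]
    ring

/-- This is `[s ∂_v, s ∂_s] = -s ∂_v`. The brackets that follow are likewise combinations of the
frame without negative powers of `s`, which is what the Koszul formula requires. -/
theorem bracket_zero_one : bracket (nullFrame m (.inl 0)) (nullFrame m (.inl 1)) p =
    (-1 : ℝ) • nullFrame m (.inl 0) p := by
  have hs := hp.1.ne'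
  rw [bracket, fderiv_nullFrame_one hp, fderiv_nullFrame_zero hp, radialForm_nullFrame_zero,
    radialForm_nullFrame_one hp]
  ext c
  refine Fin.cases ?_ (fun j => ?_) c
  · simp [nullFrame]
    field_simp
  · simp [nullFrame]

theorem bracket_zero_inr (i : Fin 3) :
    bracket (nullFrame m (.inl 0)) (nullFrame m (.inr i)) p = 0 := by
  rw [bracket, fderiv_nullFrame_inr hp, fderiv_nullFrame_zero hp, radialForm_nullFrame_zero,
    radialForm_nullFrame_inr hp]
  ext c
  refine Fin.cases ?_ (fun j => ?_) c <;> simp [nullFrame]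

theorem bracket_one_inr (i : Fin 3) :
    bracket (nullFrame m (.inl 1)) (nullFrame m (.inr i)) p = nullFrame m (.inr i) p := by
  rw [bracket, fderiv_nullFrame_inr hp, fderiv_nullFrame_one hp, radialForm_nullFrame_one hp,
    radialForm_nullFrame_inr hp]
  ext c
  refine Fin.cases ?_ (fun j => ?_) c
  · simp [nullFrame]
  · simp [nullFrame, succ_eq_unitComp hp.1]

theorem bracket_inr_inr (i j : Fin 3) : bracket (nullFrame m (.inr i)) (nullFrame m (.inr j)) p =
    (sCoord p * unitComp i p) • nullFrame m (.inr j) p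
      + (-(sCoord p * unitComp j p)) • nullFrame m (.inr i) p := by
  rw [bracket, fderiv_nullFrame_inr hp, fderiv_nullFrame_inr hp, radialForm_nullFrame_inr hp,
    radialForm_nullFrame_inr hp]
  ext c
  refine Fin.cases ?_ (fun k => ?_) c
  · simp [nullFrame]
  · simp [nullFrame, eq_comm (a := j) (b := i)]
    ring

omit hp in
theorem gSch_nullFrame_zero (w : R4) :
    gSch m p (nullFrame m (.inl 0) p) w = -(lapseFactor m p * sCoord p * w 0) := by
  rw [gSch_eq, radialForm_nullFrame_zero]
  simp [nullFrame]
  ring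

theorem gSch_nullFrame_one (w : R4) :
    gSch m p (nullFrame m (.inl 1) p) w =
      (sCoord p)⁻¹ * (w 0 - (lapseFactor m p)⁻¹ * radialForm p w) := by
  have hs := hp.1.ne'
  have hh := hp.2.ne'
  have h1 : ∑ i : Fin 3, nullFrame m (.inl 1) p i.succ * w i.succ =
      -((sCoord p)⁻¹ * radialForm p w) := by
    rw [radialForm, Finset.mul_sum, ← Finset.sum_neg_distrib]
    refine Finset.sum_congr rfl fun i _ => ?_
    simp only [nullFrame, Fin.cons_succ, succ_eq_unitComp hp.1]
    ring
  rw [gSch_eq, radialForm_nullFrame_one hp, h1]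
  simp [nullFrame]
  field_simp
  ring

theorem gSch_nullFrame_inr (i : Fin 3) (w : R4) :
    gSch m p (nullFrame m (.inr i) p) w = w i.succ - unitComp i p * radialForm p w := by
  have h2 : ∀ j : Fin 3, ((if i = j then 1 else 0) - unitComp i p * unitComp j p) * w j.succ =
      (if i = j then w j.succ else 0) - unitComp i p * (unitComp j p * w j.succ) := by
    intro j
    split_ifs <;> ring
  rw [gSch_eq, radialForm_nullFrame_inr hp]
  simp [nullFrame, h2, ← Finset.mul_sum, radialForm]

theorem gramInv_eq_nullFrame (a b : Fin 4) : gramInv (gSch m) p a b =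
    ∑ k, ∑ l, nullCoeff m k l p * nullFrame m k p a * nullFrame m l p b := by
  have hs := hp.1.ne'
  have hh := hp.2.ne'
  have hu := sum_unitComp_sq hp.1
  rw [gramInv_gSch hp]
  simp only [Fintype.sum_sum_type, Fin.sum_univ_two, nullCoeff, schInv, Matrix.of_apply]
  have h3 : ∀ i j k : Fin 3, ((if k = i then 1 else 0) - unitComp k p * unitComp i p) *
      ((if k = j then 1 else 0) - unitComp k p * unitComp j p) =
      unitComp i p * unitComp j p * unitComp k p ^ 2
      - (if k = i then unitComp k p * unitComp j p else 0)
      - (if k = j then unitComp k p * unitComp i p else 0)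
      + (if k = i then if k = j then 1 else 0 else 0) := by
    intro i j k
    split_ifs <;> ring
  refine Fin.cases ?_ (fun i => ?_) a <;> refine Fin.cases ?_ (fun j => ?_) b
  · simp [nullFrame]
    field_simp
    ring
  · simp [nullFrame, succ_eq_unitComp hp.1]
    field_simp
    ring
  · simp [nullFrame, succ_eq_unitComp hp.1]
    field_simp
    ring
  · simp [nullFrame, succ_eq_unitComp hp.1, h3, Finset.sum_add_distrib, ← Finset.mul_sum, hu]
    field_simp
    ring

end frame

/-! ### The algebra of functions smooth in `(y, s, τ)` up to `s = 0`. -/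

/-- The functions that extend smoothly, as functions of the coordinates `Z`, to `K`. -/
def IsSmoothIn (Z : R4 → E3 × ℝ × ℝ) (Ω : Set R4) (K : Set (E3 × ℝ × ℝ)) (h : R4 → ℝ) : Prop :=
  ∃ H : E3 × ℝ × ℝ → ℝ, (∀ z ∈ K, ContDiffAt ℝ ∞ H z) ∧ ∀ p ∈ Ω, h p = H (Z p)

/-- The coordinates `(y, s, τ)` of a point. -/
noncomputable def leafCoord (tau : R4 → ℝ) (p : R4) : E3 × ℝ × ℝ := (sphereVec p, sCoord p, tau p)

/-- The vector fields `nullFrame` in the coordinates `(y, s, τ)`, where `a` is the last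
component. -/
noncomputable def frameCoord (a : Fin 2 ⊕ Fin 3 → E3 × ℝ × ℝ → ℝ) :
    Fin 2 ⊕ Fin 3 → E3 × ℝ × ℝ → E3 × ℝ × ℝ
  | .inl 0 => fun z => (0, 0, a (.inl 0) z)
  | .inl 1 => fun z => (0, z.2.1, a (.inl 1) z)
  | .inr i => fun z => (z.2.1 • (EuclideanSpace.single i 1 - z.1 i • z.1), 0, a (.inr i) z)

/-- A time function `tau` on an open part `Ω` of the exterior region whose derivatives along
`nullFrame` are smooth functions `a` of `(y, s, τ)` on a compact set `K`. -/
structure IsLeafCoord (m : ℝ) (tau : R4 → ℝ) (Ω : Set R4) (K : Set (E3 × ℝ × ℝ))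
    (a : Fin 2 ⊕ Fin 3 → E3 × ℝ × ℝ → ℝ) : Prop where
  isOpen : IsOpen Ω
  isCompact : IsCompact K
  subset : Ω ⊆ exterior m
  mapsTo : ∀ p ∈ Ω, leafCoord tau p ∈ K
  smooth_tau : ∀ p ∈ Ω, ContDiffAt ℝ ∞ tau p
  smooth_deriv : ∀ k, ∀ z ∈ K, ContDiffAt ℝ ∞ (a k) z
  deriv_tau : ∀ p ∈ Ω, ∀ k, fderiv ℝ tau p (nullFrame m k p) = a k (leafCoord tau p)

theorem contDiffAt_coord (z : E3 × ℝ × ℝ) (i : Fin 3) :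
    ContDiffAt ℝ ∞ (fun z : E3 × ℝ × ℝ => z.1 i) z :=
  (EuclideanSpace.proj (𝕜 := ℝ) i).contDiff.contDiffAt.comp z contDiffAt_fst

theorem contDiffAt_frameCoord {a : Fin 2 ⊕ Fin 3 → E3 × ℝ × ℝ → ℝ} {z : E3 × ℝ × ℝ}
    (ha : ∀ k, ContDiffAt ℝ ∞ (a k) z) (k : Fin 2 ⊕ Fin 3) : ContDiffAt ℝ ∞ (frameCoord a k) z := by
  have hs : ContDiffAt ℝ ∞ (fun z : E3 × ℝ × ℝ => z.2.1) z := contDiffAt_snd.fst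
  rcases k with k | i
  · fin_cases k
    · exact contDiffAt_const.prodMk (contDiffAt_const.prodMk (ha _))
    · exact contDiffAt_const.prodMk (hs.prodMk (ha _))
  · exact (hs.smul (contDiffAt_const.sub ((contDiffAt_coord z i).smul contDiffAt_fst))).prodMk
      (contDiffAt_const.prodMk (ha _))

namespace IsLeafCoord

variable {m : ℝ} {tau : R4 → ℝ} {Ω : Set R4} {K : Set (E3 × ℝ × ℝ)}
  {a : Fin 2 ⊕ Fin 3 → E3 × ℝ × ℝ → ℝ} (L : IsLeafCoord m tau Ω K a)
include L

theorem contDiffAt_leafCoord {p : R4} (hp : p ∈ Ω) : ContDiffAt ℝ ∞ (leafCoord tau) p :=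
  (contDiffAt_sphereVec (L.subset hp).1).prodMk
    ((contDiffAt_sCoord (L.subset hp).1).prodMk (L.smooth_tau p hp))

/-- Expressed in `(y, s, τ)` the frame is smooth up to `s = 0`, although `(t, x)` run off to
infinity there. -/
theorem fderiv_leafCoord {p : R4} (hp : p ∈ Ω) (k : Fin 2 ⊕ Fin 3) :
    fderiv ℝ (leafCoord tau) p (nullFrame m k p) = frameCoord a k (leafCoord tau p) := by
  have hpe := L.subset hp
  have hs := hpe.1
  have h1 : HasFDerivAt (leafCoord tau) _ p :=
    ((contDiffAt_sphereVec hs).differentiableAt (by simp)).hasFDerivAt.prodMk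
      ((hasFDerivAt_sCoord hs).prodMk
        ((L.smooth_tau p hp).differentiableAt (by simp)).hasFDerivAt)
  rw [h1.fderiv]
  simp only [ContinuousLinearMap.prod_apply, fderiv_sCoord hs,
    L.deriv_tau p hp]
  rcases k with k | i
  · fin_cases k
    · simp [radialForm_nullFrame_zero, frameCoord, fderiv_sphereVec_nullFrame_zero hpe]
    · simp only [Fin.mk_one, radialForm_nullFrame_one hpe, frameCoord,
        fderiv_sphereVec_nullFrame_one hpe]
      congr 2
      simp [leafCoord]
      field_simp
  · simp [radialForm_nullFrame_inr hpe, frameCoord, fderiv_sphereVec_nullFrame_inr hpe, leafCoord,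
      sphereVec_apply]

/-- By the chain rule the derivative is again a smooth function of the coordinates, because the
frame is. -/
theorem isSmoothIn_deriv {h : R4 → ℝ} (hh : IsSmoothIn (leafCoord tau) Ω K h)
    (k : Fin 2 ⊕ Fin 3) :
    IsSmoothIn (leafCoord tau) Ω K fun p => fderiv ℝ h p (nullFrame m k p) := by
  obtain ⟨H, hH, h1⟩ := hh
  refine ⟨fun z => fderiv ℝ H z (frameCoord a k z), fun z hz =>
    ((hH z hz).fderiv_right (m := ∞) (by simp)).clm_apply
      (contDiffAt_frameCoord (fun k => L.smooth_deriv k z hz) k), fun p hp => ?_⟩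
  have h2 : h =ᶠ[𝓝 p] H ∘ leafCoord tau := by
    filter_upwards [L.isOpen.mem_nhds hp] with q hq using h1 q hq
  change fderiv ℝ h p (nullFrame m k p) = _
  rw [h2.fderiv_eq, fderiv_comp p ((hH _ (L.mapsTo p hp)).differentiableAt (by simp))
    ((L.contDiffAt_leafCoord hp).differentiableAt (by simp))]
  simp [L.fderiv_leafCoord hp]

omit L in
theorem isSmoothIn_sCoord : IsSmoothIn (leafCoord tau) Ω K sCoord :=
  ⟨fun z => z.2.1, fun _ _ => contDiffAt_snd.fst, fun _ _ => rfl⟩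

omit L in
theorem isSmoothIn_unitComp (i : Fin 3) : IsSmoothIn (leafCoord tau) Ω K (unitComp i) :=
  ⟨fun z => z.1 i, fun z _ => contDiffAt_coord z i, fun p _ => (sphereVec_apply p i).symm⟩

/-- Each product and each bracket is a polynomial in `y`, `s` and `m`. Boundedness is continuity of
the extension on the compact set `K`. -/
theorem admissibleFrame :
    AdmissibleFrame (gSch m) Ω (IsSmoothIn (leafCoord tau) Ω K) (nullFrame m) (nullCoeff m) := by
  have hmetric := isMetricOn_gSch L.subset
  have congr : ∀ {h h' : R4 → ℝ}, IsSmoothIn (leafCoord tau) Ω K h → (∀ p ∈ Ω, h' p = h p) →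
      IsSmoothIn (leafCoord tau) Ω K h' := by
    rintro h h' ⟨H, hH, h1⟩ h2
    exact ⟨H, hH, fun p hp => (h2 p hp).trans (h1 p hp)⟩
  have const : ∀ c : ℝ, IsSmoothIn (leafCoord tau) Ω K fun _ => c := fun c =>
    ⟨fun _ => c, fun _ _ => contDiffAt_const, fun _ _ => rfl⟩
  have add : ∀ {h h' : R4 → ℝ}, IsSmoothIn (leafCoord tau) Ω K h →
      IsSmoothIn (leafCoord tau) Ω K h' → IsSmoothIn (leafCoord tau) Ω K fun p => h p + h' p := by
    rintro h h' ⟨H, hH, h1⟩ ⟨H', hH', h1'⟩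
    exact ⟨fun z => H z + H' z, fun z hz => (hH z hz).add (hH' z hz), fun p hp => by
      simp only [h1 p hp, h1' p hp]⟩
  have mul : ∀ {h h' : R4 → ℝ}, IsSmoothIn (leafCoord tau) Ω K h →
      IsSmoothIn (leafCoord tau) Ω K h' → IsSmoothIn (leafCoord tau) Ω K fun p => h p * h' p := by
    rintro h h' ⟨H, hH, h1⟩ ⟨H', hH', h1'⟩
    exact ⟨fun z => H z * H' z, fun z hz => (hH z hz).mul (hH' z hz), fun p hp => by
      simp only [h1 p hp, h1' p hp]⟩
  have hs := isSmoothIn_sCoord (tau := tau) (Ω := Ω) (K := K)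
  have hl : IsSmoothIn (leafCoord tau) Ω K (lapseFactor m) :=
    congr (add (const 1) (mul (const (-(2 * m))) hs)) fun p _ => by rw [lapseFactor]; ring
  have hy := isSmoothIn_unitComp (tau := tau) (Ω := Ω) (K := K)
  have happly : ∀ k l, IsSmoothIn (leafCoord tau) Ω K
      fun p => gSch m p (nullFrame m k p) (nullFrame m l p) := by
    have h1 : ∀ l, IsSmoothIn (leafCoord tau) Ω K
        fun p => gSch m p (nullFrame m (.inl 0) p) (nullFrame m l p) := by
      intro l
      rcases l with l | j
      · fin_cases l
        · refine congr (mul (const (-1)) (mul hl (mul hs hs))) fun p hp => ?_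
          simp only [Fin.zero_eta, gSch_nullFrame_zero]
          simp [nullFrame]
          ring
        · refine congr (const 1) fun p hp => ?_
          have h0 := (L.subset hp).1.ne'
          have h2 := (L.subset hp).2.ne'
          simp only [Fin.mk_one, gSch_nullFrame_zero]
          simp [nullFrame]
          field_simp
      · refine congr (const 0) fun p hp => ?_
        rw [gSch_nullFrame_zero]
        simp [nullFrame]
    have h2 : ∀ l, IsSmoothIn (leafCoord tau) Ω K
        fun p => gSch m p (nullFrame m (.inl 1) p) (nullFrame m l p) := by
      intro l
      rcases l with l | j
      · fin_cases l
        · exact congr (h1 (.inl 1)) fun p hp => hmetric.symm _ _ _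
        · refine congr (const 0) fun p hp => ?_
          have h0 := (L.subset hp).1.ne'
          have h2 := (L.subset hp).2.ne'
          simp only [Fin.mk_one, gSch_nullFrame_one (L.subset hp),
            radialForm_nullFrame_one (L.subset hp)]
          simp [nullFrame]
      · refine congr (const 0) fun p hp => ?_
        rw [gSch_nullFrame_one (L.subset hp), radialForm_nullFrame_inr (L.subset hp)]
        simp [nullFrame]
    intro k l
    rcases k with k | i
    · fin_cases k
      · exact h1 l
      · exact h2 l
    · rcases l with l | j
      · fin_cases l
        · exact congr (h1 (.inr i)) fun p hp => hmetric.symm _ _ _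
        · exact congr (h2 (.inr i)) fun p hp => hmetric.symm _ _ _
      · refine congr (add (const (if i = j then 1 else 0)) (mul (const (-1)) (mul (hy i) (hy j))))
          fun p hp => ?_
        rw [gSch_nullFrame_inr (L.subset hp), radialForm_nullFrame_inr (L.subset hp)]
        simp [nullFrame, eq_comm (a := i) (b := j)]
        split_ifs <;> ring
  have hbr : ∀ {k l j}, IsSmoothIn (leafCoord tau) Ω K (fun p =>
        gSch m p (bracket (nullFrame m k) (nullFrame m l) p) (nullFrame m j p)) →
      IsSmoothIn (leafCoord tau) Ω K (fun p =>
        gSch m p (bracket (nullFrame m l) (nullFrame m k) p) (nullFrame m j p)) := by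
    intro k l j h
    refine congr (mul (const (-1)) h) fun p hp => ?_
    rw [← hmetric.smul_left]
    congr 1
    rw [bracket, bracket]
    module
  have hself : ∀ k j, IsSmoothIn (leafCoord tau) Ω K (fun p =>
      gSch m p (bracket (nullFrame m k) (nullFrame m k) p) (nullFrame m j p)) := fun k j =>
    congr (const 0) fun p _ => by simp [bracket, hmetric.apply_eq]
  have h01 : ∀ j, IsSmoothIn (leafCoord tau) Ω K (fun p => gSch m p
      (bracket (nullFrame m (.inl 0)) (nullFrame m (.inl 1)) p) (nullFrame m j p)) := fun j =>
    congr (mul (const (-1)) (happly (.inl 0) j)) fun p hp => by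
      rw [bracket_zero_one (L.subset hp), hmetric.smul_left]
  have h0i : ∀ i j, IsSmoothIn (leafCoord tau) Ω K (fun p => gSch m p
      (bracket (nullFrame m (.inl 0)) (nullFrame m (.inr i)) p) (nullFrame m j p)) := fun i j =>
    congr (const 0) fun p hp => by
      rw [bracket_zero_inr (L.subset hp)]
      simp [hmetric.apply_eq]
  have h1i : ∀ i j, IsSmoothIn (leafCoord tau) Ω K (fun p => gSch m p
      (bracket (nullFrame m (.inl 1)) (nullFrame m (.inr i)) p) (nullFrame m j p)) := fun i j =>
    congr (happly (.inr i) j) fun p hp => by rw [bracket_one_inr (L.subset hp)]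
  have hij : ∀ i i' j, IsSmoothIn (leafCoord tau) Ω K (fun p => gSch m p
      (bracket (nullFrame m (.inr i)) (nullFrame m (.inr i')) p) (nullFrame m j p)) :=
    fun i i' j => congr (add (mul (mul hs (hy i)) (happly (.inr i') j))
      (mul (mul (const (-1)) (mul hs (hy i'))) (happly (.inr i) j))) fun p hp => by
        rw [bracket_inr_inr (L.subset hp), hmetric.add_left, hmetric.smul_left, hmetric.smul_left]
        ring
  refine ⟨L.isOpen, hmetric, congr, const, add, mul, ?_, L.isSmoothIn_deriv, ?_,
    fun k p hp => contDiffAt_nullFrame (L.subset hp) k, happly, ?_, ?_,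
    fun p hp => gramInv_eq_nullFrame (L.subset hp)⟩
  · rintro h ⟨H, hH, h1⟩ p hp
    have h2 : h =ᶠ[𝓝 p] H ∘ leafCoord tau := by
      filter_upwards [L.isOpen.mem_nhds hp] with q hq using h1 q hq
    exact ((hH _ (L.mapsTo p hp)).comp p (L.contDiffAt_leafCoord hp)).congr_of_eventuallyEq h2
  · rintro h ⟨H, hH, h1⟩
    obtain ⟨C, hC⟩ := L.isCompact.exists_bound_of_continuousOn
      (fun z hz => (hH z hz).continuousAt.continuousWithinAt)
    exact ⟨C, fun p hp => (h1 p hp).trans_le ((le_abs_self _).trans (hC _ (L.mapsTo p hp)))⟩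
  · intro k l j
    rcases k with k | i <;> rcases l with l | i'
    · fin_cases k <;> fin_cases l
      · exact hself _ _
      · exact h01 _
      · exact hbr (h01 _)
      · exact hself _ _
    · fin_cases k
      · exact h0i _ _
      · exact h1i _ _
    · fin_cases l
      · exact hbr (h0i _ _)
      · exact hbr (h1i _ _)
    · exact hij _ _ _
  · intro k l
    rcases k with k | i <;> rcases l with l | j
    · fin_cases k <;> fin_cases l
      · exact const 0
      · exact const 1
      · exact const 1
      · exact congr (mul hl (mul hs hs)) fun p _ => by simp [nullCoeff, pow_two]
    · fin_cases k <;> exact const 0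
    · fin_cases l <;> exact const 0
    · exact const _

end IsLeafCoord

/-! ### Smooth functions on the sphere through their degree zero extensions. -/

theorem coe_dir {x : E3} (hx : x ≠ 0) : (dir x : E3) = ‖x‖⁻¹ • x := by
  simp [dir, hx]

theorem contDiffAt_coe_dir {x : E3} (hx : x ≠ 0) : ContDiffAt ℝ ∞ (fun x => (dir x : E3)) x := by
  have h : (fun x => (dir x : E3)) =ᶠ[𝓝 x] fun x => ‖x‖⁻¹ • x := by
    filter_upwards [isOpen_ne.mem_nhds hx] with z hz using coe_dir hz
  exact (((contDiffAt_norm ℝ hx).inv (norm_ne_zero_iff.2 hx)).smul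
    contDiffAt_id).congr_of_eventuallyEq h

theorem coe_dir_ne_zero (x : E3) : (dir x : E3) ≠ 0 := by
  intro h
  have := mem_sphere_zero_iff_norm.1 (dir x).2
  simp [h] at this

/-- Smoothness of the degree zero extension away from the origin. -/
def HasSmoothExt (φ : S2 → ℝ) : Prop := ∀ x : E3, x ≠ 0 → ContDiffAt ℝ ∞ (homExt φ) x

theorem HasSmoothExt.of_contMDiff {f : S2 → ℝ} (hf : ContMDiff (𝓡 2) 𝓘(ℝ) ∞ f) :
    HasSmoothExt f := by
  intro x hx
  have : Fact (Module.finrank ℝ E3 = 2 + 1) := ⟨by simp⟩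
  -- The radial projection is a smooth map to the sphere only away from the origin, so smoothness is
  -- checked on this open submanifold.
  let U : TopologicalSpace.Opens E3 := ⟨{x | x ≠ 0}, isOpen_ne⟩
  have h1 : ContMDiff 𝓘(ℝ, E3) 𝓘(ℝ, E3) ∞ (fun x : U => (dir (x : E3) : E3)) := by
    intro z
    exact (contMDiffAt_subtype_iff (f := fun x : E3 => (dir x : E3))).2
      (contDiffAt_coe_dir z.2).contMDiffAt
  have h2 : ContMDiff 𝓘(ℝ, E3) (𝓡 2) ∞ (fun x : U => dir (x : E3)) :=
    h1.codRestrict_sphere fun x => (dir (x : E3)).2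
  have h3 : ContMDiffAt 𝓘(ℝ, E3) 𝓘(ℝ) ∞ (fun z : U => homExt f z) ⟨x, hx⟩ := (hf.comp h2) _
  exact (contMDiffAt_subtype_iff.1 h3).contDiffAt

/-- Euclidean gradients and Laplacians of a degree zero function are not of degree zero, and only
their values on the sphere are used. Composing with the radial projection replaces them by the
degree zero extensions of those values. -/
theorem HasSmoothExt.of_comp_dir {F : E3 → ℝ} (hF : ∀ x ≠ 0, ContDiffAt ℝ ∞ F x) :
    HasSmoothExt fun y => F y := fun x hx =>
  (hF _ (coe_dir_ne_zero x)).comp x (contDiffAt_coe_dir hx)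

theorem HasSmoothExt.contDiffAt_gradient {φ : S2 → ℝ} (hφ : HasSmoothExt φ) {x : E3}
    (hx : x ≠ 0) : ContDiffAt ℝ ∞ (gradient (homExt φ)) x :=
  ((InnerProductSpace.toDual ℝ E3).symm.toContinuousLinearEquiv.contDiff.contDiffAt).comp x
    ((hφ x hx).fderiv_right (m := ∞) (by simp))

theorem HasSmoothExt.sphereGradSq {φ : S2 → ℝ} (hφ : HasSmoothExt φ) :
    HasSmoothExt (sphereGradSq φ) :=
  .of_comp_dir (F := fun x => ‖gradient (homExt φ) x‖ ^ 2) fun _ hx =>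
    (hφ.contDiffAt_gradient hx).norm_sq ℝ

theorem HasSmoothExt.inner_sphereGrad {φ χ : S2 → ℝ} (hφ : HasSmoothExt φ) (hχ : HasSmoothExt χ) :
    HasSmoothExt fun y => inner ℝ (sphereGrad φ y) (sphereGrad χ y) :=
  .of_comp_dir (F := fun x => inner ℝ (gradient (homExt φ) x) (gradient (homExt χ) x)) fun _ hx =>
    (hφ.contDiffAt_gradient hx).inner ℝ (hχ.contDiffAt_gradient hx)

theorem HasSmoothExt.sphereLaplacian {φ : S2 → ℝ} (hφ : HasSmoothExt φ) :
    HasSmoothExt (sphereLaplacian φ) := by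
  refine .of_comp_dir (F := Laplacian.laplacian (homExt φ)) fun x hx => ?_
  rw [InnerProductSpace.laplacian_eq_iteratedFDeriv_stdOrthonormalBasis]
  refine ContDiffAt.sum fun i _ => ?_
  simp only [iteratedFDeriv_two_apply]
  exact ((((hφ x hx).fderiv_right (m := ∞) (by simp)).fderiv_right (m := ∞) (by simp)).clm_apply
    contDiffAt_const).clm_apply contDiffAt_const

theorem homExt_coe (φ : S2 → ℝ) (y : S2) : homExt φ (y : E3) = φ y := by
  have h := mem_sphere_zero_iff_norm.1 y.2
  have h0 : (y : E3) ≠ 0 := by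
    intro h0
    simp [h0] at h
  have : dir (y : E3) = y := Subtype.ext (by rw [coe_dir h0, h]; simp)
  rw [homExt, this]

/-- The extension is constant along rays. Hence projecting a coordinate vector to the tangent plane
does not change the derivative. -/
theorem HasSmoothExt.fderiv_self {φ : S2 → ℝ} (hφ : HasSmoothExt φ) {x : E3} (hx : x ≠ 0) :
    fderiv ℝ (homExt φ) x x = 0 := by
  have h1 : HasDerivAt (fun c : ℝ => homExt φ (c • x)) (fderiv ℝ (homExt φ) x x) 1 := by
    have h2 : HasDerivAt (fun c : ℝ => c • x) x 1 := by
      simpa using (hasDerivAt_id (1 : ℝ)).smul_const x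
    have h3 : HasFDerivAt (homExt φ) (fderiv ℝ (homExt φ) x) ((1 : ℝ) • x) := by
      rw [one_smul]
      exact ((hφ x hx).differentiableAt (by simp)).hasFDerivAt
    exact h3.comp_hasDerivAt 1 h2
  have h2 : (fun c : ℝ => homExt φ (c • x)) =ᶠ[𝓝 1] fun _ => homExt φ x := by
    filter_upwards [lt_mem_nhds one_pos] with c hc
    have : dir (c • x) = dir x := by
      refine Subtype.ext ?_
      rw [coe_dir (smul_ne_zero hc.ne' hx), coe_dir hx, norm_smul, Real.norm_of_nonneg hc.le,
        mul_inv, smul_smul]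
      congr 1
      field_simp
    rw [homExt, this, homExt]
  exact h1.unique ((hasDerivAt_const _ _).congr_of_eventuallyEq h2)

theorem sphereGradSq_eq_sum (φ : S2 → ℝ) (y : S2) :
    sphereGradSq φ y = ∑ i, fderiv ℝ (homExt φ) (y : E3) (EuclideanSpace.single i 1) ^ 2 := by
  rw [sphereGradSq, EuclideanSpace.norm_sq_eq]
  refine Finset.sum_congr rfl fun i _ => ?_
  have h : fderiv ℝ (homExt φ) (y : E3) (EuclideanSpace.single i 1) = sphereGrad φ y i := by
    rw [← toDual_gradient, InnerProductSpace.toDual_apply_apply]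
    rw [EuclideanSpace.inner_single_right]
    simp [sphereGrad]
  rw [h, Real.norm_eq_abs, sq_abs]

/-- The function `⟨∇|∇f|², ∇f⟩` on the sphere. -/
noncomputable def gradSqDeriv (f : S2 → ℝ) (y : S2) : ℝ :=
  inner ℝ (sphereGrad (sphereGradSq f) y) (sphereGrad f y)

/-! ### The time function. -/

/-- The part of `P` that does not depend on `τ`. -/
noncomputable def heightBase (f : S2 → ℝ) (y : S2) (s : ℝ) : ℝ :=
  f y - 1 / 2 * s * sphereGradSq f y + 1 / 4 * s ^ 2 * gradSqDeriv f y

/-- The factor `1 - s Δf / 2`. -/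
noncomputable def slopeFactor (f : S2 → ℝ) (y : S2) (s : ℝ) : ℝ := 1 - 1 / 2 * s * sphereLaplacian f y

/-- Since `P` is affine in `τ²`, the equation of the leaves can be solved for `τ` explicitly. -/
theorem heightP_eq (f : S2 → ℝ) (y : S2) (s τ : ℝ) :
    heightP f y s τ = heightBase f y s - 1 / 2 * s * slopeFactor f y s * τ ^ 2 := by
  simp only [heightP, phiFun, psiFun, heightBase, slopeFactor, gradSqDeriv]
  ring

/-- The value at `p` of `2 (v + A) / (s D)`, the square of the time function. -/
noncomputable def timeSq (m : ℝ) (f : S2 → ℝ) (p : R4) : ℝ :=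
  2 * (vCoord m p + heightBase f (yCoord p) (sCoord p)) /
    (sCoord p * slopeFactor f (yCoord p) (sCoord p))

/-- The function whose level sets are the surfaces `v = -P`. -/
noncomputable def timeFun (m : ℝ) (f : S2 → ℝ) (p : R4) : ℝ := Real.sqrt (timeSq m f p)

/-- The condition `0 < τ` selects the positive root. It also excludes points where `timeSq` is
negative, since there the real square root takes its default value `0`. -/
theorem mem_leaf_iff {m : ℝ} {f : S2 → ℝ} {s₀ τ : ℝ} {p : R4} (hτ : 0 < τ) (hs : 0 < sCoord p)
    (hs₀ : sCoord p < s₀) (hD : 0 < slopeFactor f (yCoord p) (sCoord p)) :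
    p ∈ leaf m f s₀ τ ↔ timeFun m f p = τ := by
  have hsD := mul_pos hs hD
  have h1 : timeFun m f p = τ ↔ timeSq m f p = τ ^ 2 := by
    rw [timeFun]
    constructor
    · rintro rfl
      rw [Real.sq_sqrt (Real.sqrt_pos.1 hτ).le]
    · intro h
      rw [h, Real.sqrt_sq hτ.le]
  rw [h1, timeSq, div_eq_iff hsD.ne']
  simp only [leaf, Set.mem_ofPred_eq, heightP_eq, hs, hs₀, true_and]
  constructor <;> intro h <;> linarith

theorem coe_yCoord {p : R4} (hs : 0 < sCoord p) : ((yCoord p : S2) : E3) = sphereVec p :=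
  coe_dir (spatial_ne_zero hs)

theorem homExt_sphereVec (φ : S2 → ℝ) {p : R4} (hs : 0 < sCoord p) :
    homExt φ (sphereVec p) = φ (yCoord p) := by
  rw [← coe_yCoord hs, homExt_coe]

theorem sphereVec_ne_zero {p : R4} (hs : 0 < sCoord p) : sphereVec p ≠ 0 :=
  norm_ne_zero_iff.1 (by rw [sum_sphereVec hs]; exact one_ne_zero)

theorem eventually_sCoord_pos {p : R4} (hs : 0 < sCoord p) : ∀ᶠ q in 𝓝 p, 0 < sCoord q :=
  (contDiffAt_sCoord hs).continuousAt.eventually (lt_mem_nhds hs)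

theorem HasSmoothExt.comp_yCoord_eventuallyEq (φ : S2 → ℝ) {p : R4} (hs : 0 < sCoord p) :
    (fun p => φ (yCoord p)) =ᶠ[𝓝 p] homExt φ ∘ sphereVec := by
  filter_upwards [eventually_sCoord_pos hs] with q hq using (homExt_sphereVec φ hq).symm

theorem HasSmoothExt.contDiffAt_comp_yCoord {φ : S2 → ℝ} (hφ : HasSmoothExt φ) {p : R4}
    (hs : 0 < sCoord p) : ContDiffAt ℝ ∞ (fun p => φ (yCoord p)) p :=
  ((hφ _ (sphereVec_ne_zero hs)).comp p (contDiffAt_sphereVec hs)).congr_of_eventuallyEq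
    (comp_yCoord_eventuallyEq φ hs)

theorem HasSmoothExt.fderiv_comp_yCoord {φ : S2 → ℝ} (hφ : HasSmoothExt φ) {p : R4}
    (hs : 0 < sCoord p) (u : R4) : fderiv ℝ (fun p => φ (yCoord p)) p u =
      fderiv ℝ (homExt φ) (sphereVec p) (fderiv ℝ sphereVec p u) := by
  rw [(comp_yCoord_eventuallyEq φ hs).fderiv_eq, fderiv_comp p
    ((hφ _ (sphereVec_ne_zero hs)).differentiableAt (by simp))
    ((contDiffAt_sphereVec hs).differentiableAt (by simp))]
  rfl

theorem HasSmoothExt.hasFDerivAt_comp_yCoord {φ : S2 → ℝ} (hφ : HasSmoothExt φ) {p : R4}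
    (hs : 0 < sCoord p) : HasFDerivAt (fun p => φ (yCoord p))
      (fderiv ℝ (fun p => φ (yCoord p)) p) p :=
  ((hφ.contDiffAt_comp_yCoord hs).differentiableAt (by simp)).hasFDerivAt

theorem two_m_lt_norm {m : ℝ} {p : R4} (hp : p ∈ exterior m) : 2 * m < ‖spatial p‖ := by
  obtain ⟨hs, hh⟩ := hp
  have h0 := norm_pos_iff.2 (spatial_ne_zero hs)
  rw [lapseFactor, sCoord, ← div_eq_mul_inv, sub_pos, div_lt_one h0] at hh
  exact hh

theorem contDiffAt_vCoord {m : ℝ} (hm : 0 < m) {p : R4} (hp : p ∈ exterior m) :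
    ContDiffAt ℝ ∞ (vCoord m) p := by
  have h1 := two_m_lt_norm hp
  have h2 := contDiffAt_norm_spatial hp.1
  refine (contDiff_apply ℝ ℝ (0 : Fin 4)).contDiffAt.sub (h2.add (contDiffAt_const.mul
    (ContDiffAt.log ((h2.div_const _).sub contDiffAt_const) ?_)))
  have : 1 < ‖spatial p‖ / (2 * m) := (one_lt_div (by positivity)).2 h1
  linarith

theorem fderiv_vCoord {m : ℝ} (hm : 0 < m) {p : R4} (hp : p ∈ exterior m) (u : R4) :
    fderiv ℝ (vCoord m) p u = u 0 - (lapseFactor m p)⁻¹ * radialForm p u := by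
  have h1 := two_m_lt_norm hp
  have h2 : HasFDerivAt (fun q => ‖spatial q‖) (fderiv ℝ (fun q => ‖spatial q‖) p) p :=
    ((contDiffAt_norm_spatial hp.1).differentiableAt (by simp)).hasFDerivAt
  have h3 : ‖spatial p‖ / (2 * m) - 1 ≠ 0 := by
    have : 1 < ‖spatial p‖ / (2 * m) := (one_lt_div (by positivity)).2 h1
    linarith
  have h4 : HasDerivAt (rStar m) (lapseFactor m p)⁻¹ ‖spatial p‖ := by
    have h5 := (hasDerivAt_id ‖spatial p‖).add
      (((((hasDerivAt_id ‖spatial p‖).div_const (2 * m)).sub_const 1).log h3).const_mul (2 * m))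
    have h6 : ‖spatial p‖ - 2 * m ≠ 0 := by linarith
    have h7 := norm_ne_zero_iff.2 (spatial_ne_zero hp.1)
    have h8 : lapseFactor m p = (‖spatial p‖ - 2 * m) / ‖spatial p‖ := by
      rw [lapseFactor, sCoord]
      field_simp
    have h9 : ‖spatial p‖ / (2 * m) - 1 = (‖spatial p‖ - 2 * m) / (2 * m) := by field_simp
    refine h5.congr_deriv ?_
    simp only [id]
    rw [h8, h9]
    field_simp
    ring
  have h6 : HasFDerivAt (rStar m ∘ fun p => ‖spatial p‖) _ p := h4.comp_hasFDerivAt p h2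
  have h5 : HasFDerivAt (vCoord m) _ p :=
    (hasFDerivAt_apply (𝕜 := ℝ) (0 : Fin 4) p).fun_sub h6
  rw [h5.fderiv]
  simp [fderiv_norm_spatial hp.1]

section timeFun

variable {m : ℝ} (hm : 0 < m) {f : S2 → ℝ} (hf : HasSmoothExt f) {p : R4} (hp : p ∈ exterior m)
  (hD : 0 < slopeFactor f (yCoord p) (sCoord p))
include hf

theorem hasSmoothExt_gradSqDeriv : HasSmoothExt (gradSqDeriv f) :=
  hf.sphereGradSq.inner_sphereGrad hf

include hp

theorem contDiffAt_slopeFactor :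
    ContDiffAt ℝ ∞ (fun p => slopeFactor f (yCoord p) (sCoord p)) p :=
  contDiffAt_const.sub ((contDiffAt_const.mul (contDiffAt_sCoord hp.1)).mul
    (hf.sphereLaplacian.contDiffAt_comp_yCoord hp.1))

include hm hD

theorem contDiffAt_timeSq : ContDiffAt ℝ ∞ (timeSq m f) p := by
  have hs := contDiffAt_sCoord hp.1
  refine (contDiffAt_const.mul ((contDiffAt_vCoord hm hp).add (((hf.contDiffAt_comp_yCoord hp.1).sub
    ((contDiffAt_const.mul hs).mul (hf.sphereGradSq.contDiffAt_comp_yCoord hp.1))).add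
    ((contDiffAt_const.mul (hs.pow 2)).mul
      ((hasSmoothExt_gradSqDeriv hf).contDiffAt_comp_yCoord hp.1))))).div
    (hs.mul (contDiffAt_slopeFactor hf hp)) (mul_pos hp.1 hD).ne'

variable (hτ : 0 < timeFun m f p)
include hτ

theorem contDiffAt_timeFun : ContDiffAt ℝ ∞ (timeFun m f) p :=
  (contDiffAt_timeSq hm hf hp hD).sqrt (Real.sqrt_pos.1 hτ).ne'

/-- Implicit differentiation of `v + P(y, s, τ) = 0`. -/
theorem fderiv_timeFun (u : R4) :
    timeFun m f p * slopeFactor f (yCoord p) (sCoord p) * (sCoord p * fderiv ℝ (timeFun m f) p u) =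
      fderiv ℝ (vCoord m) p u + fderiv ℝ (fun p => f (yCoord p)) p u
      - 1 / 2 * sCoord p * fderiv ℝ (fun p => sphereGradSq f (yCoord p)) p u
      + 1 / 4 * sCoord p ^ 2 * fderiv ℝ (fun p => gradSqDeriv f (yCoord p)) p u
      + 1 / 4 * sCoord p ^ 2 * timeFun m f p ^ 2
        * fderiv ℝ (fun p => sphereLaplacian f (yCoord p)) p u
      + fderiv ℝ sCoord p u * (-(1 / 2) * sphereGradSq f (yCoord p)
        + 1 / 2 * sCoord p * gradSqDeriv f (yCoord p)
        - 1 / 2 * timeFun m f p ^ 2 * (1 - sCoord p * sphereLaplacian f (yCoord p))) := by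
  have hs := hasFDerivAt_sCoord hp.1
  have hv := ((contDiffAt_vCoord hm hp).differentiableAt (by simp)).hasFDerivAt
  have ht := ((contDiffAt_timeFun hm hf hp hD hτ).differentiableAt (by simp)).hasFDerivAt
  have h1 := hf.hasFDerivAt_comp_yCoord hp.1
  have h2 := hf.sphereGradSq.hasFDerivAt_comp_yCoord hp.1
  have h3 := (hasSmoothExt_gradSqDeriv hf).hasFDerivAt_comp_yCoord hp.1
  have h4 := hf.sphereLaplacian.hasFDerivAt_comp_yCoord hp.1
  have key := (hv.fun_add ((h1.fun_sub ((hs.const_mul (1 / 2)).fun_mul h2)).fun_add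
    (((hs.fun_mul hs).const_mul (1 / 4)).fun_mul h3))).fun_sub
    (((hs.const_mul (1 / 2)).fun_mul (((hs.const_mul (1 / 2)).fun_mul h4).const_sub 1)).fun_mul
      (ht.fun_mul ht))
  -- The relation `v + P = 0` is multiplied out before it is differentiated, so that neither the
  -- square root nor a division by `s` appears.
  have hzero : (fun q => vCoord m q + (f (yCoord q) - 1 / 2 * sCoord q * sphereGradSq f (yCoord q)
      + 1 / 4 * (sCoord q * sCoord q) * gradSqDeriv f (yCoord q)) - 1 / 2 * sCoord q *
        (1 - 1 / 2 * sCoord q * sphereLaplacian f (yCoord q)) * (timeFun m f q * timeFun m f q))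
      =ᶠ[𝓝 p] fun _ => 0 := by
    filter_upwards [eventually_sCoord_pos hp.1,
      (contDiffAt_slopeFactor hf hp).continuousAt.eventually (lt_mem_nhds hD),
      (contDiffAt_timeFun hm hf hp hD hτ).continuousAt.eventually (lt_mem_nhds hτ)]
      with q hsq hDq hτq
    have h5 : timeFun m f q ^ 2 = timeSq m f q := Real.sq_sqrt (Real.sqrt_pos.1 hτq).le
    rw [timeSq, eq_div_iff (mul_pos hsq hDq).ne', slopeFactor, heightBase] at h5
    linarith
  have h6 := congrArg (fun L => L u) (key.unique
    ((hasFDerivAt_const (0 : ℝ) p).congr_of_eventuallyEq hzero))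
  simp at h6
  rw [slopeFactor]
  linear_combination -h6

end timeFun

/-! ### The derivatives of the time function as functions of `(y, s, τ)` -/

/-- The derivative of the extension of `φ` along the projected coordinate vector `e_i`. -/
noncomputable def tangDeriv (φ : S2 → ℝ) (i : Fin 3) (x : E3) : ℝ :=
  fderiv ℝ (homExt φ) x (EuclideanSpace.single i 1 - x i • x)

/-- The reciprocal of `τ (1 - s Δf / 2)`. -/
noncomputable def slopeInv (f : S2 → ℝ) (z : E3 × ℝ × ℝ) : ℝ :=
  (z.2.2 * (1 - 1 / 2 * z.2.1 * homExt (sphereLaplacian f) z.1))⁻¹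

/-- The derivatives of `τ` along `nullFrame`. -/
noncomputable def timeDeriv (f : S2 → ℝ) : Fin 2 ⊕ Fin 3 → E3 × ℝ × ℝ → ℝ
  | .inl 0 => slopeInv f
  | .inl 1 => fun z => slopeInv f z * (-(1 / 2) * homExt (sphereGradSq f) z.1
      + 1 / 2 * z.2.1 * homExt (gradSqDeriv f) z.1
      - 1 / 2 * z.2.2 ^ 2 * (1 - z.2.1 * homExt (sphereLaplacian f) z.1))
  | .inr i => fun z => slopeInv f z * (tangDeriv f i z.1
      - 1 / 2 * z.2.1 * tangDeriv (sphereGradSq f) i z.1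
      + 1 / 4 * z.2.1 ^ 2 * tangDeriv (gradSqDeriv f) i z.1
      + 1 / 4 * z.2.1 ^ 2 * z.2.2 ^ 2 * tangDeriv (sphereLaplacian f) i z.1)

/-- The quantity `-g(∇τ, ∇τ)` as a function of `(y, s, τ)`. -/
noncomputable def lapseInvSq (m : ℝ) (f : S2 → ℝ) (z : E3 × ℝ × ℝ) : ℝ :=
  -(2 * timeDeriv f (.inl 0) z * timeDeriv f (.inl 1) z
    + (1 - 2 * m * z.2.1) * z.2.1 ^ 2 * timeDeriv f (.inl 1) z ^ 2
    + ∑ i, timeDeriv f (.inr i) z ^ 2)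

theorem HasSmoothExt.contDiffAt_fst {φ : S2 → ℝ} (hφ : HasSmoothExt φ) {z : E3 × ℝ × ℝ}
    (hz : z.1 ≠ 0) : ContDiffAt ℝ ∞ (fun z : E3 × ℝ × ℝ => homExt φ z.1) z :=
  (hφ _ hz).comp z _root_.contDiffAt_fst

theorem HasSmoothExt.contDiffAt_tangDeriv {φ : S2 → ℝ} (hφ : HasSmoothExt φ) (i : Fin 3)
    {z : E3 × ℝ × ℝ} (hz : z.1 ≠ 0) :
    ContDiffAt ℝ ∞ (fun z : E3 × ℝ × ℝ => tangDeriv φ i z.1) z :=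
  (((hφ _ hz).fderiv_right (m := ∞) (by simp)).comp z _root_.contDiffAt_fst).clm_apply
    (contDiffAt_const.sub ((contDiffAt_coord z i).smul _root_.contDiffAt_fst))

theorem contDiffAt_timeDeriv {f : S2 → ℝ} (hf : HasSmoothExt f) {z : E3 × ℝ × ℝ} (hz : z.1 ≠ 0)
    (hτ : z.2.2 ≠ 0) (hD : 1 - 1 / 2 * z.2.1 * homExt (sphereLaplacian f) z.1 ≠ 0)
    (k : Fin 2 ⊕ Fin 3) : ContDiffAt ℝ ∞ (timeDeriv f k) z := by
  have hs : ContDiffAt ℝ ∞ (fun z : E3 × ℝ × ℝ => z.2.1) z := contDiffAt_snd.fst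
  have ht : ContDiffAt ℝ ∞ (fun z : E3 × ℝ × ℝ => z.2.2) z := contDiffAt_snd.snd
  have hl := hf.sphereLaplacian.contDiffAt_fst hz
  have hq := hf.sphereGradSq.contDiffAt_fst hz
  have hw := (hasSmoothExt_gradSqDeriv hf).contDiffAt_fst hz
  have h0 : ContDiffAt ℝ ∞ (slopeInv f) z :=
    (ht.mul (contDiffAt_const.sub ((contDiffAt_const.mul hs).mul hl))).inv (mul_ne_zero hτ hD)
  rcases k with k | i
  · fin_cases k
    · exact h0
    · exact h0.mul (((contDiffAt_const.mul hq).add ((contDiffAt_const.mul hs).mul hw)).sub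
        ((contDiffAt_const.mul (ht.pow 2)).mul (contDiffAt_const.sub (hs.mul hl))))
  · exact h0.mul ((((hf.contDiffAt_tangDeriv i hz).sub ((contDiffAt_const.mul hs).mul
      (hf.sphereGradSq.contDiffAt_tangDeriv i hz))).add ((contDiffAt_const.mul (hs.pow 2)).mul
      ((hasSmoothExt_gradSqDeriv hf).contDiffAt_tangDeriv i hz))).add
      (((contDiffAt_const.mul (hs.pow 2)).mul (ht.pow 2)).mul
        (hf.sphereLaplacian.contDiffAt_tangDeriv i hz)))

theorem contDiffAt_lapseInvSq (m : ℝ) {f : S2 → ℝ} (hf : HasSmoothExt f) {z : E3 × ℝ × ℝ}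
    (hz : z.1 ≠ 0) (hτ : z.2.2 ≠ 0)
    (hD : 1 - 1 / 2 * z.2.1 * homExt (sphereLaplacian f) z.1 ≠ 0) :
    ContDiffAt ℝ ∞ (lapseInvSq m f) z := by
  have hs : ContDiffAt ℝ ∞ (fun z : E3 × ℝ × ℝ => z.2.1) z := contDiffAt_snd.fst
  have ha := contDiffAt_timeDeriv hf hz hτ hD
  exact (((((contDiffAt_const.mul (ha _)).mul (ha _)).add
    (((contDiffAt_const.sub (contDiffAt_const.mul hs)).mul (hs.pow 2)).mul ((ha _).pow 2))).add
    (ContDiffAt.sum fun i _ => (ha _).pow 2))).neg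

/-- The three projected coordinate vectors resolve the inverse metric of the round sphere, so they
compute `|∇f|²` despite being dependent. -/
theorem HasSmoothExt.sum_tangDeriv_sq {f : S2 → ℝ} (hf : HasSmoothExt f) {x : E3} (hx : ‖x‖ = 1) :
    ∑ i, tangDeriv f i x ^ 2 = homExt (_root_.sphereGradSq f) x := by
  obtain ⟨y, rfl⟩ : ∃ y : S2, (y : E3) = x := ⟨⟨x, mem_sphere_zero_iff_norm.2 hx⟩, rfl⟩
  have h0 : (y : E3) ≠ 0 := norm_ne_zero_iff.1 (by rw [hx]; exact one_ne_zero)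
  rw [homExt_coe, sphereGradSq_eq_sum]
  refine Finset.sum_congr rfl fun i _ => ?_
  rw [tangDeriv, map_sub, map_smul, hf.fderiv_self h0, smul_zero, sub_zero]

/-- Along the frame every term of the implicit derivative contains a factor `s`: the first field
maps `v` to `s`, the second annihilates `v` and maps `s` to itself, and the others differentiate
only functions of `y`, with a factor `s`. Cancelling it against the factor of `dτ` gives expressions
regular at `s = 0`. -/
theorem fderiv_timeFun_nullFrame {m : ℝ} (hm : 0 < m) {f : S2 → ℝ} (hf : HasSmoothExt f) {p : R4}
    (hp : p ∈ exterior m) (hD : 0 < slopeFactor f (yCoord p) (sCoord p))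
    (hτ : 0 < timeFun m f p) (k : Fin 2 ⊕ Fin 3) :
    fderiv ℝ (timeFun m f) p (nullFrame m k p) = timeDeriv f k (leafCoord (timeFun m f) p) := by
  have hs := hp.1
  have hh := hp.2.ne'
  have h := fderiv_timeFun hm hf hp hD hτ (nullFrame m k p)
  have hq := hf.sphereGradSq
  have hw := hasSmoothExt_gradSqDeriv hf
  have hl := hf.sphereLaplacian
  have hτD : timeFun m f p * slopeFactor f (yCoord p) (sCoord p) ≠ 0 := (mul_pos hτ hD).ne'
  have hinv : slopeInv f (leafCoord (timeFun m f) p) =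
      (timeFun m f p * slopeFactor f (yCoord p) (sCoord p))⁻¹ := by
    simp [slopeInv, leafCoord, homExt_sphereVec _ hs, slopeFactor]
  have hc : ∀ X, timeFun m f p * slopeFactor f (yCoord p) (sCoord p) * sCoord p *
      ((timeFun m f p * slopeFactor f (yCoord p) (sCoord p))⁻¹ * X) = sCoord p * X := by
    intro X
    field_simp
  refine mul_left_cancel₀ (mul_ne_zero hτD hs.ne') ?_
  rw [mul_assoc _ (sCoord p), h, fderiv_vCoord hm hp, fderiv_sCoord hs,
    hf.fderiv_comp_yCoord hs, hq.fderiv_comp_yCoord hs, hw.fderiv_comp_yCoord hs,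
    hl.fderiv_comp_yCoord hs]
  rcases k with k | i
  · fin_cases k
    · simp only [Fin.zero_eta, radialForm_nullFrame_zero, fderiv_sphereVec_nullFrame_zero hp,
        timeDeriv, hinv, map_zero]
      have h1 := hc 1
      rw [mul_one, mul_one] at h1
      rw [h1]
      simp [nullFrame]
    · simp only [Fin.mk_one, radialForm_nullFrame_one hp, fderiv_sphereVec_nullFrame_one hp,
        timeDeriv, hinv, map_zero]
      rw [hc]
      simp [nullFrame, leafCoord, homExt_sphereVec _ hs]
      field_simp
      exact .inl trivial
  · simp only [radialForm_nullFrame_inr hp, fderiv_sphereVec_nullFrame_inr hp, timeDeriv, hinv,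
      map_smul]
    rw [hc]
    simp [nullFrame, leafCoord, tangDeriv, sphereVec_apply]
    ring

/-! ### The choice of `s₀` and the foliated region. -/

/-- The coordinate domain `𝕊² × [0, s₀] × [τ₁, τ₂]`. -/
def leafBox (s₀ τ₁ τ₂ : ℝ) : Set (E3 × ℝ × ℝ) :=
  Metric.sphere 0 1 ×ˢ Set.Icc 0 s₀ ×ˢ Set.Icc τ₁ τ₂

theorem isCompact_leafBox (s₀ τ₁ τ₂ : ℝ) : IsCompact (leafBox s₀ τ₁ τ₂) :=
  (isCompact_sphere _ _).prod (isCompact_Icc.prod isCompact_Icc)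

/-- The choice of `φ` makes the first product contribute `τ⁻² (|∇f|² + τ²)`, from which the angular
derivatives subtract `τ⁻² |∇f|²`. -/
theorem lapseInvSq_zero (m : ℝ) {f : S2 → ℝ} (hf : HasSmoothExt f) {x : E3} (hx : ‖x‖ = 1) {τ : ℝ}
    (hτ : 0 < τ) : lapseInvSq m f (x, 0, τ) = 1 := by
  have h := hf.sum_tangDeriv_sq hx
  simp only [lapseInvSq, timeDeriv, slopeInv, mul_zero, zero_mul, sub_zero, mul_one, add_zero,
    mul_pow, ne_eq, OfNat.ofNat_ne_zero, not_false_eq_true, zero_pow, ← Finset.mul_sum, h]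
  field_simp
  ring

/-- For small `s₀` the leaves are spacelike up to `s = 0`. -/
theorem exists_leafBox (m : ℝ) (hm : 0 < m) {f : S2 → ℝ} (hf : HasSmoothExt f) {τ₁ : ℝ} (τ₂ : ℝ)
    (hτ₁ : 0 < τ₁) : ∃ s₀ : ℝ, 0 < s₀ ∧ s₀ < 1 / (2 * m) ∧ ∀ z ∈ leafBox s₀ τ₁ τ₂,
      0 < 1 - 1 / 2 * z.2.1 * homExt (sphereLaplacian f) z.1 ∧ 0 < lapseInvSq m f z := by
  have hK : IsCompact (Metric.sphere (0 : E3) 1 ×ˢ Set.Icc τ₁ τ₂) :=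
    (isCompact_sphere _ _).prod isCompact_Icc
  have h1 : ∀ᶠ s in 𝓝 (0 : ℝ), ∀ w ∈ Metric.sphere (0 : E3) 1 ×ˢ Set.Icc τ₁ τ₂,
      0 < 1 - 1 / 2 * s * homExt (sphereLaplacian f) w.1 ∧ 0 < lapseInvSq m f (w.1, s, w.2) := by
    -- Tube lemma: both conditions hold at `s = 0` and are open, so compactness of the remaining
    -- factors gives one interval of `s` for all `(y, τ)`.
    refine hK.eventually_forall_of_forall_eventually fun w hw => ?_
    have hx : ‖w.1‖ = 1 := mem_sphere_zero_iff_norm.1 hw.1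
    have hx0 : w.1 ≠ 0 := norm_ne_zero_iff.1 (by rw [hx]; exact one_ne_zero)
    have hτ : 0 < w.2 := hτ₁.trans_le hw.2.1
    have hc : Continuous fun q : ℝ × (E3 × ℝ) => (q.2.1, q.1, q.2.2) := by fun_prop
    have hD : ContinuousAt (fun z : E3 × ℝ × ℝ =>
        1 - 1 / 2 * z.2.1 * homExt (sphereLaplacian f) z.1) (w.1, 0, w.2) :=
      (contDiffAt_const.sub ((contDiffAt_const.mul contDiffAt_snd.fst).mul
        (hf.sphereLaplacian.contDiffAt_fst (z := (w.1, 0, w.2)) hx0))).continuousAt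
    have hN : ContinuousAt (lapseInvSq m f) (w.1, 0, w.2) :=
      (contDiffAt_lapseInvSq m hf (z := (w.1, 0, w.2)) hx0 hτ.ne' (by simp)).continuousAt
    have hD' := (hD.comp_of_eq (x := ((0 : ℝ), w)) hc.continuousAt rfl).eventually
      (lt_mem_nhds (a := 0) (by simp))
    have hN' := (hN.comp_of_eq (x := ((0 : ℝ), w)) hc.continuousAt rfl).eventually
      (lt_mem_nhds (a := 0) (by simp [lapseInvSq_zero m hf hx hτ]))
    filter_upwards [hD', hN'] with q h1 h2 using ⟨h1, h2⟩
  obtain ⟨ε, hε, h2⟩ := Metric.eventually_nhds_iff.1 h1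
  have hm' : 0 < 1 / (2 * m) := by positivity
  -- Halving keeps the closed interval `[0, s₀]` inside the open ball of radius `ε` and makes `s₀ <
  -- 1 / (2m)` strict.
  refine ⟨min (ε / 2) (1 / (2 * m) / 2), by positivity, ?_, ?_⟩
  · exact (min_le_right _ _).trans_lt (half_lt_self hm')
  · rintro ⟨x, s, τ⟩ ⟨hx, hs, hτ⟩
    refine h2 (y := s) ?_ (x, τ) ⟨hx, hτ⟩
    rw [Real.dist_eq, sub_zero, abs_of_nonneg hs.1]
    exact (hs.2.trans (min_le_left _ _)).trans_lt (half_lt_self hε)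

/-- The conditions on `s₀` under which the leaves are well behaved. -/
structure IsGoodRange (m : ℝ) (f : S2 → ℝ) (s₀ τ₁ τ₂ : ℝ) : Prop where
  m_pos : 0 < m
  smooth : HasSmoothExt f
  s₀_pos : 0 < s₀
  s₀_lt : s₀ < 1 / (2 * m)
  τ₁_pos : 0 < τ₁
  slope_pos : ∀ z ∈ leafBox s₀ τ₁ τ₂, 0 < 1 - 1 / 2 * z.2.1 * homExt (sphereLaplacian f) z.1
  lapseInvSq_pos : ∀ z ∈ leafBox s₀ τ₁ τ₂, 0 < lapseInvSq m f z

namespace IsGoodRange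

variable {m : ℝ} {f : S2 → ℝ} {s₀ τ₁ τ₂ : ℝ} (R : IsGoodRange m f s₀ τ₁ τ₂)
include R

theorem one_sub_pos {s : ℝ} (hs : s ≤ s₀) : 0 < 1 - 2 * m * s := by
  have hm := R.m_pos
  have h := hs.trans_lt R.s₀_lt
  rw [lt_div_iff₀ (by positivity)] at h
  linarith

theorem mem_exterior {p : R4} (hs : 0 < sCoord p) (hs₀ : sCoord p < s₀) : p ∈ exterior m :=
  ⟨hs, R.one_sub_pos hs₀.le⟩

theorem slopeFactor_pos (hτ : τ₁ < τ₂) {p : R4} (hs : 0 < sCoord p) (hs₀ : sCoord p < s₀) :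
    0 < slopeFactor f (yCoord p) (sCoord p) := by
  have h := R.slope_pos (sphereVec p, sCoord p, τ₁)
    ⟨mem_sphere_zero_iff_norm.2 (sum_sphereVec hs), ⟨hs.le, hs₀.le⟩, le_rfl, hτ.le⟩
  simpa only [homExt_sphereVec _ hs, slopeFactor] using h

theorem mem_foliatedRegion_iff (hτ : τ₁ < τ₂) {p : R4} : p ∈ foliatedRegion m f τ₁ τ₂ s₀ ↔
    (0 < sCoord p ∧ sCoord p < s₀) ∧ τ₁ < timeFun m f p ∧ timeFun m f p < τ₂ := by
  simp only [foliatedRegion, Set.mem_iUnion, exists_prop]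
  constructor
  · rintro ⟨τ, hτm, hp⟩
    obtain ⟨hs, hs₀, -⟩ := id hp
    rw [mem_leaf_iff (R.τ₁_pos.trans hτm.1) hs hs₀ (R.slopeFactor_pos hτ hs hs₀)] at hp
    rw [hp]
    exact ⟨⟨hs, hs₀⟩, hτm⟩
  · rintro ⟨⟨hs, hs₀⟩, hτm⟩
    exact ⟨_, hτm, (mem_leaf_iff (R.τ₁_pos.trans hτm.1) hs hs₀
      (R.slopeFactor_pos hτ hs hs₀)).2 rfl⟩

theorem timeFun_eq (hτ : τ₁ < τ₂) {τ : ℝ} (hτm : τ ∈ Set.Ioo τ₁ τ₂) {p : R4}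
    (hp : p ∈ leaf m f s₀ τ) : timeFun m f p = τ := by
  obtain ⟨hs, hs₀, -⟩ := id hp
  exact (mem_leaf_iff (R.τ₁_pos.trans hτm.1) hs hs₀ (R.slopeFactor_pos hτ hs hs₀)).1 hp

theorem isLeafCoord (hτ : τ₁ < τ₂) : IsLeafCoord m (timeFun m f) (foliatedRegion m f τ₁ τ₂ s₀)
    (leafBox s₀ τ₁ τ₂) (timeDeriv f) where
  isOpen := by
    rw [isOpen_iff_mem_nhds]
    intro p hp
    obtain ⟨⟨hs, hs₀⟩, h1, h2⟩ := (R.mem_foliatedRegion_iff hτ).1 hp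
    have hc := (contDiffAt_timeFun R.m_pos R.smooth (R.mem_exterior hs hs₀)
      (R.slopeFactor_pos hτ hs hs₀) (R.τ₁_pos.trans h1)).continuousAt
    have hsc := (contDiffAt_sCoord hs).continuousAt
    filter_upwards [hc.eventually (lt_mem_nhds h1), hc.eventually (gt_mem_nhds h2),
      hsc.eventually (lt_mem_nhds hs), hsc.eventually (gt_mem_nhds hs₀)] with q h1 h2 h3 h4
    exact (R.mem_foliatedRegion_iff hτ).2 ⟨⟨h3, h4⟩, h1, h2⟩
  isCompact := isCompact_leafBox _ _ _
  subset p hp := by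
    obtain ⟨⟨hs, hs₀⟩, -⟩ := (R.mem_foliatedRegion_iff hτ).1 hp
    exact R.mem_exterior hs hs₀
  mapsTo p hp := by
    obtain ⟨⟨hs, hs₀⟩, h1, h2⟩ := (R.mem_foliatedRegion_iff hτ).1 hp
    exact ⟨mem_sphere_zero_iff_norm.2 (sum_sphereVec hs), ⟨hs.le, hs₀.le⟩, h1.le, h2.le⟩
  smooth_tau p hp := by
    obtain ⟨⟨hs, hs₀⟩, h1, h2⟩ := (R.mem_foliatedRegion_iff hτ).1 hp
    exact contDiffAt_timeFun R.m_pos R.smooth (R.mem_exterior hs hs₀)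
      (R.slopeFactor_pos hτ hs hs₀) (R.τ₁_pos.trans h1)
  smooth_deriv k z hz := contDiffAt_timeDeriv R.smooth
    (norm_ne_zero_iff.1 (by rw [mem_sphere_zero_iff_norm.1 hz.1]; exact one_ne_zero))
    (R.τ₁_pos.trans_le hz.2.2.1).ne' (R.slope_pos z hz).ne' k
  deriv_tau p hp k := by
    obtain ⟨⟨hs, hs₀⟩, h1, h2⟩ := (R.mem_foliatedRegion_iff hτ).1 hp
    exact fderiv_timeFun_nullFrame R.m_pos R.smooth (R.mem_exterior hs hs₀)
      (R.slopeFactor_pos hτ hs hs₀) (R.τ₁_pos.trans h1) k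

theorem contDiffAt_lapseInvSq {z : E3 × ℝ × ℝ} (hz : z ∈ leafBox s₀ τ₁ τ₂) :
    ContDiffAt ℝ ∞ (lapseInvSq m f) z :=
  _root_.contDiffAt_lapseInvSq m R.smooth
    (norm_ne_zero_iff.1 (by rw [mem_sphere_zero_iff_norm.1 hz.1]; exact one_ne_zero))
    (R.τ₁_pos.trans_le hz.2.2.1).ne' (R.slope_pos z hz).ne'

/-- The gradient is expanded in the frame; pairing it with the frame again gives the quadratic form
of `nullCoeff` in the derivatives of `τ`. -/
theorem apply_metricGrad_timeFun (hτ : τ₁ < τ₂) {p : R4} (hp : p ∈ foliatedRegion m f τ₁ τ₂ s₀) :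
    gSch m p (metricGrad (gSch m) (timeFun m f) p) (metricGrad (gSch m) (timeFun m f) p) =
      -lapseInvSq m f (leafCoord (timeFun m f) p) := by
  have L := R.isLeafCoord hτ
  have F := L.admissibleFrame
  have h := F.eq_sum_frame hp (metricGrad (gSch m) (timeFun m f) p)
  have h2 : ∀ k, gSch m p (metricGrad (gSch m) (timeFun m f) p) (nullFrame m k p) =
      timeDeriv f k (leafCoord (timeFun m f) p) := fun k => by
    rw [F.metric.apply_metricGrad hp, L.deriv_tau p hp]
  conv_lhs =>
    arg 4
    rw [h]
  simp only [F.metric.sum_right, F.metric.smul_right, h2]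
  simp [nullCoeff, Fintype.sum_sum_type, lapseInvSq, lapseFactor, leafCoord, pow_two]
  ring

end IsGoodRange

/-! ### Spacelike leaves, the unit normal and the mean curvature vector. -/

/-- Reversed Cauchy-Schwarz: vectors orthogonal to a timelike vector are spacelike. -/
theorem gSch_pos_of_orthogonal {m : ℝ} {p : R4} (hp : p ∈ exterior m) {n u : R4}
    (hn : gSch m p n n < 0) (hnu : gSch m p n u = 0) (hu : u ≠ 0) : 0 < gSch m p u u := by
  obtain ⟨hs, hh⟩ := hp
  have hY := sum_unitComp_sq hs
  set h := lapseFactor m p with hdef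
  -- Stretching the radial direction by `1 + c = h^(-1/2)` turns the spatial part of the metric into
  -- the Euclidean inner product of the images under `B`, to which the ordinary Cauchy-Schwarz
  -- inequality applies.
  set c := Real.sqrt h⁻¹ - 1
  have hc : (c + 1) ^ 2 = h⁻¹ := by
    simp only [c, sub_add_cancel]
    exact Real.sq_sqrt (inv_pos.2 hh).le
  let B : R4 → E3 := fun v => WithLp.toLp 2 fun i => v i.succ + c * radialForm p v * unitComp i p
  have hB : ∀ v w, gSch m p v w = -h * (v 0 * w 0) + inner ℝ (B v) (B w) := by
    intro v w
    have h1 : inner ℝ (B v) (B w) = ∑ i : Fin 3, v i.succ * w i.succ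
        + c * radialForm p v * ∑ i : Fin 3, unitComp i p * w i.succ
        + c * radialForm p w * ∑ i : Fin 3, unitComp i p * v i.succ
        + c ^ 2 * radialForm p v * radialForm p w * ∑ i, unitComp i p ^ 2 := by
      simp only [PiLp.inner_apply, RCLike.inner_apply, conj_trivial, B, Finset.mul_sum,
        ← Finset.sum_add_distrib]
      refine Finset.sum_congr rfl fun i _ => by ring
    rw [h1, hY, gSch_eq, ← hdef, ← hc]
    simp only [← radialForm.eq_1]
    ring
  rw [hB] at hn hnu ⊢
  have hn0 : 0 < h * n 0 ^ 2 := by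
    have := real_inner_self_nonneg (x := B n)
    nlinarith
  have hn0' : 0 < n 0 ^ 2 := pos_of_mul_pos_right hn0 hh.le
  by_cases hBu : B u = 0
  · exfalso
    rw [hBu, inner_zero_right] at hnu
    have hu0 : u 0 = 0 := by
      have h1 : h * n 0 ≠ 0 := mul_ne_zero hh.ne' (by rintro h0; simp [h0] at hn0')
      have h2 : h * n 0 * u 0 = 0 := by linarith
      exact (mul_eq_zero.1 h2).resolve_left h1
    have h3 : ∀ i : Fin 3, u i.succ + c * radialForm p u * unitComp i p = 0 := fun i =>
      congrArg (fun x : E3 => x i) hBu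
    have h4 : (1 + c) * radialForm p u = 0 := by
      have h5 : ∑ i : Fin 3, unitComp i p * (u i.succ + c * radialForm p u * unitComp i p) = 0 :=
        Finset.sum_eq_zero fun i _ => by rw [h3, mul_zero]
      have h6 : ∑ i : Fin 3, unitComp i p * (u i.succ + c * radialForm p u * unitComp i p) =
          ∑ i : Fin 3, unitComp i p * u i.succ + c * radialForm p u * ∑ i, unitComp i p ^ 2 := by
        rw [Finset.mul_sum, ← Finset.sum_add_distrib]
        refine Finset.sum_congr rfl fun i _ => by ring
      rw [h6, hY, ← radialForm.eq_1] at h5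
      linarith
    have h7 : radialForm p u = 0 := by
      refine (mul_eq_zero.1 h4).resolve_left fun h0 => ?_
      have : h⁻¹ = 0 := by rw [← hc, add_comm, h0]; ring
      exact (inv_pos.2 hh).ne' this
    refine hu (funext fun a => Fin.cases hu0 (fun i => ?_) a)
    have := h3 i
    rw [h7] at this
    simpa using this
  · have hQ : 0 < inner ℝ (B u) (B u) := real_inner_self_pos.2 hBu
    have hcs := real_inner_mul_inner_self_le (B n) (B u)
    have h1 : inner ℝ (B n) (B u) = h * (n 0 * u 0) := by linarith
    rw [h1] at hcs
    have h2 : h * n 0 ^ 2 * (h * u 0 ^ 2) < h * n 0 ^ 2 * inner ℝ (B u) (B u) := by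
      nlinarith
    have h3 := lt_of_mul_lt_mul_left h2 hn0.le
    nlinarith

/-- The vector field `s ∂_v + (1 - 2ms) s² · s ∂_s`, which is `g`-dual to `ds / s`. -/
noncomputable def radialNormal (m : ℝ) (p : R4) : R4 :=
  nullFrame m (.inl 0) p + (lapseFactor m p * sCoord p ^ 2) • nullFrame m (.inl 1) p

theorem gSch_radialNormal {m : ℝ} {Ω : Set R4} (hg : IsMetricOn (gSch m) Ω) {p : R4}
    (hp : p ∈ exterior m) (u : R4) :
    gSch m p (radialNormal m p) u = -(sCoord p * radialForm p u) := by
  have hs := hp.1.ne'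
  have hh := hp.2.ne'
  rw [radialNormal, hg.add_left, hg.smul_left, gSch_nullFrame_zero, gSch_nullFrame_one hp]
  field_simp
  ring

namespace IsGoodRange

variable {m : ℝ} {f : S2 → ℝ} {s₀ τ₁ τ₂ : ℝ} (R : IsGoodRange m f s₀ τ₁ τ₂) (hτ : τ₁ < τ₂)
include R hτ

theorem lapseInvSq_pos' {p : R4} (hp : p ∈ foliatedRegion m f τ₁ τ₂ s₀) :
    0 < lapseInvSq m f (leafCoord (timeFun m f) p) :=
  R.lapseInvSq_pos _ ((R.isLeafCoord hτ).mapsTo p hp)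

theorem lapse_eq {p : R4} (hp : p ∈ foliatedRegion m f τ₁ τ₂ s₀) :
    lapse (gSch m) (timeFun m f) p =
      (Real.sqrt (lapseInvSq m f (leafCoord (timeFun m f) p)))⁻¹ := by
  rw [lapse, R.apply_metricGrad_timeFun hτ hp, neg_neg]

theorem lapse_pos {p : R4} (hp : p ∈ foliatedRegion m f τ₁ τ₂ s₀) :
    0 < lapse (gSch m) (timeFun m f) p := by
  rw [R.lapse_eq hτ hp]
  exact inv_pos.2 (Real.sqrt_pos.2 (R.lapseInvSq_pos' hτ hp))

/-- The square root and the inverse are smooth because `lapseInvSq` is positive on the whole closed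
box, including `s = 0`. -/
theorem isSmoothIn_lapse : IsSmoothIn (leafCoord (timeFun m f)) (foliatedRegion m f τ₁ τ₂ s₀)
    (leafBox s₀ τ₁ τ₂) (lapse (gSch m) (timeFun m f)) :=
  ⟨fun z => (Real.sqrt (lapseInvSq m f z))⁻¹, fun z hz =>
    ((R.contDiffAt_lapseInvSq hz).sqrt (R.lapseInvSq_pos z hz).ne').inv
      (Real.sqrt_pos.2 (R.lapseInvSq_pos z hz)).ne', fun _ hp => R.lapse_eq hτ hp⟩

theorem isSmoothIn_lapse_inv : IsSmoothIn (leafCoord (timeFun m f))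
    (foliatedRegion m f τ₁ τ₂ s₀) (leafBox s₀ τ₁ τ₂)
    (fun p => (lapse (gSch m) (timeFun m f) p)⁻¹) :=
  ⟨fun z => Real.sqrt (lapseInvSq m f z), fun z hz =>
    (R.contDiffAt_lapseInvSq hz).sqrt (R.lapseInvSq_pos z hz).ne', fun p hp => by
      simp only [R.lapse_eq hτ hp, inv_inv]⟩

omit R hτ in
theorem isSmoothIn_timeFun {Ω : Set R4} {K : Set (E3 × ℝ × ℝ)} :
    IsSmoothIn (leafCoord (timeFun m f)) Ω K (timeFun m f) :=
  ⟨fun z => z.2.2, fun _ _ => contDiffAt_snd.snd, fun _ _ => rfl⟩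

theorem isAdmissibleField_unitNormal : IsAdmissibleField (foliatedRegion m f τ₁ τ₂ s₀)
    (IsSmoothIn (leafCoord (timeFun m f)) (foliatedRegion m f τ₁ τ₂ s₀) (leafBox s₀ τ₁ τ₂))
    (nullFrame m) (unitNormal (gSch m) (timeFun m f)) :=
  have F := (R.isLeafCoord hτ).admissibleFrame
  F.smul_field (F.neg (R.isSmoothIn_lapse hτ))
    (F.metricGrad_field fun k => F.deriv_frame isSmoothIn_timeFun k)

theorem apply_unitNormal {p : R4} (hp : p ∈ foliatedRegion m f τ₁ τ₂ s₀) (u : R4) :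
    gSch m p (unitNormal (gSch m) (timeFun m f) p) u =
      -(lapse (gSch m) (timeFun m f) p * fderiv ℝ (timeFun m f) p u) := by
  have F := (R.isLeafCoord hτ).admissibleFrame
  rw [unitNormal, F.metric.smul_left, F.metric.apply_metricGrad hp, neg_mul]

theorem unitNormal_unitNormal {p : R4} (hp : p ∈ foliatedRegion m f τ₁ τ₂ s₀) :
    gSch m p (unitNormal (gSch m) (timeFun m f) p) (unitNormal (gSch m) (timeFun m f) p) = -1 := by
  have F := (R.isLeafCoord hτ).admissibleFrame
  have h := Real.mul_self_sqrt (R.lapseInvSq_pos' hτ hp).le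
  have h0 := (Real.sqrt_pos.2 (R.lapseInvSq_pos' hτ hp)).ne'
  rw [unitNormal, F.metric.smul_left, F.metric.smul_right, R.apply_metricGrad_timeFun hτ hp,
    R.lapse_eq hτ hp]
  have key : ∀ r N : ℝ, r ≠ 0 → r * r = N → -r⁻¹ * (-r⁻¹ * -N) = -1 := by
    rintro r _ hr rfl
    field_simp
  exact key _ _ h0 h

theorem fderiv_timeFun_nullFrame_zero_pos {p : R4} (hp : p ∈ foliatedRegion m f τ₁ τ₂ s₀) :
    0 < fderiv ℝ (timeFun m f) p (nullFrame m (.inl 0) p) := by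
  have L := R.isLeafCoord hτ
  have hz := L.mapsTo p hp
  rw [L.deriv_tau p hp]
  exact inv_pos.2 (mul_pos (R.τ₁_pos.trans_le hz.2.2.1) (R.slope_pos _ hz))

/-- As `∂_t` is future pointing, the claim is that `∂_t τ` is positive, and `s ∂_t` is the first
field of the frame. -/
theorem unitNormal_future {p : R4} (hp : p ∈ foliatedRegion m f τ₁ τ₂ s₀) :
    gSch m p (unitNormal (gSch m) (timeFun m f) p) (coordVec 0) < 0 := by
  have L := R.isLeafCoord hτ
  have hs := (L.subset hp).1
  have h : nullFrame m (.inl 0) p = sCoord p • coordVec 0 := by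
    ext c
    refine Fin.cases ?_ (fun j => ?_) c <;> simp [nullFrame, coordVec]
  have h1 := R.fderiv_timeFun_nullFrame_zero_pos hτ hp
  rw [h, map_smul, smul_eq_mul] at h1
  rw [R.apply_unitNormal hτ hp, neg_lt_zero]
  exact mul_pos (R.lapse_pos hτ hp) (pos_of_mul_pos_right h1 hs.le)

theorem apply_pos_of_tangent {p : R4} (hp : p ∈ foliatedRegion m f τ₁ τ₂ s₀) {u : R4}
    (hu : u ≠ 0) (hut : fderiv ℝ (timeFun m f) p u = 0) : 0 < gSch m p u u := by
  have L := R.isLeafCoord hτ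
  refine gSch_pos_of_orthogonal (L.subset hp) (n := metricGrad (gSch m) (timeFun m f) p) ?_ ?_ hu
  · rw [R.apply_metricGrad_timeFun hτ hp]
    exact neg_lt_zero.2 (R.lapseInvSq_pos' hτ hp)
  · rw [L.admissibleFrame.metric.apply_metricGrad hp, hut]

theorem isAdmissibleField_radialNormal : IsAdmissibleField (foliatedRegion m f τ₁ τ₂ s₀)
    (IsSmoothIn (leafCoord (timeFun m f)) (foliatedRegion m f τ₁ τ₂ s₀) (leafBox s₀ τ₁ τ₂))
    (nullFrame m) (radialNormal m) :=
  have F := (R.isLeafCoord hτ).admissibleFrame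
  F.add_field (F.frame_field (.inl 0))
    (F.smul_field (F.coeff (.inl 1) (.inl 1)) (F.frame_field (.inl 1)))

/-- The normal planes are spanned by `T` and `radialNormal`, dual to `dτ` and `ds` up to nonzero
factors. The mean curvature vector is then an admissible field by
`exists_meanCurvatureVector_field`. -/
theorem exists_meanCurvatureVector_bound : ∃ C, ∀ p ∈ foliatedRegion m f τ₁ τ₂ s₀, ∀ N : R4,
    IsMeanCurvatureVector (gSch m) (timeFun m f) sCoord p N →
      vecNorm (thetaMetric (gSch m) (unitNormal (gSch m) (timeFun m f))) p N ≤ C := by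
  have L := R.isLeafCoord hτ
  have F := L.admissibleFrame
  have hT := R.isAdmissibleField_unitNormal hτ
  set T := unitNormal (gSch m) (timeFun m f) with hTdef
  set n : Fin 2 → R4 → R4 := ![T, radialNormal m] with hn
  -- The Gram determinant of the two normal fields. Both of its terms are nonpositive; the first is
  -- negative for `s > 0`, and at `s = 0` the second is, since `s ∂_v τ` is positive there.
  set ν : E3 × ℝ × ℝ → ℝ := fun z =>
    -((1 - 2 * m * z.2.1) * z.2.1 ^ 2) - ((Real.sqrt (lapseInvSq m f z))⁻¹ *
      (timeDeriv f (.inl 0) z + (1 - 2 * m * z.2.1) * z.2.1 ^ 2 * timeDeriv f (.inl 1) z)) ^ 2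
    with hν
  have hdet : ∀ p ∈ foliatedRegion m f τ₁ τ₂ s₀, gSch m p (n 0 p) (n 0 p) *
      gSch m p (n 1 p) (n 1 p) - gSch m p (n 0 p) (n 1 p) ^ 2 = ν (leafCoord (timeFun m f) p) := by
    intro p hp
    have hpe := L.subset hp
    have hs := hpe.1.ne'
    have h1 : gSch m p (T p) (T p) = -1 := R.unitNormal_unitNormal hτ hp
    have h2 : gSch m p (radialNormal m p) (radialNormal m p) = lapseFactor m p * sCoord p ^ 2 := by
      rw [gSch_radialNormal F.metric hpe, radialNormal]
      have : radialForm p (nullFrame m (.inl 0) p +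
          (lapseFactor m p * sCoord p ^ 2) • nullFrame m (.inl 1) p) =
          radialForm p (nullFrame m (.inl 0) p) +
          (lapseFactor m p * sCoord p ^ 2) * radialForm p (nullFrame m (.inl 1) p) := by
        simp only [radialForm, Pi.add_apply, Pi.smul_apply, smul_eq_mul, Finset.mul_sum,
          ← Finset.sum_add_distrib]
        refine Finset.sum_congr rfl fun i _ => by ring
      rw [this, radialForm_nullFrame_zero, radialForm_nullFrame_one hpe]
      field_simp
      ring
    have h3 : gSch m p (T p) (radialNormal m p) = -((Real.sqrt
        (lapseInvSq m f (leafCoord (timeFun m f) p)))⁻¹ *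
        (timeDeriv f (.inl 0) (leafCoord (timeFun m f) p) +
          lapseFactor m p * sCoord p ^ 2 * timeDeriv f (.inl 1) (leafCoord (timeFun m f) p))) := by
      rw [hTdef, R.apply_unitNormal hτ hp, R.lapse_eq hτ hp, radialNormal, map_add, map_smul,
        L.deriv_tau p hp, L.deriv_tau p hp, smul_eq_mul]
    simp only [hn, Matrix.cons_val_zero, Matrix.cons_val_one, h1, h2, h3, hν, lapseFactor,
      leafCoord]
    ring
  have hν0 : ∀ z ∈ leafBox s₀ τ₁ τ₂, ν z ≠ 0 := by
    intro z hz
    have hh := R.one_sub_pos hz.2.1.2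
    have hi := inv_pos.2 (Real.sqrt_pos.2 (R.lapseInvSq_pos z hz))
    refine ne_of_lt ?_
    rcases hz.2.1.1.eq_or_lt with h0 | h0
    · have h1 : 0 < timeDeriv f (.inl 0) z :=
        inv_pos.2 (mul_pos (R.τ₁_pos.trans_le hz.2.2.1) (R.slope_pos _ hz))
      simp only [hν, ← h0]
      have := pow_pos (mul_pos hi h1) 2
      simpa using this
    · have h1 := mul_pos hh (pow_pos h0 2)
      simp only [hν]
      have := sq_nonneg ((Real.sqrt (lapseInvSq m f z))⁻¹ *
        (timeDeriv f (.inl 0) z + (1 - 2 * m * z.2.1) * z.2.1 ^ 2 * timeDeriv f (.inl 1) z))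
      linarith
  have hνs : ∀ z ∈ leafBox s₀ τ₁ τ₂, ContDiffAt ℝ ∞ ν z := by
    intro z hz
    have hs : ContDiffAt ℝ ∞ (fun z : E3 × ℝ × ℝ => z.2.1) z := contDiffAt_snd.fst
    have hhs := (contDiffAt_const (c := (1 : ℝ)).sub
      ((contDiffAt_const (c := 2 * m)).mul hs)).mul (hs.pow 2)
    exact hhs.neg.sub (((((R.contDiffAt_lapseInvSq hz).sqrt (R.lapseInvSq_pos z hz).ne').inv
      (Real.sqrt_pos.2 (R.lapseInvSq_pos z hz)).ne').mul
        ((L.smooth_deriv _ z hz).add (hhs.mul (L.smooth_deriv _ z hz)))).pow 2)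
  have hnf : ∀ i, IsAdmissibleField (foliatedRegion m f τ₁ τ₂ s₀) (IsSmoothIn (leafCoord
      (timeFun m f)) (foliatedRegion m f τ₁ τ₂ s₀) (leafBox s₀ τ₁ τ₂)) (nullFrame m) (n i) := by
    intro i
    fin_cases i
    · exact hT
    · exact R.isAdmissibleField_radialNormal hτ
  obtain ⟨N₀, hN₀, hN⟩ := F.exists_meanCurvatureVector_field hnf
    (fun p hp => by rw [hdet p hp]; exact hν0 _ (L.mapsTo p hp))
    ⟨fun z => (ν z)⁻¹, fun z hz => (hνs z hz).inv (hν0 z hz), fun p hp => by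
      simp only [hdet p hp]⟩
  obtain ⟨C, hC⟩ := F.vecNorm_bounded hT hN₀
  refine ⟨C, fun p hp N hNp => ?_⟩
  obtain ⟨W, hW, hWp, rfl⟩ := hNp
  rw [hN p hp W (fun i => (hW i).differentiableAt (by simp))]
  · exact hC p hp
  filter_upwards [hWp, F.mem_nhds hp] with q ⟨h1, h2⟩ hq
  refine ⟨fun i j => ?_, h2⟩
  have hqe := L.subset hq
  rw [F.metric.symm]
  fin_cases j
  · change gSch m q (T q) (W i q) = 0
    rw [hTdef, R.apply_unitNormal hτ hq, (h1 i).1, mul_zero, neg_zero]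
  · change gSch m q (radialNormal m q) (W i q) = 0
    have h3 := (h1 i).2
    rw [fderiv_sCoord hqe.1, neg_mul, neg_eq_zero, mul_eq_zero] at h3
    rw [gSch_radialNormal F.metric hqe, h3.resolve_left (pow_pos hqe.1 2).ne', mul_zero, neg_zero]

theorem exists_isMeanCurvatureVector {p : R4} (hp : p ∈ foliatedRegion m f τ₁ τ₂ s₀) :
    ∃ N, IsMeanCurvatureVector (gSch m) (timeFun m f) sCoord p N := by
  have L := R.isLeafCoord hτ
  have F := L.admissibleFrame
  have hpe := L.subset hp
  set c : Fin 3 → R4 → ℝ := fun i q => fderiv ℝ (timeFun m f) q (nullFrame m (.inr i) q) /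
    fderiv ℝ (timeFun m f) q (nullFrame m (.inl 0) q) with hc
  -- The field `s ∂_v` leaves `s` unchanged and strictly increases `τ`, so subtracting a multiple of
  -- it makes the projected coordinate vectors tangent to both families of level sets.
  set X : Fin 3 → R4 → R4 := fun i q => nullFrame m (.inr i) q - c i q • nullFrame m (.inl 0) q
    with hX
  have hd : ∀ k, ContDiffAt ℝ ∞ (fun q => fderiv ℝ (timeFun m f) q (nullFrame m k q)) p :=
    fun k => F.smooth (F.deriv_frame isSmoothIn_timeFun k) p hp
  have hXs : ∀ i, ContDiffAt ℝ ∞ (X i) p := fun i =>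
    (F.smooth_frame _ p hp).sub (((hd _).div (hd _)
      (R.fderiv_timeFun_nullFrame_zero_pos hτ hp).ne').smul (F.smooth_frame _ p hp))
  have hXt : ∀ i, ∀ q ∈ foliatedRegion m f τ₁ τ₂ s₀,
      fderiv ℝ (timeFun m f) q (X i q) = 0 ∧ fderiv ℝ sCoord q (X i q) = 0 := by
    intro i q hq
    have hqe := L.subset hq
    have h0 := (R.fderiv_timeFun_nullFrame_zero_pos hτ hq).ne'
    constructor
    · rw [hX, map_sub, map_smul, smul_eq_mul, hc, div_mul_cancel₀ _ h0, sub_self]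
    · rw [hX, map_sub, map_smul, fderiv_sCoord hqe.1, fderiv_sCoord hqe.1,
        radialForm_nullFrame_zero, radialForm_nullFrame_inr hqe]
      simp
  -- Where `y_k ≠ 0`, the projections of the other two coordinate vectors are independent. Their
  -- indices are `k + 1` and `k + 2` modulo 3.
  obtain ⟨k, hk⟩ : ∃ k, unitComp k p ≠ 0 := by
    by_contra! h
    have := sum_unitComp_sq hpe.1
    simp [h] at this
  have hcomp : ∀ i j : Fin 3, X i p j.succ = (if i = j then 1 else 0) - unitComp i p * unitComp j p := by
    intro i j
    simp [hX, nullFrame]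
  have h1 : k + 1 ≠ k := by fin_cases k <;> decide
  have h2 : k + 2 ≠ k := by fin_cases k <;> decide
  have h3 : k + 1 ≠ k + 2 := by fin_cases k <;> decide
  refine F.metric.exists_isMeanCurvatureVector hp (hXs (k + 1)) (hXs (k + 2)) ?_ ?_
    fun u hu hut => R.apply_pos_of_tangent hτ hp hu hut
  · filter_upwards [F.mem_nhds hp] with q hq using ⟨hXt _ q hq, hXt _ q hq⟩
  · rw [LinearIndependent.pair_iff]
    intro a b hab
    have h4 : ∀ j : Fin 3, a * X (k + 1) p j.succ + b * X (k + 2) p j.succ = 0 := fun j =>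
      congrFun hab j.succ
    have h5 := h4 k
    have h6 := h4 (k + 1)
    have h7 := h4 (k + 2)
    rw [hcomp, hcomp, if_neg h1, if_neg h2] at h5
    rw [hcomp, hcomp, if_pos rfl, if_neg h3.symm] at h6
    rw [hcomp, hcomp, if_pos rfl, if_neg h3] at h7
    have h8 : a * unitComp (k + 1) p + b * unitComp (k + 2) p = 0 := by
      have : (a * unitComp (k + 1) p + b * unitComp (k + 2) p) * unitComp k p = 0 := by linarith
      exact (mul_eq_zero.1 this).resolve_right hk
    constructor
    · linear_combination h6 + unitComp (k + 1) p * h8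
    · linear_combination h7 + unitComp (k + 2) p * h8

end IsGoodRange

/-! ### Calculus modulo `s`. -/

/-- The divergence of `nullFrame` for the Euclidean volume. -/
theorem sum_fderiv_nullFrame {m : ℝ} {p : R4} (hp : p ∈ exterior m) (k : Fin 2 ⊕ Fin 3) :
    ∑ a, fderiv ℝ (nullFrame m k) p (coordVec a) a =
      Sum.elim ![0, -3] (fun i => -(2 * sCoord p * unitComp i p)) k := by
  have hY := sum_unitComp_sq hp.1
  have h0 : radialForm p (coordVec 0) = 0 := by
    simp [radialForm, coordVec]
  have h1 : ∀ j : Fin 3, radialForm p (coordVec j.succ) = unitComp j p := by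
    intro j
    simp [radialForm, coordVec, Pi.single_apply]
  rw [Fin.sum_univ_succ]
  rcases k with k | i
  · fin_cases k
    · simp [fderiv_nullFrame_zero hp, h0]
    · simp only [Fin.mk_one, fderiv_nullFrame_one hp, h0, h1]
      simp [coordVec]
  · have h2 : ∀ j : Fin 3, coordVec j.succ i.succ = if i = j then 1 else 0 := fun j => by
      simp [coordVec, Pi.single_apply]
    have h3 : ∀ j : Fin 3, coordVec j.succ j.succ = 1 := fun j => by simp [coordVec]
    have h4 : ∀ j : Fin 3, -(sCoord p * (unitComp i p * (1 - unitComp j p * unitComp j p) +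
        unitComp j p * ((if i = j then 1 else 0) - unitComp i p * unitComp j p))) =
        2 * sCoord p * unitComp i p * unitComp j p ^ 2 - sCoord p * unitComp i p
        - (if i = j then sCoord p * unitComp j p else 0) := by
      intro j
      split_ifs <;> ring
    simp only [fderiv_nullFrame_inr hp, h1, h2, h3, h4, Fin.cons_zero, Fin.cons_succ,
      Finset.sum_sub_distrib, ← Finset.mul_sum, hY, Sum.elim_inr]
    simp
    ring
/-- Equality of functions of a class `A` modulo `s` times functions of that class. -/
def EqModS (A : (R4 → ℝ) → Prop) (Ω : Set R4) (h h' : R4 → ℝ) : Prop :=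
  A h' ∧ ∃ u, A u ∧ ∀ p ∈ Ω, h p = h' p + sCoord p * u p

namespace AdmissibleFrame

variable {m : ℝ} {g : R4 → R4 → R4 → ℝ} {Ω : Set R4} {A : (R4 → ℝ) → Prop}
  {G : Fin 2 ⊕ Fin 3 → Fin 2 ⊕ Fin 3 → R4 → ℝ}
  (F : AdmissibleFrame g Ω A (nullFrame m) G) (hΩ : Ω ⊆ exterior m) (hs : A sCoord)
include F

theorem fderiv_mul {h h' : R4 → ℝ} (hh : A h) (hh' : A h') {p : R4} (hp : p ∈ Ω) (u : R4) :
    fderiv ℝ (fun p => h p * h' p) p u = h p * fderiv ℝ h' p u + h' p * fderiv ℝ h p u := by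
  rw [((F.differentiableAt hh hp).hasFDerivAt.fun_mul (F.differentiableAt hh' hp).hasFDerivAt).fderiv]
  simp

theorem fderiv_add {h h' : R4 → ℝ} (hh : A h) (hh' : A h') {p : R4} (hp : p ∈ Ω) (u : R4) :
    fderiv ℝ (fun p => h p + h' p) p u = fderiv ℝ h p u + fderiv ℝ h' p u := by
  rw [((F.differentiableAt hh hp).hasFDerivAt.fun_add (F.differentiableAt hh' hp).hasFDerivAt).fderiv]
  simp

theorem eqModS_refl {h : R4 → ℝ} (hh : A h) : EqModS A Ω h h :=
  ⟨hh, fun _ => 0, F.const 0, fun p _ => by simp⟩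

omit F in
theorem eqModS_congr_left {h₁ h h' : R4 → ℝ} (hh : EqModS A Ω h h') (h1 : ∀ p ∈ Ω, h₁ p = h p) :
    EqModS A Ω h₁ h' := by
  obtain ⟨h2, u, hu, h3⟩ := hh
  exact ⟨h2, u, hu, fun p hp => (h1 p hp).trans (h3 p hp)⟩

theorem eqModS_congr_right {h₁ h h' : R4 → ℝ} (hh : EqModS A Ω h h') (h1 : ∀ p ∈ Ω, h₁ p = h' p) :
    EqModS A Ω h h₁ := by
  obtain ⟨h2, u, hu, h3⟩ := hh
  exact ⟨F.congr h2 h1, u, hu, fun p hp => (h3 p hp).trans (by rw [h1 p hp])⟩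

theorem eqModS_trans {h h' h'' : R4 → ℝ} (hh : EqModS A Ω h h') (hh' : EqModS A Ω h' h'') :
    EqModS A Ω h h'' := by
  obtain ⟨_, u, hu, h3⟩ := hh
  obtain ⟨h2', u', hu', h3'⟩ := hh'
  exact ⟨h2', fun p => u p + u' p, F.add hu hu', fun p hp => by rw [h3 p hp, h3' p hp]; ring⟩

theorem eqModS_add {h₁ h₂ h₁' h₂' : R4 → ℝ} (hh : EqModS A Ω h₁ h₁') (hh' : EqModS A Ω h₂ h₂') :
    EqModS A Ω (fun p => h₁ p + h₂ p) (fun p => h₁' p + h₂' p) := by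
  obtain ⟨h2, u, hu, h3⟩ := hh
  obtain ⟨h2', u', hu', h3'⟩ := hh'
  exact ⟨F.add h2 h2', fun p => u p + u' p, F.add hu hu', fun p hp => by
    simp only [h3 p hp, h3' p hp]; ring⟩

theorem eqModS_sum {κ : Type} (s : Finset κ) {h h' : κ → R4 → ℝ}
    (hh : ∀ i, EqModS A Ω (h i) (h' i)) :
    EqModS A Ω (fun p => ∑ i ∈ s, h i p) (fun p => ∑ i ∈ s, h' i p) := by
  classical
  induction s using Finset.induction_on with
  | empty => simpa using F.eqModS_refl (F.const 0)
  | insert i s hi ih => simpa only [Finset.sum_insert hi] using F.eqModS_add (hh i) ih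

include hs

omit hs in
theorem eqModS_zero_of_mul {u : R4 → ℝ} (hu : A u) :
    EqModS A Ω (fun p => sCoord p * u p) (fun _ => 0) :=
  ⟨F.const 0, u, hu, fun p _ => by simp⟩

theorem eqModS_mul {h₁ h₂ h₁' h₂' : R4 → ℝ} (hh : EqModS A Ω h₁ h₁') (hh' : EqModS A Ω h₂ h₂') :
    EqModS A Ω (fun p => h₁ p * h₂ p) (fun p => h₁' p * h₂' p) := by
  obtain ⟨h2, u, hu, h3⟩ := hh
  obtain ⟨h2', u', hu', h3'⟩ := hh'
  exact ⟨F.mul h2 h2', fun p => u p * h₂' p + h₁' p * u' p + sCoord p * (u p * u' p),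
    F.add (F.add (F.mul hu h2') (F.mul h2 hu')) (F.mul hs (F.mul hu hu')), fun p hp => by
    simp only [h3 p hp, h3' p hp]; ring⟩

include hΩ

/-- Every field of the frame maps `s` to `0` or to `s`, so multiples of `s` remain multiples of `s`.
Leading terms can therefore be taken before differentiating. -/
theorem eqModS_deriv {h h' : R4 → ℝ} (hh : EqModS A Ω h h') (k : Fin 2 ⊕ Fin 3) :
    EqModS A Ω (fun p => fderiv ℝ h p (nullFrame m k p))
      (fun p => fderiv ℝ h' p (nullFrame m k p)) := by
  obtain ⟨h2, u, hu, h3⟩ := hh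
  have hds : ∀ p ∈ Ω, fderiv ℝ sCoord p (nullFrame m k p) =
      sCoord p * Sum.elim ![0, 1] (fun _ => 0) k := by
    intro p hp
    have h0 := (hΩ hp).1.ne'
    rw [fderiv_sCoord (hΩ hp).1]
    rcases k with k | i
    · fin_cases k
      · simp [radialForm_nullFrame_zero]
      · simp [radialForm_nullFrame_one (hΩ hp)]
        field_simp
    · simp [radialForm_nullFrame_inr (hΩ hp)]
  refine ⟨F.deriv_frame h2 k, fun p => fderiv ℝ u p (nullFrame m k p) +
    u p * Sum.elim ![0, 1] (fun _ => 0) k,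
    F.add (F.deriv_frame hu k) (F.mul hu (F.const _)), fun p hp => ?_⟩
  have h4 : h =ᶠ[𝓝 p] fun p => h' p + sCoord p * u p := by
    filter_upwards [F.mem_nhds hp] with q hq using h3 q hq
  simp only [h4.fderiv_eq, F.fderiv_add h2 (F.mul hs hu) hp, F.fderiv_mul hs hu hp, hds p hp]
  ring

end AdmissibleFrame

/-! ### Leading terms of the derivatives of `τ` and of the lapse. -/

namespace IsGoodRange

variable {m : ℝ} {f : S2 → ℝ} {s₀ τ₁ τ₂ : ℝ} (R : IsGoodRange m f s₀ τ₁ τ₂) (hτ : τ₁ < τ₂)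

/-- The functions that extend smoothly to the closed coordinate domain of the foliation. -/
def SmoothClass (m : ℝ) (f : S2 → ℝ) (s₀ τ₁ τ₂ : ℝ) : (R4 → ℝ) → Prop :=
  IsSmoothIn (leafCoord (timeFun m f)) (foliatedRegion m f τ₁ τ₂ s₀) (leafBox s₀ τ₁ τ₂)

local notation "𝓐" => SmoothClass m f s₀ τ₁ τ₂
local notation "Ω" => foliatedRegion m f τ₁ τ₂ s₀

include R hτ

theorem frame : AdmissibleFrame (gSch m) Ω 𝓐 (nullFrame m) (nullCoeff m) :=
  (R.isLeafCoord hτ).admissibleFrame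

omit R hτ in
theorem norm_eq_one_of_mem {z : E3 × ℝ × ℝ} (hz : z ∈ leafBox s₀ τ₁ τ₂) : ‖z.1‖ = 1 :=
  mem_sphere_zero_iff_norm.1 hz.1

omit R hτ in
theorem ne_zero_of_mem {z : E3 × ℝ × ℝ} (hz : z ∈ leafBox s₀ τ₁ τ₂) : z.1 ≠ 0 :=
  norm_ne_zero_iff.1 (by rw [norm_eq_one_of_mem hz]; exact one_ne_zero)

omit R hτ in
theorem smoothClass_sCoord : 𝓐 sCoord := IsLeafCoord.isSmoothIn_sCoord

omit R hτ in
theorem smoothClass_sphere {H : E3 → ℝ} (hH : ∀ x ≠ 0, ContDiffAt ℝ ∞ H x) :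
    𝓐 fun p => H (sphereVec p) :=
  ⟨fun z => H z.1, fun z hz => (hH _ (ne_zero_of_mem hz)).comp z contDiffAt_fst, fun _ _ => rfl⟩

omit hτ in
theorem smoothClass_inv : 𝓐 fun p => (timeFun m f p)⁻¹ :=
  ⟨fun z => z.2.2⁻¹, fun _ hz => contDiffAt_snd.snd.inv (R.τ₁_pos.trans_le hz.2.2.1).ne',
    fun _ _ => rfl⟩

/-- The first two fields do not move `y`, and the projected vectors move it at rate `s`. Thus
functions of `y` behave as constants to leading order. -/
theorem eqModS_deriv_sphere {H : E3 → ℝ} (hH : ∀ x ≠ 0, ContDiffAt ℝ ∞ H x)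
    (k : Fin 2 ⊕ Fin 3) : EqModS 𝓐 Ω
      (fun p => fderiv ℝ (fun p => H (sphereVec p)) p (nullFrame m k p)) (fun _ => 0) := by
  have F := R.frame hτ
  have L := R.isLeafCoord hτ
  have h1 : ∀ p ∈ Ω, fderiv ℝ (fun p => H (sphereVec p)) p (nullFrame m k p) =
      fderiv ℝ H (sphereVec p) (fderiv ℝ sphereVec p (nullFrame m k p)) := by
    intro p hp
    have hs := (L.subset hp).1
    have := fderiv_comp p ((hH _ (sphereVec_ne_zero hs)).differentiableAt (by simp))
      ((contDiffAt_sphereVec hs).differentiableAt (by simp))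
    exact congrArg (fun L => L (nullFrame m k p)) this
  rcases k with k | i
  · refine AdmissibleFrame.eqModS_congr_left (F.eqModS_refl (F.const 0)) fun p hp => ?_
    rw [h1 p hp]
    fin_cases k
    · exact (congrArg _ (fderiv_sphereVec_nullFrame_zero (L.subset hp))).trans (map_zero _)
    · exact (congrArg _ (fderiv_sphereVec_nullFrame_one (L.subset hp))).trans (map_zero _)
  · refine AdmissibleFrame.eqModS_congr_left (F.eqModS_zero_of_mul
      (u := fun p => fderiv ℝ H (sphereVec p)
        (EuclideanSpace.single i 1 - sphereVec p i • sphereVec p))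
      ⟨fun z => fderiv ℝ H z.1 (EuclideanSpace.single i 1 - z.1 i • z.1), fun z hz =>
        (((hH _ (ne_zero_of_mem hz)).fderiv_right (m := ∞) (by simp)).comp z
          contDiffAt_fst).clm_apply
          (contDiffAt_const.sub ((contDiffAt_coord z i).smul contDiffAt_fst)),
        fun _ _ => rfl⟩) fun p hp => ?_
    rw [h1 p hp, fderiv_sphereVec_nullFrame_inr (L.subset hp), map_smul, smul_eq_mul,
      sphereVec_apply]

/-- Replacing `1 - s Δf / 2` by `1` costs a multiple of `s`; the remainder is smooth because this
factor is positive on the closed box. -/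
theorem eqModS_deriv_zero : EqModS 𝓐 Ω
    (fun p => fderiv ℝ (timeFun m f) p (nullFrame m (.inl 0) p))
    (fun p => (timeFun m f p)⁻¹) := by
  have L := R.isLeafCoord hτ
  refine ⟨R.smoothClass_inv, fun p => slopeInv f (leafCoord (timeFun m f) p) *
      (1 / 2 * homExt (sphereLaplacian f) (sphereVec p)),
    (R.frame hτ).mul ⟨slopeInv f, fun z hz => L.smooth_deriv (.inl 0) z hz, fun _ _ => rfl⟩
      ((R.frame hτ).mul ((R.frame hτ).const _) (smoothClass_sphere R.smooth.sphereLaplacian)),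
    fun p hp => ?_⟩
  have hz := L.mapsTo p hp
  have h1 : timeFun m f p ≠ 0 := (R.τ₁_pos.trans_le hz.2.2.1).ne'
  have h2 : 1 - 1 / 2 * sCoord p * homExt (sphereLaplacian f) (sphereVec p) ≠ 0 :=
    (R.slope_pos _ hz).ne'
  beta_reduce
  rw [L.deriv_tau p hp]
  simp only [timeDeriv, slopeInv, leafCoord]
  generalize homExt (sphereLaplacian f) (sphereVec p) = l at *
  rw [mul_inv]
  have h3 : (1 - 1 / 2 * sCoord p * l)⁻¹ * (1 - 1 / 2 * sCoord p * l) = 1 := inv_mul_cancel₀ h2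
  linear_combination (timeFun m f p)⁻¹ * h3

theorem eqModS_deriv_one : EqModS 𝓐 Ω
    (fun p => fderiv ℝ (timeFun m f) p (nullFrame m (.inl 1) p))
    (fun p => (timeFun m f p)⁻¹ * (-(1 / 2) * (homExt (sphereGradSq f) (sphereVec p)
      + timeFun m f p * timeFun m f p))) := by
  have L := R.isLeafCoord hτ
  have F := R.frame hτ
  have ht : 𝓐 (timeFun m f) := isSmoothIn_timeFun
  have hq : 𝓐 fun p => homExt (sphereGradSq f) (sphereVec p) :=
    smoothClass_sphere R.smooth.sphereGradSq
  have hl : 𝓐 fun p => homExt (sphereLaplacian f) (sphereVec p) :=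
    smoothClass_sphere R.smooth.sphereLaplacian
  have hw : 𝓐 fun p => homExt (gradSqDeriv f) (sphereVec p) :=
    smoothClass_sphere (hasSmoothExt_gradSqDeriv R.smooth)
  refine AdmissibleFrame.eqModS_congr_left (F.eqModS_mul smoothClass_sCoord (R.eqModS_deriv_zero hτ)
    (h₂ := fun p => -(1 / 2) * (homExt (sphereGradSq f) (sphereVec p)
      + timeFun m f p * timeFun m f p) + sCoord p * (1 / 2 * (homExt (gradSqDeriv f) (sphereVec p)
      + timeFun m f p * timeFun m f p * homExt (sphereLaplacian f) (sphereVec p))))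
    ⟨F.mul (F.const _) (F.add hq (F.mul ht ht)), _,
      F.mul (F.const _) (F.add hw (F.mul (F.mul ht ht) hl)), fun _ _ => rfl⟩) fun p hp => ?_
  rw [L.deriv_tau p hp, L.deriv_tau p hp]
  simp only [timeDeriv, leafCoord]
  ring

omit hτ in
theorem contDiffAt_tangDeriv (i : Fin 3) : ∀ x ≠ 0, ContDiffAt ℝ ∞ (tangDeriv f i) x := fun x hx =>
  (R.smooth.contDiffAt_tangDeriv i (z := (x, 0, 0)) hx).comp x
    (contDiffAt_id.prodMk contDiffAt_const)

theorem eqModS_deriv_inr (i : Fin 3) : EqModS 𝓐 Ω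
    (fun p => fderiv ℝ (timeFun m f) p (nullFrame m (.inr i) p))
    (fun p => (timeFun m f p)⁻¹ * tangDeriv f i (sphereVec p)) := by
  have L := R.isLeafCoord hτ
  have F := R.frame hτ
  have hT : ∀ {φ : S2 → ℝ}, HasSmoothExt φ → 𝓐 fun p => tangDeriv φ i (sphereVec p) :=
    fun {φ} hφ => ⟨fun z => tangDeriv φ i z.1, fun z hz => hφ.contDiffAt_tangDeriv i
      (ne_zero_of_mem hz), fun _ _ => rfl⟩
  have ht : 𝓐 (timeFun m f) := isSmoothIn_timeFun
  have hs : 𝓐 sCoord := smoothClass_sCoord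
  refine AdmissibleFrame.eqModS_congr_left (F.eqModS_mul smoothClass_sCoord (R.eqModS_deriv_zero hτ)
    (h₂ := fun p => tangDeriv f i (sphereVec p) + sCoord p *
      (-(1 / 2) * tangDeriv (sphereGradSq f) i (sphereVec p) + sCoord p *
        (1 / 4 * (tangDeriv (gradSqDeriv f) i (sphereVec p) + timeFun m f p * timeFun m f p *
          tangDeriv (sphereLaplacian f) i (sphereVec p)))))
    ⟨hT R.smooth, _, F.add (F.mul (F.const _) (hT R.smooth.sphereGradSq)) (F.mul hs
      (F.mul (F.const _) (F.add (hT (hasSmoothExt_gradSqDeriv R.smooth)) (F.mul (F.mul ht ht)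
        (hT R.smooth.sphereLaplacian))))), fun _ _ => rfl⟩) fun p hp => ?_
  rw [L.deriv_tau p hp, L.deriv_tau p hp]
  simp only [timeDeriv, leafCoord]
  ring

/-- The leading term is the computation of `lapseInvSq_zero`, repeated with an explicit smooth
remainder. -/
theorem eqModS_lapse : EqModS 𝓐 Ω (lapse (gSch m) (timeFun m f)) (fun _ => 1) := by
  have L := R.isLeafCoord hτ
  have F := R.frame hτ
  have hs : 𝓐 sCoord := smoothClass_sCoord
  have h1 := F.eqModS_mul hs (F.eqModS_refl (F.const (-1))) (F.eqModS_add (F.eqModS_add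
    (F.eqModS_mul hs (F.eqModS_refl (F.const 2)) (F.eqModS_mul hs (R.eqModS_deriv_zero hτ)
      (R.eqModS_deriv_one hτ)))
    (F.eqModS_zero_of_mul (F.mul (F.mul (F.add (F.const 1) (F.mul (F.const (-(2 * m))) hs)) hs)
      (F.mul (F.deriv_frame isSmoothIn_timeFun (.inl 1))
        (F.deriv_frame isSmoothIn_timeFun (.inl 1))))))
    (F.eqModS_sum Finset.univ fun i => F.eqModS_mul hs (R.eqModS_deriv_inr hτ i)
      (R.eqModS_deriv_inr hτ i)))
  have h2 : EqModS 𝓐 Ω (fun p => lapseInvSq m f (leafCoord (timeFun m f) p)) (fun _ => 1) := by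
    refine F.eqModS_congr_right (AdmissibleFrame.eqModS_congr_left h1 fun p hp => ?_) fun p hp => ?_
    · simp only [lapseInvSq, L.deriv_tau p hp]
      simp only [leafCoord, ← pow_two]
      ring
    · have h3 : timeFun m f p ≠ 0 := (R.τ₁_pos.trans_le (L.mapsTo p hp).2.2.1).ne'
      have h4 := R.smooth.sum_tangDeriv_sq (sum_sphereVec (L.subset hp).1)
      have h5 : ∀ i, (timeFun m f p)⁻¹ * tangDeriv f i (sphereVec p) *
          ((timeFun m f p)⁻¹ * tangDeriv f i (sphereVec p)) =
          (timeFun m f p)⁻¹ ^ 2 * tangDeriv f i (sphereVec p) ^ 2 := fun i => by ring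
      simp only [h5, ← Finset.mul_sum, h4]
      field_simp
      ring
  obtain ⟨-, ν, hν, h3⟩ := h2
  -- With `N` for `lapseInvSq`, this is `N^(-1/2) - 1 = (1 - N) / (√N (1 + √N))` combined with `N =
  -- 1 + s ν`.
  refine ⟨F.const 1, fun p => -ν p * lapse (gSch m) (timeFun m f) p *
    (1 + Real.sqrt (lapseInvSq m f (leafCoord (timeFun m f) p)))⁻¹,
    F.mul (F.mul (F.neg hν) (R.isSmoothIn_lapse hτ))
      ⟨fun z => (1 + Real.sqrt (lapseInvSq m f z))⁻¹, fun z hz =>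
        (contDiffAt_const.add ((R.contDiffAt_lapseInvSq hz).sqrt (R.lapseInvSq_pos z hz).ne')).inv
          (by positivity), fun _ _ => rfl⟩, fun p hp => ?_⟩
  have h4 := R.lapseInvSq_pos' hτ hp
  have h5 := Real.sqrt_pos.2 h4
  have h6 := Real.mul_self_sqrt h4.le
  simp only [R.lapse_eq hτ hp]
  have h7 := h3 p hp
  beta_reduce at h7
  rw [← h6] at h7
  generalize Real.sqrt (lapseInvSq m f (leafCoord (timeFun m f) p)) = r at *
  field_simp
  linear_combination -h7

end IsGoodRange

/-! ### The divergence of the unit normal and the mean curvature of the leaves. -/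

namespace AdmissibleFrame

/-- The product rule `div (c E) = E c + c div E`; the derivatives of the coefficients occur only
along the frame, where they are controlled. -/
theorem sum_fderiv_field {m : ℝ} {g : R4 → R4 → R4 → ℝ} {Ω : Set R4} {A : (R4 → ℝ) → Prop}
    {G : Fin 2 ⊕ Fin 3 → Fin 2 ⊕ Fin 3 → R4 → ℝ} (F : AdmissibleFrame g Ω A (nullFrame m) G)
    (hΩ : Ω ⊆ exterior m) {c : Fin 2 ⊕ Fin 3 → R4 → ℝ} (hc : ∀ k, A (c k)) {X : R4 → R4}
    (hX : ∀ p ∈ Ω, X p = ∑ k, c k p • nullFrame m k p) {p : R4} (hp : p ∈ Ω) :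
    ∑ a, fderiv ℝ X p (coordVec a) a = ∑ k, (fderiv ℝ (c k) p (nullFrame m k p) +
      c k p * Sum.elim ![0, -3] (fun i => -(2 * sCoord p * unitComp i p)) k) := by
  have h1 : HasFDerivAt (fun q => ∑ k, c k q • nullFrame m k q) _ p :=
    HasFDerivAt.fun_sum fun k _ => (F.differentiableAt (hc k) hp).hasFDerivAt.fun_smul
      (F.differentiableAt_frame k hp).hasFDerivAt
  rw [(F.field_eventuallyEq hX hp).fderiv_eq, h1.fderiv]
  simp only [_root_.sum_apply, _root_.add_apply,
    _root_.smul_apply, ContinuousLinearMap.smulRight_apply, Finset.sum_apply,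
    Pi.add_apply, Pi.smul_apply, smul_eq_mul]
  rw [Finset.sum_comm]
  refine Finset.sum_congr rfl fun k _ => ?_
  rw [Finset.sum_add_distrib, ← Finset.mul_sum, sum_fderiv_nullFrame (hΩ hp), add_comm]
  congr 1
  rw [← sum_mul_clm_coordVec]
  exact Finset.sum_congr rfl fun a _ => mul_comm _ _

end AdmissibleFrame

theorem contMDiff_coe_S2 : ContMDiff (𝓡 2) 𝓘(ℝ, E3) ∞ (fun y : S2 => (y : E3)) :=
  have := Fact.mk (finrank_euclideanSpace_fin (𝕜 := ℝ) (n := 2 + 1))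
  contMDiff_coe_sphere (E := E3) (n := 2)

theorem contMDiff_coe_prod : ContMDiff ((𝓡 2).prod 𝓘(ℝ, ℝ × ℝ)) 𝓘(ℝ, E3 × ℝ × ℝ) ∞
    (fun z : S2 × ℝ × ℝ => ((z.1 : E3), z.2)) := by
  have h1 : ContMDiff ((𝓡 2).prod 𝓘(ℝ, ℝ × ℝ)) 𝓘(ℝ, E3) ∞ (fun z : S2 × ℝ × ℝ => (z.1 : E3)) :=
    contMDiff_coe_S2.comp contMDiff_fst
  have h2 : ContMDiff ((𝓡 2).prod 𝓘(ℝ, ℝ × ℝ)) 𝓘(ℝ, ℝ × ℝ) ∞ (fun z : S2 × ℝ × ℝ => z.2) :=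
    contMDiff_snd
  exact h1.prodMk_space h2

namespace IsGoodRange

variable {m : ℝ} {f : S2 → ℝ} {s₀ τ₁ τ₂ : ℝ} (R : IsGoodRange m f s₀ τ₁ τ₂) (hτ : τ₁ < τ₂)

local notation "𝓐" => SmoothClass m f s₀ τ₁ τ₂
local notation "Ω" => foliatedRegion m f τ₁ τ₂ s₀
local notation "α" => lapse (gSch m) (timeFun m f)
local notation "θ" => timeFun m f

variable (m f) in
/-- The coefficients of the unit normal in `nullFrame`. -/
noncomputable def normalCoeff : Fin 2 ⊕ Fin 3 → R4 → ℝ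
  | .inl 0 => fun p => -1 * (α p * fderiv ℝ θ p (nullFrame m (.inl 1) p))
  | .inl 1 => fun p => -1 * (α p * fderiv ℝ θ p (nullFrame m (.inl 0) p)) +
      sCoord p * (-1 * (lapseFactor m p * sCoord p *
        (α p * fderiv ℝ θ p (nullFrame m (.inl 1) p))))
  | .inr i => fun p => -1 * (α p * fderiv ℝ θ p (nullFrame m (.inr i) p))

include R hτ

theorem unitNormal_eq {p : R4} (hp : p ∈ Ω) :
    unitNormal (gSch m) θ p = ∑ k, normalCoeff m f k p • nullFrame m k p := by
  have F := R.frame hτ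
  refine (F.eq_sum_frame hp _).trans (Finset.sum_congr rfl fun k _ => ?_)
  congr 1
  simp only [R.apply_unitNormal hτ hp, Fintype.sum_sum_type, Fin.sum_univ_two]
  rcases k with k | i
  · fin_cases k
    · simp [nullCoeff, normalCoeff]
    · simp [nullCoeff, normalCoeff]
      ring
  · simp [nullCoeff, normalCoeff]

theorem smoothClass_lapseFactor_mul : 𝓐 fun p => lapseFactor m p * sCoord p := by
  have F := R.frame hτ
  have hs : 𝓐 sCoord := smoothClass_sCoord
  exact F.congr (F.mul (F.add (F.const 1) (F.mul (F.const (-(2 * m))) hs)) hs) fun p _ => by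
    rw [lapseFactor]; ring

theorem smoothClass_normalCoeff (k : Fin 2 ⊕ Fin 3) : 𝓐 (normalCoeff m f k) := by
  have F := R.frame hτ
  have ha : 𝓐 α := R.isSmoothIn_lapse hτ
  have hd := F.deriv_frame (h := θ) isSmoothIn_timeFun
  have h1 := fun k => F.mul (F.const (-1)) (F.mul ha (hd k))
  rcases k with k | i
  · fin_cases k
    · exact h1 (.inl 1)
    · exact F.add (h1 (.inl 0)) (F.mul smoothClass_sCoord (F.mul (F.const (-1))
        (F.mul (R.smoothClass_lapseFactor_mul hτ) (F.mul ha (hd (.inl 1))))))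
  · exact h1 (.inr i)

variable (m f) in
/-- The values of `normalCoeff` at infinity. -/
noncomputable def normalLimit : Fin 2 ⊕ Fin 3 → R4 → ℝ
  | .inl 0 => fun p => (1 / 2) * ((θ p)⁻¹ * homExt (sphereGradSq f) (sphereVec p) + θ p)
  | .inl 1 => fun p => -1 * (θ p)⁻¹
  | .inr i => fun p => -1 * ((θ p)⁻¹ * tangDeriv f i (sphereVec p))

omit R in
theorem timeFun_ne_zero (R : IsGoodRange m f s₀ τ₁ τ₂) {p : R4} (hp : p ∈ Ω) : θ p ≠ 0 :=
  (R.τ₁_pos.trans_le ((R.isLeafCoord hτ).mapsTo p hp).2.2.1).ne'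

theorem eqModS_normalCoeff (k : Fin 2 ⊕ Fin 3) :
    EqModS 𝓐 Ω (normalCoeff m f k) (normalLimit m f k) := by
  have F := R.frame hτ
  have ha : 𝓐 α := R.isSmoothIn_lapse hτ
  have hd := F.deriv_frame (h := θ) isSmoothIn_timeFun
  have hs : 𝓐 sCoord := smoothClass_sCoord
  have h1 : ∀ {k h}, EqModS 𝓐 Ω (fun p => fderiv ℝ θ p (nullFrame m k p)) h →
      EqModS 𝓐 Ω (fun p => -1 * (α p * fderiv ℝ θ p (nullFrame m k p)))
        (fun p => -1 * (1 * h p)) := fun hk =>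
    F.eqModS_mul hs (F.eqModS_refl (F.const (-1))) (F.eqModS_mul hs (R.eqModS_lapse hτ) hk)
  rcases k with k | i
  · fin_cases k
    · refine F.eqModS_congr_right (h1 (R.eqModS_deriv_one hτ)) fun p hp => ?_
      have := R.timeFun_ne_zero hτ hp
      simp only [normalLimit]
      field_simp
    · refine F.eqModS_congr_right (F.eqModS_add (h1 (R.eqModS_deriv_zero hτ))
        (F.eqModS_zero_of_mul (F.mul (F.const (-1)) (F.mul (R.smoothClass_lapseFactor_mul hτ)
          (F.mul ha (hd (.inl 1))))))) fun p hp => ?_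
      simp only [normalLimit]
      ring
  · refine F.eqModS_congr_right (h1 (R.eqModS_deriv_inr hτ i)) fun p hp => ?_
    simp only [normalLimit]
    ring

theorem eqModS_deriv_mul {h h' d d' : R4 → ℝ} {k : Fin 2 ⊕ Fin 3} (hh : 𝓐 h) (hh' : 𝓐 h')
    (hd : EqModS 𝓐 Ω (fun p => fderiv ℝ h p (nullFrame m k p)) d)
    (hd' : EqModS 𝓐 Ω (fun p => fderiv ℝ h' p (nullFrame m k p)) d') :
    EqModS 𝓐 Ω (fun p => fderiv ℝ (fun p => h p * h' p) p (nullFrame m k p))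
      (fun p => h p * d' p + h' p * d p) := by
  have F := R.frame hτ
  have hs : 𝓐 sCoord := smoothClass_sCoord
  exact AdmissibleFrame.eqModS_congr_left (F.eqModS_add
    (F.eqModS_mul hs (F.eqModS_refl hh) hd') (F.eqModS_mul hs (F.eqModS_refl hh') hd))
    fun p hp => F.fderiv_mul hh hh' hp _

theorem eqModS_deriv_const_mul (a : ℝ) {h d : R4 → ℝ} {k : Fin 2 ⊕ Fin 3} (hh : 𝓐 h)
    (hd : EqModS 𝓐 Ω (fun p => fderiv ℝ h p (nullFrame m k p)) d) :
    EqModS 𝓐 Ω (fun p => fderiv ℝ (fun p => a * h p) p (nullFrame m k p))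
      (fun p => a * d p) := by
  have F := R.frame hτ
  refine AdmissibleFrame.eqModS_congr_left (F.eqModS_mul smoothClass_sCoord
    (F.eqModS_refl (F.const a)) hd) fun p hp => ?_
  rw [F.fderiv_mul (F.const a) hh hp]
  simp

theorem eqModS_deriv_inv {d : R4 → ℝ} {k : Fin 2 ⊕ Fin 3}
    (hd : EqModS 𝓐 Ω (fun p => fderiv ℝ θ p (nullFrame m k p)) d) :
    EqModS 𝓐 Ω (fun p => fderiv ℝ (fun p => (θ p)⁻¹) p (nullFrame m k p))
      (fun p => -1 * ((θ p)⁻¹ * (θ p)⁻¹) * d p) := by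
  have F := R.frame hτ
  have hi : 𝓐 fun p => (θ p)⁻¹ := R.smoothClass_inv
  refine AdmissibleFrame.eqModS_congr_left (F.eqModS_mul smoothClass_sCoord
    (F.eqModS_refl (F.mul (F.const (-1)) (F.mul hi hi))) hd) fun p hp => ?_
  have h1 : HasFDerivAt (fun p => (θ p)⁻¹) _ p :=
    (hasDerivAt_inv (R.timeFun_ne_zero hτ hp)).comp_hasFDerivAt p
      (F.differentiableAt (h := θ) isSmoothIn_timeFun hp).hasFDerivAt
  rw [h1.fderiv]
  change -(θ p ^ 2)⁻¹ * fderiv ℝ θ p (nullFrame m k p) = _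
  rw [pow_two, mul_inv]
  ring

/-- Put `Q = |∇f|²`. Modulo `s` the normal has coefficients `(Q/τ + τ)/2`, `-1/τ` and `-(∇f)_i/τ`.
Their frame derivatives are `(1/τ - Q/τ³)/2`, `-(1/τ + Q/τ³)/2` and, summed over `i`, `Q/τ³`, which
add up to zero. The value `3/τ` comes entirely from the divergence `-3` of `s ∂_s`. -/
theorem eqModS_divergence : EqModS 𝓐 Ω
    (fun p => ∑ a, fderiv ℝ (unitNormal (gSch m) θ) p (coordVec a) a) (fun p => 3 * (θ p)⁻¹) := by
  have F := R.frame hτ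
  have L := R.isLeafCoord hτ
  have hs : 𝓐 sCoord := smoothClass_sCoord
  have ht : 𝓐 θ := isSmoothIn_timeFun
  have hi : 𝓐 fun p => (θ p)⁻¹ := R.smoothClass_inv
  have hQ : 𝓐 fun p => homExt (sphereGradSq f) (sphereVec p) :=
    smoothClass_sphere R.smooth.sphereGradSq
  have hF : ∀ i, 𝓐 fun p => tangDeriv f i (sphereVec p) := fun i =>
    smoothClass_sphere (R.contDiffAt_tangDeriv i)
  have hC := R.eqModS_normalCoeff hτ
  have hD := fun k => F.eqModS_deriv L.subset hs (hC k) k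
  have h0 := F.eqModS_trans (hD (.inl 0)) (R.eqModS_deriv_const_mul hτ (1 / 2)
    (F.add (F.mul hi hQ) ht) (AdmissibleFrame.eqModS_congr_left (F.eqModS_add
      (R.eqModS_deriv_mul hτ hi hQ (R.eqModS_deriv_inv hτ (R.eqModS_deriv_zero hτ))
        (R.eqModS_deriv_sphere hτ R.smooth.sphereGradSq (.inl 0))) (R.eqModS_deriv_zero hτ))
      fun p hp => F.fderiv_add (F.mul hi hQ) ht hp _))
  have h1 := F.eqModS_trans (hD (.inl 1)) (R.eqModS_deriv_const_mul hτ (-1) hi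
    (R.eqModS_deriv_inv hτ (R.eqModS_deriv_one hτ)))
  have h2 := fun i => F.eqModS_trans (hD (.inr i)) (R.eqModS_deriv_const_mul hτ (-1)
    (F.mul hi (hF i)) (R.eqModS_deriv_mul hτ hi (hF i)
      (R.eqModS_deriv_inv hτ (R.eqModS_deriv_inr hτ i))
      (R.eqModS_deriv_sphere hτ (R.contDiffAt_tangDeriv i) (.inr i))))
  have h3 := F.eqModS_mul hs (hC (.inl 1)) (F.eqModS_refl (F.const (-3)))
  have h4 := fun i => F.eqModS_zero_of_mul (F.mul (F.const (-2)) (F.mul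
    (R.smoothClass_normalCoeff hτ (.inr i)) (IsLeafCoord.isSmoothIn_unitComp i)))
  have h5 := F.eqModS_add (F.eqModS_add h0 (F.eqModS_add h1 h3)) (F.eqModS_sum Finset.univ
    fun i => F.eqModS_add (h2 i) (h4 i))
  refine F.eqModS_congr_right (AdmissibleFrame.eqModS_congr_left h5 fun p hp => ?_) fun p hp => ?_
  · rw [F.sum_fderiv_field L.subset (R.smoothClass_normalCoeff hτ)
      (fun q hq => R.unitNormal_eq hτ hq) hp]
    simp only [Fintype.sum_sum_type, Fin.sum_univ_two, Sum.elim_inl, Sum.elim_inr]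
    refine congr_arg₂ _ ?_ (Finset.sum_congr rfl fun i _ => ?_)
    · simp
    · ring
  · have h6 := R.smooth.sum_tangDeriv_sq (sum_sphereVec (L.subset hp).1)
    have h7 := R.timeFun_ne_zero hτ hp
    have h8 : ∀ i : Fin 3, -1 * ((θ p)⁻¹ * 0 + tangDeriv f i (sphereVec p) *
        (-1 * ((θ p)⁻¹ * (θ p)⁻¹) * ((θ p)⁻¹ * tangDeriv f i (sphereVec p)))) + 0 =
        (θ p)⁻¹ ^ 3 * tangDeriv f i (sphereVec p) ^ 2 := fun i => by ring
    simp only [h8, ← Finset.mul_sum, h6, normalLimit]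
    field_simp
    ring

/-- The mean curvature of the leaves is `τ⁻¹` modulo `s`. -/
theorem eqModS_meanCurvature :
    EqModS 𝓐 Ω (meanCurvature (gSch m) (unitNormal (gSch m) θ)) (fun p => (θ p)⁻¹) := by
  have F := R.frame hτ
  have L := R.isLeafCoord hτ
  refine F.eqModS_congr_right (AdmissibleFrame.eqModS_congr_left (F.eqModS_mul smoothClass_sCoord
    (F.eqModS_refl (F.const (1 / 3))) (R.eqModS_divergence hτ)) fun p hp => ?_) fun p hp => ?_
  · rw [F.metric.meanCurvature_eq hp
      (by filter_upwards [F.mem_nhds hp] with q hq using R.unitNormal_unitNormal hτ hq)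
      (F.differentiableAt_field (R.isAdmissibleField_unitNormal hτ) hp)]
    simp only [trace_schInv_mul_pd_gram (L.subset hp), mul_zero, Finset.sum_const_zero, add_zero]
  · ring

/-- The remainder is a member of the algebra, so it extends smoothly to the closed box; restricting
the extension to the sphere gives `Λ`. -/
theorem exists_meanCurvature_remainder : ∃ Λ : S2 × ℝ × ℝ → ℝ,
    ContMDiffOn ((𝓡 2).prod 𝓘(ℝ, ℝ × ℝ)) 𝓘(ℝ) ∞ Λ
      (Set.univ ×ˢ Set.Icc 0 s₀ ×ˢ Set.Icc τ₁ τ₂) ∧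
    ∀ τ ∈ Set.Ioo τ₁ τ₂, ∀ p ∈ leaf m f s₀ τ,
      meanCurvature (gSch m) (unitNormal (gSch m) θ) p
        = τ⁻¹ + sCoord p * Λ (yCoord p, sCoord p, τ) := by
  obtain ⟨-, u, ⟨H, hH, hu⟩, h⟩ := R.eqModS_meanCurvature hτ
  refine ⟨fun z => H ((z.1 : E3), z.2), fun z hz => ?_, fun τ hτm p hp => ?_⟩
  · have hz' : ((z.1 : E3), z.2) ∈ leafBox s₀ τ₁ τ₂ :=
      Set.mk_mem_prod z.1.2 (Set.mem_prod.1 hz).2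
    exact ((hH _ hz').comp_contMDiffAt
      (f := fun z : S2 × ℝ × ℝ => ((z.1 : E3), z.2)) (x := z)
      contMDiff_coe_prod.contMDiffAt).contMDiffWithinAt
  · have hpΩ : p ∈ Ω := Set.mem_biUnion hτm hp
    rw [h p hpΩ, hu p hpΩ, leafCoord, R.timeFun_eq hτ hτm hp]
    simp only [R.timeFun_eq hτ hτm hp, coe_yCoord hp.1]

end IsGoodRange

/-! ### Assembly of the theorem. -/

theorem mainTheorem4 (m : ℝ) (hm : 0 < m) (f : S2 → ℝ) (hf : ContMDiff (𝓡 2) 𝓘(ℝ) ∞ f)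
    (τ₁ τ₂ : ℝ) (hτ₁ : 0 < τ₁) (hτ : τ₁ < τ₂) :
    ∃ s₀ : ℝ, 0 < s₀ ∧ s₀ < 1 / (2 * m) ∧
      -- the leaves foliate an open region, on which `τ` is a smooth function
      IsOpen (foliatedRegion m f τ₁ τ₂ s₀) ∧
      ∃ tau : R4 → ℝ,
        (∀ τ ∈ Set.Ioo τ₁ τ₂, ∀ p ∈ leaf m f s₀ τ, tau p = τ) ∧
        ContDiffOn ℝ ∞ tau (foliatedRegion m f τ₁ τ₂ s₀) ∧
        -- each leaf is spacelike
        (∀ τ ∈ Set.Ioo τ₁ τ₂, ∀ p ∈ leaf m f s₀ τ, ∀ u : R4, u ≠ 0 →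
          fderiv ℝ tau p u = 0 → 0 < gSch m p u u) ∧
        -- `τ` is a time function and `T` is the future pointing unit normal of the leaves
        (∀ p ∈ foliatedRegion m f τ₁ τ₂ s₀,
          gSch m p (metricGrad (gSch m) tau p) (metricGrad (gSch m) tau p) < 0 ∧
          gSch m p (unitNormal (gSch m) tau p) (unitNormal (gSch m) tau p) = -1 ∧
          gSch m p (unitNormal (gSch m) tau p) (coordVec 0) < 0 ∧
          ∀ u : R4, fderiv ℝ tau p u = 0 → gSch m p (unitNormal (gSch m) tau p) u = 0) ∧
        -- uniform bounds
        (∃ C : ℝ, ∀ p ∈ foliatedRegion m f τ₁ τ₂ s₀,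
          lapse (gSch m) tau p ≤ C ∧
          (lapse (gSch m) tau p)⁻¹ ≤ C ∧
          vecNorm (thetaMetric (gSch m) (unitNormal (gSch m) tau)) p
            (metricGrad (gSch m) (lapse (gSch m) tau) p) ≤ C ∧
          tensorNorm1 (thetaMetric (gSch m) (unitNormal (gSch m) tau)) p
            (covDeriv (gSch m) (unitNormal (gSch m) tau) p) ≤ C ∧
          tensorNorm2 (thetaMetric (gSch m) (unitNormal (gSch m) tau)) p
            (covDeriv2 (gSch m) (unitNormal (gSch m) tau) p) ≤ C ∧
          (∃ N : R4, IsMeanCurvatureVector (gSch m) tau sCoord p N) ∧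
          ∀ N : R4, IsMeanCurvatureVector (gSch m) tau sCoord p N →
            vecNorm (thetaMetric (gSch m) (unitNormal (gSch m) tau)) p N ≤ C) ∧
        -- the mean curvature is `τ⁻¹` plus `s` times a function smooth up to `s = 0`
        ∃ Λ : S2 × ℝ × ℝ → ℝ,
          ContMDiffOn ((𝓡 2).prod 𝓘(ℝ, ℝ × ℝ)) 𝓘(ℝ) ∞ Λ
            (Set.univ ×ˢ Set.Icc 0 s₀ ×ˢ Set.Icc τ₁ τ₂) ∧
          ∀ τ ∈ Set.Ioo τ₁ τ₂, ∀ p ∈ leaf m f s₀ τ,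
            meanCurvature (gSch m) (unitNormal (gSch m) tau) p
              = τ⁻¹ + sCoord p * Λ (yCoord p, sCoord p, τ) := by
  have hf' := HasSmoothExt.of_contMDiff hf
  obtain ⟨s₀, hs₀, hs₀m, hbox⟩ := exists_leafBox m hm hf' τ₂ hτ₁
  have R : IsGoodRange m f s₀ τ₁ τ₂ :=
    ⟨hm, hf', hs₀, hs₀m, hτ₁, fun z hz => (hbox z hz).1, fun z hz => (hbox z hz).2⟩
  have L := R.isLeafCoord hτ
  have F := R.frame hτ
  have hT := R.isAdmissibleField_unitNormal hτ
  have hTT := fun p hp => R.unitNormal_unitNormal hτ (p := p) hp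
  have hmem : ∀ τ ∈ Set.Ioo τ₁ τ₂, ∀ p ∈ leaf m f s₀ τ, p ∈ foliatedRegion m f τ₁ τ₂ s₀ :=
    fun τ hτm p hp => Set.mem_biUnion hτm hp
  obtain ⟨C₁, h₁⟩ := F.bounded (R.isSmoothIn_lapse hτ)
  obtain ⟨C₂, h₂⟩ := F.bounded (R.isSmoothIn_lapse_inv hτ)
  obtain ⟨C₃, h₃⟩ := F.vecNorm_bounded hT
    (F.metricGrad_field fun k => F.deriv_frame (R.isSmoothIn_lapse hτ) k)
  obtain ⟨C₄, h₄⟩ := F.covDeriv_bounded hT hTT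
  obtain ⟨C₅, h₅⟩ := F.covDeriv2_bounded hT hTT
  obtain ⟨C₆, h₆⟩ := R.exists_meanCurvatureVector_bound hτ
  refine ⟨s₀, hs₀, hs₀m, L.isOpen, timeFun m f, fun τ hτm p hp => R.timeFun_eq hτ hτm hp,
    fun p hp => (L.smooth_tau p hp).contDiffWithinAt,
    fun τ hτm p hp u hu hut => R.apply_pos_of_tangent hτ (hmem τ hτm p hp) hu hut,
    fun p hp => ⟨?_, hTT p hp, R.unitNormal_future hτ hp, fun u hu => ?_⟩,
    ⟨max C₁ (max C₂ (max C₃ (max C₄ (max C₅ C₆)))), fun p hp => ?_⟩,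
    R.exists_meanCurvature_remainder hτ⟩
  · rw [R.apply_metricGrad_timeFun hτ hp]
    exact neg_lt_zero.2 (R.lapseInvSq_pos' hτ hp)
  · rw [R.apply_unitNormal hτ hp, hu, mul_zero, neg_zero]
  · refine ⟨by simp [h₁ p hp], by simp [h₂ p hp], by simp [h₃ p hp], by simp [h₄ p hp],
      by simp [h₅ p hp], R.exists_isMeanCurvatureVector hτ hp, fun N hN => by simp [h₆ p hp N hN]⟩
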